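/- Let $\mathbb{K}$ be an algebraically closed field of characteristic $0$, let $n \ge 2$, and let $\Gamma \subset \mathbb{P}^n = \mathbb{P}^n_{\mathbb{K}}$ be a finite closed subscheme with ideal sheaf $\mathcal{I}_\Gamma$. For a finite subscheme $Z$ write $|Z| = \operatorname{length}(\mathcal{O}_Z) = h^0(Z,\mathcal{O}_Z)$, its degree. Let $d = |\Gamma|$. Assume that $d \ge 4n^2+6n+1$ and that $\Gamma$ is in linearly general position, i.e. the smallest integer $t$ for which there is a $t$-dimensional linear subspace $\Lambda \subset \mathbb{P}^n$ with $|\Gamma \cap \Lambda| \ge t+2$ is $t = n$. (Intersections are scheme-theoretic.) Write $d = nq+r+2$ with integers $q$ and $0 \le r \le n-1$. Let $\operatorname{reg}(\Gamma)$ be the least integer $p$ such that $H^i(\mathbb{P}^n, \mathcal{I}_\Gamma(p-i)) = 0$ for all $i \ge 1$, and let $\rho(\Gamma)$ be the maximum of $|\Gamma \cap C|$ over all rational normal curves $C$ (of degree $n$) in $\mathbb{P}^n$. Then $$\operatorname{reg}(\Gamma) = \left\lceil \frac{d-1}{n} \right\rceil + 1 \quad\text{if and only if}\quad \rho(\Gamma)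 \ge d-r.$$ In particular, if $r = 0$ and $\operatorname{reg}(\Gamma) = \left\lceil \frac{d-1}{n} \right\rceil + 1$, then $\Gamma$ is a closed subscheme of a rational normal curve in $\mathbb{P}^n$, and $\Gamma$ is in uniform position: $\Gamma$ is nondegenerate (contained in no hyperplane) and $h_Y(\ell) = \min\{|Y|, h_\Gamma(\ell)\}$ for every closed subscheme $Y \subseteq \Gamma$ and every integer $\ell \ge 0$, where $h_Y(\ell)$ is the dimension of the degree $\ell$ part of the homogeneous coordinate ring $\mathbb{K}[x_0,\dots,x_n]/I(Y)$, with $I(Y)$ the saturated homogeneous ideal of $Y$. (When $\Gamma$ is reduced, its closed subschemes are its subsets, and this is the usual definition for finite sets of points.) -/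

import Mathlib

noncomputable section

namespace ProjSub

open MvPolynomial

variable {K : Type*} [Field K] {n : ℕ}

/-- A closed subscheme of `ℙⁿ` over `K`, given by its saturated homogeneous ideal in the homogeneous
coordinate ring `K[x₀, …, xₙ]` (closed subschemes of `ℙⁿ` correspond bijectively to these ideals).
The empty subscheme is given by the unit ideal. -/
@[ext]
structure ClosedSubscheme (K : Type*) [Field K] (n : ℕ) where
  /-- the saturated homogeneous ideal `I(Γ)` -/
  ideal : Ideal (MvPolynomial (Fin (n + 1)) K)
  homogeneous : ∀ f ∈ ideal, ∀ m : ℕ, homogeneousComponent m f ∈ ideal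
  saturated : ∀ f, (∀ i, ∃ N : ℕ, X i ^ N * f ∈ ideal) → f ∈ ideal

/-! ### Sections of twisted ideal sheaves and Čech cohomology -/

/-- The ring `K[x₀^{±1}, …, xₙ^{±1}]` of Laurent polynomials. -/
abbrev Laurent (K : Type*) [Field K] (n : ℕ) : Type _ :=
  AddMonoidAlgebra K (Fin (n + 1) → ℤ)

/-- The variable `xᵢ` as a Laurent polynomial. -/
def Laurent.x (K : Type*) [Field K] {n : ℕ} (i : Fin (n + 1)) : Laurent K n :=
  AddMonoidAlgebra.single (Pi.single i 1) 1

/-- The inclusion of the homogeneous coordinate ring into the Laurent polynomials. -/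
def toLaurent (K : Type*) [Field K] (n : ℕ) :
    MvPolynomial (Fin (n + 1)) K →ₐ[K] Laurent K n :=
  aeval (Laurent.x K)

/-- Let `ℐ` be the ideal sheaf on `ℙⁿ` of the homogeneous ideal `I`. For a set `S` of variables with
product `x_S`, this is `Γ(D₊(x_S), ℐ(m))`, that is, the degree `m` part of the localization of `I`
at `x_S`, inside the Laurent polynomials. For `I = ⊤` it is `Γ(D₊(x_S), 𝒪(m))`. -/
def sections (I : Ideal (MvPolynomial (Fin (n + 1)) K)) (m : ℤ) (S : Finset (Fin (n + 1))) :
    Submodule K (Laurent K n) where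
  carrier := {f | (∀ e ∈ Finsupp.support f.coeff, ∑ i, e i = m) ∧
    ∃ N : ℕ, ∃ g ∈ I, (∏ i ∈ S, Laurent.x K i) ^ N * f = toLaurent K n g}
  zero_mem' := by
    refine ⟨by simp, 0, 0, I.zero_mem, by simp⟩
  add_mem' := by
    classical
    rintro f₁ f₂ ⟨h₁, N₁, g₁, hg₁, e₁⟩ ⟨h₂, N₂, g₂, hg₂, e₂⟩
    refine ⟨fun e he => ?_, N₁ + N₂,
      (∏ i ∈ S, X i) ^ N₂ * g₁ + (∏ i ∈ S, X i) ^ N₁ * g₂,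
      I.add_mem (I.mul_mem_left _ hg₁) (I.mul_mem_left _ hg₂), ?_⟩
    · rcases Finset.mem_union.1 (Finsupp.support_add he) with h | h
      exacts [h₁ e h, h₂ e h]
    · have hx : toLaurent K n (∏ i ∈ S, X i) = ∏ i ∈ S, Laurent.x K i := by
        simp [toLaurent]
      rw [map_add, map_mul, map_mul, map_pow, map_pow, hx, ← e₁, ← e₂]
      ring
  smul_mem' := by
    rintro a f ⟨h, N, g, hg, e⟩
    refine ⟨fun e' he => h e' (Finsupp.support_smul he), N, a • g, ?_, ?_⟩
    · rw [smul_eq_C_mul]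
      exact I.mul_mem_left _ hg
    · rw [map_smul, ← e, mul_smul_comm]

/-- The (ordered) Čech cochains of degree `p` of `ℐ(m)` for the covering of `ℙⁿ` by the standard
affine opens `D₊(x₀), …, D₊(xₙ)`: a section over each `D₊(x_{s 0} ⋯ x_{s p})`,
`s 0 < ⋯ < s p`. -/
def cochains (I : Ideal (MvPolynomial (Fin (n + 1)) K)) (m : ℤ) (p : ℕ) :
    Submodule K ((Fin (p + 1) ↪o Fin (n + 1)) → Laurent K n) :=
  Submodule.pi Set.univ fun s => sections I m (Finset.univ.map s.toEmbedding)

/-- The Čech coboundary `(dc)(s) = ∑ₖ (-1)ᵏ c(s with its k-th entry omitted)`. -/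
def coboundary (K : Type*) [Field K] (n p : ℕ) :
    ((Fin (p + 1) ↪o Fin (n + 1)) → Laurent K n) →ₗ[K]
      ((Fin (p + 2) ↪o Fin (n + 1)) → Laurent K n) :=
  LinearMap.pi fun s => ∑ k : Fin (p + 2),
    (-1 : K) ^ (k : ℕ) • LinearMap.proj ((Fin.succAboveOrderEmb k).trans s)

/-- Čech cocycles of `ℐ(m)`. -/
def cocycles (I : Ideal (MvPolynomial (Fin (n + 1)) K)) (m : ℤ) (p : ℕ) :
    Submodule K ((Fin (p + 1) ↪o Fin (n + 1)) → Laurent K n) :=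
  cochains I m p ⊓ LinearMap.ker (coboundary K n p)

/-- Čech coboundaries of `ℐ(m)`. -/
def coboundaries (I : Ideal (MvPolynomial (Fin (n + 1)) K)) (m : ℤ) : (p : ℕ) →
    Submodule K ((Fin (p + 1) ↪o Fin (n + 1)) → Laurent K n)
  | 0 => ⊥
  | p + 1 => (cochains I m p).map (coboundary K n p)

/-- The cohomology `Hᵖ(ℙⁿ, ℐ(m))` of the twisted ideal sheaf. -/
abbrev cohomology (I : Ideal (MvPolynomial (Fin (n + 1)) K)) (m : ℤ) (p : ℕ) : Type _ :=
  cocycles I m p ⧸ (coboundaries I m p).submoduleOf (cocycles I m p)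

/-- The `0`-cochains of `𝒪(m)` whose classes modulo `ℐ(m)` agree on the overlaps, i.e. which
give a global section of `𝒪(m)/ℐ(m)`. -/
def quotientCocycles (I : Ideal (MvPolynomial (Fin (n + 1)) K)) (m : ℤ) :
    Submodule K ((Fin 1 ↪o Fin (n + 1)) → Laurent K n) :=
  cochains ⊤ m 0 ⊓ (cochains I m 1).comap (coboundary K n 0)

/-- `H⁰(Z, 𝒪_Z)` for the subscheme `Z` of `ℙⁿ` defined by the homogeneous ideal `I`: families of
regular functions on the `D₊(xᵢ)` agreeing modulo `ℐ` on overlaps, modulo families of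
sections of `ℐ`. -/
abbrev globalSections (I : Ideal (MvPolynomial (Fin (n + 1)) K)) : Type _ :=
  quotientCocycles I 0 ⧸ (cochains I 0 0).submoduleOf (quotientCocycles I 0)

/-- `h⁰(Z, 𝒪_Z)` for the subscheme `Z` of `ℙⁿ` defined by the homogeneous ideal `I` (which need not
be saturated). For a finite scheme `Z` this is the length of `𝒪_Z`. -/
def length (I : Ideal (MvPolynomial (Fin (n + 1)) K)) : ℕ :=
  Module.finrank K (globalSections I)

namespace ClosedSubscheme

/-- `Γ` is finite over `K`: its intersection with each standard affine open `D₊(xᵢ)` is the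
spectrum of a finite dimensional `K`-algebra. -/
def IsFinite (Γ : ClosedSubscheme K n) : Prop :=
  ∀ i : Fin (n + 1), FiniteDimensional K
    (sections (⊤ : Ideal (MvPolynomial (Fin (n + 1)) K)) 0 {i} ⧸
      (sections Γ.ideal 0 {i}).submoduleOf (sections ⊤ 0 {i}))

/-- The degree `|Γ|` of a finite subscheme: the length of `𝒪_Γ`. -/
def degree (Γ : ClosedSubscheme K n) : ℕ := length Γ.ideal

/-- The degree `|Γ ∩ Z|` of the scheme-theoretic intersection, which is defined by the sum of the
two ideal sheaves. -/
def interDegree (Γ Z : ClosedSubscheme K n) : ℕ := length (Γ.ideal ⊔ Z.ideal)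

/-- `Y` is a closed subscheme of `Γ`. -/
def IsSubscheme (Y Γ : ClosedSubscheme K n) : Prop := Γ.ideal ≤ Y.ideal

/-- `Γ` is `p`-regular in the sense of Castelnuovo and Mumford. -/
def IsRegular (Γ : ClosedSubscheme K n) (p : ℤ) : Prop :=
  ∀ i : ℕ, 1 ≤ i → Subsingleton (cohomology Γ.ideal (p - i) i)

/-- The Castelnuovo–Mumford regularity of `Γ`: the least integer `p` such that `Γ` is
`p`-regular. -/
def reg (Γ : ClosedSubscheme K n) : ℤ := sInf {p : ℤ | Γ.IsRegular p}

/-- `Z` is a linear subspace of `ℙⁿ` of dimension `t`: its ideal is generated by a space of linear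
forms of dimension `n - t`. -/
def IsPlane (Z : ClosedSubscheme K n) (t : ℕ) : Prop :=
  ∃ L : Submodule K (MvPolynomial (Fin (n + 1)) K),
    L ≤ homogeneousSubmodule (Fin (n + 1)) K 1 ∧ Module.finrank K L + t = n ∧
      Z.ideal = Ideal.span (L : Set (MvPolynomial (Fin (n + 1)) K))

/-- `t(Γ)`, the smallest `t` such that `Γ` admits a `(t+2)`-secant `t`-plane. -/
def secantIndex (Γ : ClosedSubscheme K n) : ℕ :=
  sInf {t : ℕ | ∃ Z : ClosedSubscheme K n, Z.IsPlane t ∧ t + 2 ≤ Γ.interDegree Z}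

/-- `Γ ⊆ ℙⁿ` is in linearly general position. -/
def InLinearlyGeneralPosition (Γ : ClosedSubscheme K n) : Prop :=
  Γ.secantIndex = n

/-- `C` is a rational normal curve (of degree `n`) in `ℙⁿ`: the image of the embedding
`ℙ¹ → ℙⁿ`, `(s : t) ↦ (F₀(s,t) : ⋯ : Fₙ(s,t))`, for a basis `F₀, …, Fₙ` of the binary forms of
degree `n`. -/
def IsRationalNormalCurve (C : ClosedSubscheme K n) : Prop :=
  ∃ F : Module.Basis (Fin (n + 1)) K (homogeneousSubmodule (Fin 2) K n),
    C.ideal = RingHom.ker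
      (aeval fun i => (F i : MvPolynomial (Fin 2) K) :
        MvPolynomial (Fin (n + 1)) K →ₐ[K] MvPolynomial (Fin 2) K)

/-- `ρ(Γ)`, the maximum of `|Γ ∩ C|` over all rational normal curves `C` in `ℙⁿ`. -/
def rho (Γ : ClosedSubscheme K n) : ℕ :=
  sSup {k : ℕ | ∃ C : ClosedSubscheme K n, C.IsRationalNormalCurve ∧ Γ.interDegree C = k}

/-- The Hilbert function: the dimension of the image of the forms of degree `l` in `K[x]/I(Γ)`. -/
def hilbertFunction (Γ : ClosedSubscheme K n) (l : ℕ) : ℕ :=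
  Module.finrank K ((homogeneousSubmodule (Fin (n + 1)) K l).map
    (Ideal.Quotient.mkₐ K Γ.ideal).toLinearMap)

/-- `Γ` is not contained in a hyperplane. -/
def IsNondegenerate (Γ : ClosedSubscheme K n) : Prop :=
  ∀ f ∈ homogeneousSubmodule (Fin (n + 1)) K 1, f ∈ Γ.ideal → f = 0

/-- `Γ` is in uniform position: it is finite and nondegenerate, and
`h_Y(l) = min {|Y|, h_Γ(l)}` for every closed subscheme `Y` of `Γ` and every `l ≥ 0`. When `Γ` is
reduced, i.e. a finite set of points, its closed subschemes are its subsets. -/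
def InUniformPosition (Γ : ClosedSubscheme K n) : Prop :=
  Γ.IsFinite ∧ Γ.IsNondegenerate ∧
    ∀ Y : ClosedSubscheme K n, Y.IsSubscheme Γ → ∀ l : ℕ,
      Y.hilbertFunction l = min Y.degree (Γ.hilbertFunction l)

end ClosedSubscheme

end ProjSub

end

/-! Choose a linear form `L` without zeros on `Γ`. Then `Γ` is affine with ring `A = K[x]/(I(Γ) + (L
- 1))`, of dimension `d`. If `V` denotes the image of the linear forms in `A`, then `1 ∈ V` and the
forms of degree `m` restrict to `V ^ m`. A Čech computation shows that `H¹(ℐ(m)) = 0` exactly when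
`V ^ m = A`, while the higher cohomology vanishes in every twist that matters. So the regularity is
one more than the least `m` with `V ^ m = A`.

Linearly general position says that `A/(v)` has length at most `n` for every nonzero `v ∈ V`, so `V`
spans every quotient of length at most `n + 1` (`SpansSmallQuotients`). Passing to residual schemes,
`V ^ l` spans every quotient of length at most `nl + 1` (`pow_sup_eq_top`). Since `d ≤ n(q + 1) +
1`, this gives `V ^ (q + 1) = A`. The extremal regularity is `q + 2`, and it occurs exactly when `V
^ q ≠ A`.

If a rational normal curve meets `Γ` in length at least `nq + 2 = d - r`, then `V ^ q ≠ A`, because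
forms of degree `q` have rank at most `nq + 1` on the curve.

Conversely, let `V ^ q ≠ A` and pass to a minimal subscheme `Spec B` on which forms of degree `q` do
not span. It has length at least `nq + 2`. By minimality `V ^ q` contains no nonzero ideal of `B`,
so linear forms are nonzerodivisors in low degrees and the Hilbert function grows by at least `n` at
each step. As it reaches at most `nq + n` in degree `q ≥ 2n`, two consecutive steps are exactly `n`
(`exists_finrank_pow_eq`). There, a pencil of hyperplanes through a subscheme of length `n - 1` acts
as a Kronecker pencil with a single chain, and comparing the chains in two consecutive degrees
yields a basis `v 0, …, v n` of `V` satisfying the determinantal quadrics of a rational normal curve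
(`exists_basis_of_pow`). These cut out the curve scheme-theoretically
(`exists_rationalNormalCurve_of_relations`), so `Spec B` lies on it.

If `r = 0`, then `Spec B` is all of `Γ`. Every subscheme `Y` then has Hilbert function `min(|Y|, nl
+ 1)`: the lower bound comes from general position, the upper one from the curve. -/

noncomputable section

namespace ProjSub

open Module

/-! ### Finite algebras in linearly general position -/

section GeneralPosition

variable {K : Type*} [Field K] {A : Type*} [CommRing A] [Algebra K A]

theorem finrank_quotient_add_finrank_ideal [FiniteDimensional K A] (J : Ideal A) :
    finrank K (A ⧸ J) + finrank K J = finrank K A := by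
  rw [← (Submodule.Quotient.restrictScalarsEquiv K J).finrank_eq]
  exact (J.restrictScalars K).finrank_quotient_add_finrank

theorem finrank_quotient_le_of_le [FiniteDimensional K A] {J J' : Ideal A} (h : J ≤ J') :
    finrank K (A ⧸ J') ≤ finrank K (A ⧸ J) :=
  (Ideal.Quotient.factorₐ K h).toLinearMap.finrank_le_finrank_of_surjective
    (Ideal.Quotient.factor_surjective h)

theorem finrank_sup_ideal [FiniteDimensional K A] (W : Submodule K A) (J : Ideal A)
    (h : W ⊔ J.restrictScalars K = ⊤) :
    finrank K ↥(W ⊓ J.restrictScalars K) + finrank K (A ⧸ J) = finrank K W := by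
  have h1 := Submodule.finrank_sup_add_finrank_inf_eq W (J.restrictScalars K)
  have h2 := finrank_quotient_add_finrank_ideal (K := K) J
  have h3 : finrank K ↥(J.restrictScalars K) = finrank K J := rfl
  rw [h, finrank_top] at h1
  omega

/-- An ideal `J` maximal among those between `J₀` and `J₁` and different from `J₁` makes `J₁/J` a
simple module. Simple modules are one-dimensional because the residue fields equal `K`. -/
theorem exists_ideal_finrank_quotient_succ [IsAlgClosed K] [FiniteDimensional K A]
    {J₀ J₁ : Ideal A} (h : J₀ < J₁) :
    ∃ J, J₀ ≤ J ∧ J < J₁ ∧ finrank K (A ⧸ J) = finrank K (A ⧸ J₁) + 1 := by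
  have : IsNoetherianRing A := IsNoetherianRing.of_finite K A
  obtain ⟨J, hJ, hmax⟩ := set_has_maximal_iff_noetherian.2 this {J : Ideal A | J₀ ≤ J ∧ J < J₁}
    ⟨J₀, le_rfl, h⟩
  refine ⟨J, hJ.1, hJ.2, ?_⟩
  obtain ⟨x, hx1, hx⟩ := SetLike.exists_of_lt hJ.2
  have key : ∀ y ∈ J₁, y ∉ J → J ⊔ Ideal.span {y} = J₁ := by
    intro y hy1 hy
    by_contra hne
    have hle : J ⊔ Ideal.span {y} ≤ J₁ := sup_le hJ.2.le (by simpa [Ideal.span_le] using hy1)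
    refine hmax (J ⊔ Ideal.span {y}) ⟨hJ.1.trans le_sup_left, lt_of_le_of_ne hle hne⟩ ?_
    refine lt_of_le_of_ne le_sup_left fun he => hy ?_
    rw [he]
    exact Ideal.mem_sup_right (Ideal.mem_span_singleton_self y)
  -- `J₁/J` is generated by the class of `x`, with annihilator `m`. Maximality of `m` reduces
  -- coefficients of `x` to scalars modulo `J`.
  let m : Ideal A := J.colon {x}
  have hm : ∀ a, a ∈ m ↔ a * x ∈ J := fun a => by simp [m, Submodule.mem_colon_singleton]
  have hmm : m.IsMaximal := by
    rw [Ideal.isMaximal_iff]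
    refine ⟨by simpa [hm] using hx, fun I a hI ham haI => ?_⟩
    have h1 := key (a * x) (J₁.mul_mem_left a hx1) (by rwa [hm] at ham)
    rw [← h1, Submodule.mem_sup] at hx1
    obtain ⟨j, hj, z, hz, e⟩ := hx1
    obtain ⟨b, rfl⟩ := Ideal.mem_span_singleton'.1 hz
    have : 1 - b * a ∈ m := by
      rw [hm]
      convert hj using 1
      linear_combination -e
    have h2 := I.add_mem (hI this) (I.mul_mem_left b haI)
    simpa using h2
  have hsurj : Function.Surjective (algebraMap K (A ⧸ m)) :=
    letI := Ideal.Quotient.field m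
    IsAlgClosed.algebraMap_bijective_of_isIntegral.2
  have hJ1 : J₁.restrictScalars K ≤ J.restrictScalars K ⊔ K ∙ x := by
    intro y hy
    have hy' : y ∈ J ⊔ Ideal.span {x} := by rw [key x hx1 hx]; exact hy
    obtain ⟨j, hj, z, hz, rfl⟩ := Submodule.mem_sup.1 hy'
    obtain ⟨a, rfl⟩ := Ideal.mem_span_singleton'.1 hz
    obtain ⟨c, hc⟩ := hsurj (Ideal.Quotient.mk m a)
    have hc' : a - algebraMap K A c ∈ m := by
      rw [← Ideal.Quotient.eq, ← hc]; rfl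
    rw [hm] at hc'
    refine Submodule.mem_sup.2 ⟨j + (a - algebraMap K A c) * x, J.add_mem hj hc', c • x,
      Submodule.smul_mem _ _ (Submodule.mem_span_singleton_self x), ?_⟩
    rw [Algebra.smul_def]
    ring
  have h1 : finrank K J₁ ≤ finrank K J + 1 := by
    have := (Submodule.finrank_mono hJ1).trans (Submodule.finrank_add_le_finrank_add_finrank _ _)
    have h4 := finrank_span_singleton (K := K) (v := x) (by rintro rfl; exact hx J.zero_mem)
    rw [h4] at this
    exact this
  have h2 : finrank K J < finrank K J₁ := by
    have : J.restrictScalars K < J₁.restrictScalars K := hJ.2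
    exact Submodule.finrank_lt_finrank_of_lt this
  have h3 := finrank_quotient_add_finrank_ideal (K := K) J
  have h4 := finrank_quotient_add_finrank_ideal (K := K) J₁
  omega

theorem exists_ideal_finrank_quotient_eq [IsAlgClosed K] [FiniteDimensional K A]
    {J₀ J₁ : Ideal A} (h : J₀ ≤ J₁) {k : ℕ} (h1 : finrank K (A ⧸ J₁) ≤ k)
    (h0 : k ≤ finrank K (A ⧸ J₀)) :
    ∃ J, J₀ ≤ J ∧ J ≤ J₁ ∧ finrank K (A ⧸ J) = k := by
  induction k, h1 using Nat.le_induction with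
  | base => exact ⟨J₁, h, le_rfl, rfl⟩
  | succ k hk ih =>
    obtain ⟨J, hJ0, hJ1, hJ⟩ := ih (by omega)
    have hlt : J₀ < J := lt_of_le_of_ne hJ0 (by rintro rfl; omega)
    obtain ⟨J', h0', hlt', hJ'⟩ := exists_ideal_finrank_quotient_succ (K := K) hlt
    exact ⟨J', h0', hlt'.le.trans hJ1, by omega⟩

theorem exists_ideal_finrank_quotient [IsAlgClosed K] [FiniteDimensional K A] {k : ℕ}
    (h : k ≤ finrank K A) : ∃ J : Ideal A, finrank K (A ⧸ J) = k := by
  have h0 : finrank K (A ⧸ (⊥ : Ideal A)) = finrank K A :=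
    (AlgEquiv.quotientBot K A).toLinearEquiv.finrank_eq
  have h1 : finrank K (A ⧸ (⊤ : Ideal A)) = 0 := by
    have : Subsingleton (A ⧸ (⊤ : Ideal A)) := Ideal.Quotient.subsingleton_iff.2 rfl
    exact finrank_zero_of_subsingleton
  obtain ⟨J, -, -, hJ⟩ := exists_ideal_finrank_quotient_eq (K := K) (bot_le : ⊥ ≤ (⊤ : Ideal A))
    (k := k) (by omega) (by omega)
  exact ⟨J, hJ⟩

/-- The space `V` of functions on the finite scheme `Spec A` surjects onto the functions on every
subscheme of length at most `n + 1`. -/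
def SpansSmallQuotients (V : Submodule K A) (n : ℕ) : Prop :=
  ∀ J : Ideal A, finrank K (A ⧸ J) ≤ n + 1 → V ⊔ J.restrictScalars K = ⊤

theorem exists_mem_ideal_of_finrank_lt [FiniteDimensional K A] (V : Submodule K A) (J : Ideal A)
    (h : finrank K (A ⧸ J) < finrank K V) : ∃ v ∈ V, v ∈ J ∧ v ≠ 0 := by
  let f : V →ₗ[K] (A ⧸ J) := (Ideal.Quotient.mkₐ K J).toLinearMap ∘ₗ V.subtype
  have : LinearMap.ker f ≠ ⊥ := LinearMap.ker_ne_bot_of_finrank_lt h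
  obtain ⟨v, hv, hv0⟩ := Submodule.exists_mem_ne_zero_of_ne_bot this
  exact ⟨v, v.2, Ideal.Quotient.eq_zero_iff_mem.1 hv, by simpa using hv0⟩

/-- It suffices to treat length exactly `n + 1`, by shrinking the ideal. There `V` meets the ideal
in zero, as a nonzero element would define a scheme of length more than `n`, and the dimensions then
force a direct sum. -/
theorem spansSmallQuotients_of_finrank_le [IsAlgClosed K] [FiniteDimensional K A]
    {V : Submodule K A} {n : ℕ} (hV : finrank K V = n + 1) (hA : n + 1 ≤ finrank K A)
    (h : ∀ v ∈ V, v ≠ 0 → finrank K (A ⧸ Ideal.span {v}) ≤ n) : SpansSmallQuotients V n := by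
  intro J hJ
  have h0 : finrank K (A ⧸ (⊥ : Ideal A)) = finrank K A :=
    (AlgEquiv.quotientBot K A).toLinearEquiv.finrank_eq
  obtain ⟨J', -, hle, hJ'⟩ := exists_ideal_finrank_quotient_eq (K := K) (bot_le : ⊥ ≤ J)
    (k := n + 1) hJ (by omega)
  have hinf : V ⊓ J'.restrictScalars K = ⊥ := by
    rw [Submodule.eq_bot_iff]
    rintro v ⟨hv, hvJ⟩
    by_contra hv0
    have h1 := h v hv hv0
    have h2 : finrank K (A ⧸ J') ≤ finrank K (A ⧸ Ideal.span {v}) :=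
      finrank_quotient_le_of_le ((Ideal.span_singleton_le_iff_mem _).2 hvJ)
    omega
  have h1 := Submodule.finrank_sup_add_finrank_inf_eq V (J'.restrictScalars K)
  have h2 := finrank_quotient_add_finrank_ideal (K := K) J'
  have h3 : finrank K ↥(J'.restrictScalars K) = finrank K J' := rfl
  rw [hinf, finrank_bot] at h1
  have : V ⊔ J'.restrictScalars K = ⊤ := Submodule.eq_top_of_finrank_eq (by omega)
  rw [eq_top_iff, ← this]
  exact sup_le_sup_left (fun x hx => hle hx : J'.restrictScalars K ≤ J.restrictScalars K) V

namespace SpansSmallQuotients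

variable {V : Submodule K A} {n : ℕ}

theorem finrank_quotient_span_le [IsAlgClosed K] [FiniteDimensional K A]
    (h : SpansSmallQuotients V n) (hV : finrank K V = n + 1) {v : A} (hv : v ∈ V) (hv0 : v ≠ 0) :
    finrank K (A ⧸ Ideal.span {v}) ≤ n := by
  by_contra! hlt
  have h1 : finrank K (A ⧸ (⊤ : Ideal A)) = 0 := by
    have : Subsingleton (A ⧸ (⊤ : Ideal A)) := Ideal.Quotient.subsingleton_iff.2 rfl
    exact finrank_zero_of_subsingleton
  obtain ⟨J, hJ, -, hJn⟩ := exists_ideal_finrank_quotient_eq (K := K)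
    (le_top : Ideal.span {v} ≤ ⊤) (k := n + 1) (by omega) hlt
  have h2 := finrank_sup_ideal V J (h J hJn.le)
  have h3 : finrank K ↥(V ⊓ J.restrictScalars K) = 0 := by omega
  rw [Submodule.finrank_eq_zero] at h3
  have : v ∈ V ⊓ J.restrictScalars K := ⟨hv, (Ideal.span_singleton_le_iff_mem _).1 hJ⟩
  rw [h3] at this
  exact hv0 (by simpa using this)

theorem sup_span_eq_top [IsAlgClosed K] [FiniteDimensional K A]
    (h : SpansSmallQuotients V n) (hV : finrank K V = n + 1) {v : A} (hv : v ∈ V) (hv0 : v ≠ 0) :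
    V ⊔ (Ideal.span {v}).restrictScalars K = ⊤ :=
  h _ ((h.finrank_quotient_span_le hV hv hv0).trans (by omega))

theorem pow_sup_mono (h1 : 1 ∈ V) {l m : ℕ} (hlm : l ≤ m) : V ^ l ≤ V ^ m :=
  pow_le_pow_right₀ (Submodule.one_le.2 h1) hlm

/-- A subscheme of length at most `n l + 1` imposes independent conditions on forms of
degree `l`. -/
theorem pow_sup_eq_top [IsAlgClosed K] [FiniteDimensional K A]
    (h : SpansSmallQuotients V n) (hV : finrank K V = n + 1) (h1 : 1 ∈ V) (l : ℕ) :
    ∀ J : Ideal A, finrank K (A ⧸ J) ≤ n * l + 1 → V ^ l ⊔ J.restrictScalars K = ⊤ := by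
  induction l with
  | zero =>
    intro J hJ
    rcases eq_or_ne J ⊤ with rfl | hJt
    · rw [eq_top_iff]; exact le_sup_of_le_right le_rfl
    have hinf : (1 : Submodule K A) ⊓ J.restrictScalars K = ⊥ := by
      rw [Submodule.eq_bot_iff]
      rintro v ⟨hv, hvJ⟩
      obtain ⟨c, rfl⟩ := Submodule.mem_one.1 hv
      by_contra hc
      have hc0 : c ≠ 0 := by rintro rfl; simp at hc
      refine hJt ((Ideal.eq_top_iff_one _).2 ?_)
      have := J.mul_mem_left (algebraMap K A c⁻¹) hvJ
      rwa [← map_mul, inv_mul_cancel₀ hc0, map_one] at this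
    have hA : Nontrivial A := by
      by_contra hn
      rw [not_nontrivial_iff_subsingleton] at hn
      exact hJt (Subsingleton.elim _ _)
    have h1 := Submodule.finrank_sup_add_finrank_inf_eq (1 : Submodule K A) (J.restrictScalars K)
    have h2 := finrank_quotient_add_finrank_ideal (K := K) J
    have h3 : finrank K ↥(J.restrictScalars K) = finrank K J := rfl
    have h4 : finrank K (1 : Submodule K A) = 1 := by
      rw [Submodule.one_eq_span]; exact finrank_span_singleton one_ne_zero
    have h5 := Submodule.finrank_le ((1 : Submodule K A) ⊔ J.restrictScalars K)
    rw [hinf, finrank_bot] at h1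
    rw [pow_zero]
    exact Submodule.eq_top_of_finrank_eq (by omega)
  | succ l ih =>
    intro J hJ
    by_cases hJn : finrank K (A ⧸ J) ≤ n
    · rw [eq_top_iff, ← h J (by omega)]
      refine sup_le_sup_right ?_ _
      simpa using pow_sup_mono h1 (show 1 ≤ l + 1 by omega)
    push Not at hJn
    have ht : finrank K (A ⧸ (⊤ : Ideal A)) = 0 := by
      have : Subsingleton (A ⧸ (⊤ : Ideal A)) := Ideal.Quotient.subsingleton_iff.2 rfl
      exact finrank_zero_of_subsingleton
    obtain ⟨J₁, hJJ₁, -, hJ₁⟩ := exists_ideal_finrank_quotient_eq (K := K)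
      (le_top : J ≤ ⊤) (k := n) (by omega) hJn.le
    -- A hyperplane `v` through a length `n` part of the scheme. The residual scheme `Q = (J : v)`
    -- is shorter by at least `n`, so induction applies to it.
    obtain ⟨v, hv, hvJ, hv0⟩ := exists_mem_ideal_of_finrank_lt V J₁ (by omega)
    have hsup := h.sup_span_eq_top hV hv hv0
    have hge : n ≤ finrank K (A ⧸ (J ⊔ Ideal.span {v})) := by
      rw [← hJ₁]
      exact finrank_quotient_le_of_le
        (sup_le hJJ₁ ((Ideal.span_singleton_le_iff_mem _).2 hvJ))
    let Q : Ideal A := J.colon {v}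
    have hQ : ∀ a, a ∈ Q ↔ a * v ∈ J := fun a => by simp [Q, Submodule.mem_colon_singleton]
    have hdim : finrank K (A ⧸ Q) + finrank K (A ⧸ (J ⊔ Ideal.span {v})) ≤ finrank K (A ⧸ J) := by
      let f : A →ₗ[K] A ⧸ J := (Ideal.Quotient.mkₐ K J).toLinearMap ∘ₗ LinearMap.mulRight K v
      let g : (A ⧸ J) →ₗ[K] A ⧸ (J ⊔ Ideal.span {v}) :=
        (Ideal.Quotient.factorₐ K (le_sup_left : J ≤ J ⊔ Ideal.span {v})).toLinearMap
      have hf : finrank K (LinearMap.range f) = finrank K (A ⧸ Q) := by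
        have e1 := f.finrank_range_add_finrank_ker
        have e2 := finrank_quotient_add_finrank_ideal (K := K) Q
        have e3 : LinearMap.ker f = Q.restrictScalars K := by
          ext a
          change Ideal.Quotient.mk J (a * v) = 0 ↔ a ∈ Q
          rw [hQ, Ideal.Quotient.eq_zero_iff_mem]
        have e4 : finrank K ↥(Q.restrictScalars K) = finrank K Q := rfl
        rw [e3] at e1
        omega
      have hg : finrank K (LinearMap.range g) = finrank K (A ⧸ (J ⊔ Ideal.span {v})) := by
        rw [LinearMap.range_eq_top.2, finrank_top]
        exact Ideal.Quotient.factor_surjective le_sup_left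
      have hle : LinearMap.range f ≤ LinearMap.ker g := by
        rintro _ ⟨a, rfl⟩
        rw [LinearMap.mem_ker]
        change (Ideal.Quotient.mk (J ⊔ Ideal.span {v})) (a * v) = 0
        rw [Ideal.Quotient.eq_zero_iff_mem]
        exact Ideal.mem_sup_right (Ideal.mul_mem_left _ _ (Ideal.mem_span_singleton_self v))
      have := g.finrank_range_add_finrank_ker
      have := Submodule.finrank_mono hle
      omega
    have hind := ih Q (by rw [mul_add, mul_one] at hJ; omega)
    rw [eq_top_iff]
    intro a _
    have ha : a ∈ V ⊔ (Ideal.span {v}).restrictScalars K := by rw [hsup]; trivial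
    obtain ⟨w, hw, z, hz, rfl⟩ := Submodule.mem_sup.1 ha
    obtain ⟨b, rfl⟩ := Ideal.mem_span_singleton'.1 hz
    have hb : b ∈ V ^ l ⊔ Q.restrictScalars K := by rw [hind]; trivial
    obtain ⟨w', hw', c, hc, rfl⟩ := Submodule.mem_sup.1 hb
    -- `A = V + (v)` writes the element as `w + b v`, and `b` is a form of degree `l` modulo the
    -- residual ideal, whose product with `v` lies in `J`.
    refine Submodule.mem_sup.2 ⟨w + w' * v, Submodule.add_mem _ ?_ ?_, c * v, (hQ c).1 hc, by ring⟩
    · have := pow_sup_mono h1 (show 1 ≤ l + 1 by omega)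
      exact this (by simpa using hw)
    · rw [pow_succ]
      exact Submodule.mul_mem_mul hw' hv

theorem map_quotient (h : SpansSmallQuotients V n) (J : Ideal A) :
    SpansSmallQuotients (V.map (Ideal.Quotient.mkₐ K J).toLinearMap) n := by
  intro J' hJ'
  have hle : finrank K (A ⧸ J'.comap (Ideal.Quotient.mkₐ K J)) ≤ n + 1 := by
    have e : (A ⧸ J'.comap (Ideal.Quotient.mkₐ K J)) ≃ₐ[K] ((A ⧸ J) ⧸ J') := by
      refine AlgEquiv.ofBijective (Ideal.quotientMapₐ J' (Ideal.Quotient.mkₐ K J) le_rfl) ⟨?_, ?_⟩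
      · exact Ideal.quotientMap_injective
      · exact Ideal.quotientMap_surjective (H := le_rfl) (Ideal.Quotient.mkₐ_surjective K J)
    rw [e.toLinearEquiv.finrank_eq]
    exact hJ'
  have := h _ hle
  rw [eq_top_iff]
  rintro x -
  obtain ⟨a, rfl⟩ := Ideal.Quotient.mk_surjective x
  have ha : a ∈ V ⊔ (J'.comap (Ideal.Quotient.mkₐ K J)).restrictScalars K := by
    rw [this]; trivial
  obtain ⟨w, hw, z, hz, rfl⟩ := Submodule.mem_sup.1 ha
  exact Submodule.mem_sup.2 ⟨_, Submodule.mem_map_of_mem hw, _, hz, (map_add _ _ _).symm⟩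

theorem finrank_map_quotient [IsAlgClosed K] [FiniteDimensional K A]
    (h : SpansSmallQuotients V n) (hV : finrank K V = n + 1) (J : Ideal A)
    (hJ : n + 1 ≤ finrank K (A ⧸ J)) :
    finrank K (V.map (Ideal.Quotient.mkₐ K J).toLinearMap) = n + 1 := by
  refine le_antisymm ((Submodule.finrank_map_le _ _).trans hV.le) ?_
  obtain ⟨J', hJ'⟩ := exists_ideal_finrank_quotient (K := K) hJ
  have := finrank_sup_ideal _ _ (h.map_quotient J J' hJ'.le)
  omega

end SpansSmallQuotients

end GeneralPosition

end ProjSub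

namespace ProjSub

open Module Polynomial

/-! ### Kronecker pencils and chains -/

section Pencil

variable {K : Type*} [Field K] {W W₂ : Type*} [AddCommGroup W] [Module K W]
  [AddCommGroup W₂] [Module K W₂]

/-- A chain of length `m` for the pencil spanned by `F` and `G`. -/
def IsChain (F G : W →ₗ[K] W₂) (m : ℕ) (x : ℕ → W) : Prop :=
  ∀ i, i + 1 < m → F (x (i + 1)) = G (x i)

/-- The combination of the first `m` terms of a sequence with the coefficients of a polynomial. -/
def evalSeq (x : ℕ → W) (m : ℕ) : K[X] →ₗ[K] W :=
  ∑ i ∈ Finset.range m, (lcoeff K i).smulRight (x i)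

theorem evalSeq_apply (x : ℕ → W) (m : ℕ) (p : K[X]) :
    evalSeq x m p = ∑ i ∈ Finset.range m, p.coeff i • x i := by
  simp [evalSeq, LinearMap.sum_apply]

theorem evalSeq_X_pow (x : ℕ → W) {m k : ℕ} (hk : k < m) :
    evalSeq x m (X ^ k : K[X]) = x k := by
  simp [evalSeq_apply, coeff_X_pow, hk]

theorem exists_evalSeq_eq {x : ℕ → W} {m : ℕ} (hm : 0 < m)
    (hx : Submodule.span K (Set.range fun i : Fin m => x i) = ⊤) (w : W) :
    ∃ p : K[X], p.natDegree < m ∧ evalSeq x m p = w := by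
  have hw : w ∈ Submodule.span K (Set.range fun i : Fin m => x i) := by rw [hx]; trivial
  obtain ⟨c, rfl⟩ := (Submodule.mem_span_range_iff_exists_fun K).1 hw
  refine ⟨∑ i : Fin m, monomial (i : ℕ) (c i), ?_, ?_⟩
  · refine (natDegree_sum_le_of_forall_le (n := m - 1) _ _ fun i _ => ?_).trans_lt (by omega)
    exact (natDegree_monomial_le _).trans (by omega)
  · rw [evalSeq_apply, ← Fin.sum_univ_eq_sum_range (fun i => (∑ j : Fin m,
      monomial (j : ℕ) (c j)).coeff i • x i)]
    refine Finset.sum_congr rfl fun i _ => ?_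
    congr 1
    simp [finsetSum_coeff, coeff_monomial, Fin.val_inj]

namespace IsChain

variable {F G : W →ₗ[K] W₂} {m : ℕ} {x : ℕ → W}

theorem map_evalSeq_X_mul (h : IsChain F G m x) {p : K[X]} (hp : p.natDegree + 1 < m) :
    F (evalSeq x m (X * p)) = G (evalSeq x m p) := by
  obtain ⟨k, rfl⟩ : ∃ k, m = k + 1 := ⟨m - 1, by omega⟩
  rw [evalSeq_apply, evalSeq_apply, Finset.sum_range_succ', Finset.sum_range_succ,
    coeff_eq_zero_of_natDegree_lt (show p.natDegree < k by omega)]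
  simp only [coeff_X_mul, mul_coeff_zero, coeff_X_zero, zero_mul, zero_smul, add_zero, map_sum,
    map_smul]
  refine Finset.sum_congr rfl fun i hi => ?_
  rw [h i (by simpa using hi)]

theorem ne_zero (h : IsChain F G m x) (hF : Function.Injective F) (hx : ∃ i < m, x i ≠ 0) :
    x 0 ≠ 0 := by
  intro h0
  obtain ⟨i, hi, hxi⟩ := hx
  refine hxi ?_
  clear hxi
  induction i with
  | zero => exact h0
  | succ i ih =>
    apply hF
    rw [h i hi, ih (by omega), map_zero, map_zero]

/-- Along a chain, `F` after multiplication by `X` is `G`. A relation with polynomial `(X - c) r`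
therefore says that `r` evaluates to an eigenvector for `c`, hence to zero. Splitting off roots
reduces to a constant times `x 0`. -/
theorem eq_zero_of_evalSeq_eq_zero [IsAlgClosed K] (h : IsChain F G m x)
    (hG : ∀ (c : K) (w : W), G w = c • F w → w = 0) (hx : x 0 ≠ 0) (p : K[X])
    (hpm : p.natDegree < m) (hp : evalSeq x m p = 0) : p = 0 := by
  induction hk : p.natDegree generalizing p with
  | zero =>
    rw [eq_C_of_natDegree_eq_zero hk] at hp ⊢
    obtain ⟨k, rfl⟩ : ∃ k, m = k + 1 := ⟨m - 1, by omega⟩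
    rw [evalSeq_apply, Finset.sum_range_succ'] at hp
    have : p.coeff 0 = 0 := by simpa [coeff_C, hx] using hp
    rw [this, C_0]
  | succ k ih =>
    obtain ⟨c, hc⟩ := IsAlgClosed.exists_root p (by
      rw [← natDegree_pos_iff_degree_pos.trans ⟨ne_of_gt, fun h => ?_⟩]
      · omega
      · exact natDegree_pos_iff_degree_pos.1 (by omega))
    obtain ⟨r, rfl⟩ := dvd_iff_isRoot.2 hc
    have hr0 : r ≠ 0 := by rintro rfl; simp at hk
    have hdeg : r.natDegree = k := by
      rw [natDegree_mul (X_sub_C_ne_zero c) hr0, natDegree_X_sub_C] at hk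
      omega
    have hr : evalSeq x m r = 0 := by
      apply hG c
      have := congrArg F hp
      rw [sub_mul, map_sub, map_sub, h.map_evalSeq_X_mul (by omega), map_zero, ← smul_eq_C_mul,
        map_smul, map_smul, sub_eq_zero] at this
      exact this
    exact absurd (ih r (by omega) hr hdeg) hr0

theorem linearIndependent [IsAlgClosed K] (h : IsChain F G m x)
    (hG : ∀ (c : K) (w : W), G w = c • F w → w = 0) (hx : x 0 ≠ 0) :
    LinearIndependent K fun i : Fin m => x i := by
  rcases Nat.eq_zero_or_pos m with rfl | hm
  · exact linearIndependent_empty_type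
  rw [Fintype.linearIndependent_iff]
  intro c hc i
  have hp := h.eq_zero_of_evalSeq_eq_zero hG hx (∑ i : Fin m, monomial (i : ℕ) (c i)) ?_ ?_
  · have := congrArg (fun p => p.coeff (i : ℕ)) hp
    simpa [finsetSum_coeff, coeff_monomial, Fin.val_inj] using this
  · refine (natDegree_sum_le_of_forall_le (n := m - 1) _ _ fun i _ => ?_).trans_lt (by omega)
    exact (natDegree_monomial_le _).trans (by omega)
  · rw [← hc, evalSeq_apply, ← Fin.sum_univ_eq_sum_range (fun i => (∑ j : Fin m,
      monomial (j : ℕ) (c j)).coeff i • x i)]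
    refine Finset.sum_congr rfl fun i _ => ?_
    congr 1
    simp [finsetSum_coeff, coeff_monomial, Fin.val_inj]

theorem le_finrank [IsAlgClosed K] [FiniteDimensional K W] (h : IsChain F G m x)
    (hG : ∀ (c : K) (w : W), G w = c • F w → w = 0) (hx : x 0 ≠ 0) : m ≤ finrank K W := by
  simpa using (h.linearIndependent hG hx).fintype_card_le_finrank

/-- Chains inside a space spanned by a chain `y` are multiples of `y` by a fixed polynomial. -/
theorem eq_evalSeq_X_pow_mul [IsAlgClosed K] [FiniteDimensional K W] {y z : ℕ → W}
    {N : ℕ} (hy : IsChain F G N y) (hz : IsChain F G m z) (hF : Function.Injective F)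
    (hG : ∀ (c : K) (w : W), G w = c • F w → w = 0) (hy0 : y 0 ≠ 0)
    (hN : finrank K W = N) {p : K[X]} (hp : p.natDegree < N) (hp0 : p ≠ 0)
    (hpz : z 0 = evalSeq y N p) (i : ℕ) (hi : i < m) :
    p.natDegree + i < N ∧ z i = evalSeq y N (X ^ i * p) := by
  induction i with
  | zero => simpa using ⟨hp, hpz⟩
  | succ i ih =>
    obtain ⟨h1, h2⟩ := ih (by omega)
    have hdeg : (X ^ i * p).natDegree = p.natDegree + i := by
      rw [natDegree_mul (pow_ne_zero _ X_ne_zero) hp0, natDegree_X_pow, add_comm]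
    have hzi := hz i hi
    rw [h2] at hzi
    by_cases hlt : p.natDegree + i + 1 < N
    · refine ⟨hlt, hF ?_⟩
      rw [hzi, pow_succ', mul_assoc, hy.map_evalSeq_X_mul (by omega)]
    exfalso
    -- The degree has reached `N - 1` and the chain `z` goes on. This will prolong `y` beyond the
    -- dimension of the space, which is impossible.
    set s := X ^ i * p with hs
    have hs0 : s ≠ 0 := mul_ne_zero (pow_ne_zero _ X_ne_zero) hp0
    have hsN : s.natDegree = N - 1 := by omega
    -- For `N = 1` removing the leading term does not leave room for a multiplication by `X`; the
    -- chain `z 0, z 1` itself is already too long.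
    rcases Nat.lt_or_ge N 2 with hN2 | hN2
    · have : i = 0 := by omega
      have hN1 : N = 1 := by omega
      have hle := le_finrank (m := 2) (x := fun j => if j = 0 then z 0 else z 1)
        (fun j hj => by
          have : j = 0 := by omega
          subst this
          simpa using hz 0 (by omega)) hG (by
            subst hN1
            intro h0
            rw [if_pos rfl, hpz] at h0
            exact hp0 (hy.eq_zero_of_evalSeq_eq_zero hG hy0 p hp h0))
      omega
    have hel : s.eraseLead.natDegree + 1 < N := by
      have := s.eraseLead_natDegree_le
      omega
    have hc : s.leadingCoeff ≠ 0 := leadingCoeff_ne_zero.2 hs0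
    -- The lower terms of `s` can be shifted inside `y`. Subtracting them isolates the leading term
    -- and gives a next element `t` with `F t = G (y (N - 1))`.
    let t : W := s.leadingCoeff⁻¹ • (z (i + 1) - evalSeq y N (X * s.eraseLead))
    have ht : F t = G (y (N - 1)) := by
      have e : evalSeq y N s = evalSeq y N s.eraseLead + s.leadingCoeff • y (N - 1) := by
        conv_lhs => rw [← s.eraseLead_add_C_mul_X_pow]
        rw [map_add, ← smul_eq_C_mul, map_smul, hsN, evalSeq_X_pow _ (by omega)]
      rw [map_smul, map_sub, hzi, hy.map_evalSeq_X_mul hel, e, map_add, add_sub_cancel_left,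
        map_smul, smul_smul, inv_mul_cancel₀ hc, one_smul]
    have hle := le_finrank (F := F) (G := G) (m := N + 1) (x := fun j => if j < N then y j else t)
      (fun j hj => by
        have hjN : j < N := by omega
        beta_reduce
        rw [if_pos hjN]
        by_cases hj' : j + 1 < N
        · rw [if_pos hj']; exact hy j hj'
        · rw [if_neg hj', ht]
          congr 2
          omega) hG (by rwa [if_pos (by omega)])
    omega

end IsChain

/-- Kronecker's normal form of a pencil without eigenvectors whose image has dimension at most one
more than its source. -/
theorem exists_isChain [FiniteDimensional K W] [FiniteDimensional K W₂] (F G : W →ₗ[K] W₂)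
    (hF : Function.Injective F) {m : ℕ} (hW : finrank K W = m) (hm : 0 < m)
    (hFG : finrank K ↥(LinearMap.range F ⊔ LinearMap.range G) ≤ m + 1) :
    ∃ x : ℕ → W, IsChain F G m x ∧ x 0 ≠ 0 := by
  obtain ⟨k, rfl⟩ : ∃ k, m = k + 1 := ⟨m - 1, by omega⟩
  let T := LinearMap.range F ⊔ LinearMap.range G
  let F' : W →ₗ[K] T := F.codRestrict T fun w => Submodule.mem_sup_left ⟨w, rfl⟩
  let G' : W →ₗ[K] T := G.codRestrict T fun w => Submodule.mem_sup_right ⟨w, rfl⟩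
  -- The kernel of `Ψ` consists of the chains of length `m = k + 1`. It is nonzero because `k (k +
  -- 2) < (k + 1) ^ 2`.
  let Ψ : (Fin (k + 1) → W) →ₗ[K] (Fin k → T) := LinearMap.pi fun i =>
    F' ∘ₗ LinearMap.proj i.succ - G' ∘ₗ LinearMap.proj i.castSucc
  have hker : LinearMap.ker Ψ ≠ ⊥ := by
    apply LinearMap.ker_ne_bot_of_finrank_lt
    rw [finrank_pi_fintype, finrank_pi_fintype]
    simp only [Finset.sum_const, Finset.card_univ, Fintype.card_fin, smul_eq_mul, hW]
    calc k * finrank K T ≤ k * (k + 1 + 1) := Nat.mul_le_mul_left _ hFG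
      _ < (k + 1) * (k + 1) := by nlinarith
  obtain ⟨u, hu, hu0⟩ := Submodule.exists_mem_ne_zero_of_ne_bot hker
  let x : ℕ → W := fun i => if h : i < k + 1 then u ⟨i, h⟩ else 0
  have hx : ∀ i (h : i < k + 1), x i = u ⟨i, h⟩ := fun i h => dif_pos h
  have hchain : IsChain F G (k + 1) x := by
    intro i hi
    have h1 : Ψ u ⟨i, by omega⟩ = 0 := by rw [LinearMap.mem_ker.1 hu]; rfl
    have h2 := congrArg Subtype.val h1
    rw [hx _ hi, hx _ (by omega)]
    exact sub_eq_zero.1 h2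
  refine ⟨x, hchain, hchain.ne_zero hF ?_⟩
  obtain ⟨i, hi⟩ := Function.ne_iff.1 hu0
  exact ⟨i, i.2, by rw [hx i i.2]; exact hi⟩

end Pencil

end ProjSub

namespace ProjSub

open Module Polynomial

/-! ### A Castelnuovo lemma for minimal schemes -/

section Castelnuovo

variable {K : Type*} [Field K] {A : Type*} [CommRing A] [Algebra K A]

namespace SpansSmallQuotients

variable {V : Submodule K A} {n : ℕ}

/-- If `V ^ q` contains no ideal, then linear forms are nonzerodivisors in degrees below `q`. -/
theorem eq_zero_of_mul_eq_zero [IsAlgClosed K] [FiniteDimensional K A]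
    (h : SpansSmallQuotients V n) (hV : finrank K V = n + 1) (h1 : 1 ∈ V) {q : ℕ}
    (hq : ∀ J : Ideal A, J.restrictScalars K ≤ V ^ q → J = ⊥) {l : ℕ} (hl : l + 1 ≤ q) {v x : A}
    (hv : v ∈ V) (hv0 : v ≠ 0) (hx : x ∈ V ^ l) (hvx : v * x = 0) : x = 0 := by
  -- Since `A = V + (v)` and `v` kills `x`, the ideal generated by `x` is `V x`, which lies in `V ^
  -- (l + 1)` and hence in `V ^ q`.
  have := hq (Ideal.span {x}) ?_
  · simpa using this
  · intro y hy
    obtain ⟨a, rfl⟩ := Ideal.mem_span_singleton'.1 hy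
    have ha : a ∈ V ⊔ (Ideal.span {v}).restrictScalars K := by
      rw [h.sup_span_eq_top hV hv hv0]; trivial
    obtain ⟨w, hw, z, hz, rfl⟩ := Submodule.mem_sup.1 ha
    obtain ⟨b, rfl⟩ := Ideal.mem_span_singleton'.1 hz
    refine pow_sup_mono h1 hl ?_
    have : (w + b * v) * x = x * w := by linear_combination b * hvx
    rw [this, pow_succ]
    exact Submodule.mul_mem_mul hx hw

/-- The first difference of the Hilbert function is at least `n`. -/
theorem finrank_pow_add_le [IsAlgClosed K] [FiniteDimensional K A]
    (h : SpansSmallQuotients V n) (hV : finrank K V = n + 1) (h1 : 1 ∈ V) {q : ℕ}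
    (hq : ∀ J : Ideal A, J.restrictScalars K ≤ V ^ q → J = ⊥) (hA : n + 1 ≤ finrank K A) {l : ℕ}
    (hl : l + 1 ≤ q) : finrank K ↥(V ^ l) + n ≤ finrank K ↥(V ^ (l + 1)) := by
  obtain ⟨J, hJ⟩ := exists_ideal_finrank_quotient (K := K) (show n ≤ finrank K A by omega)
  -- Multiplication by a hyperplane `v` containing a length `n` subscheme embeds `V ^ l` in the part
  -- of `V ^ (l + 1)` vanishing there, which has codimension `n`.
  obtain ⟨v, hv, hvJ, hv0⟩ := exists_mem_ideal_of_finrank_lt V J (by omega)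
  have hsup : V ^ (l + 1) ⊔ J.restrictScalars K = ⊤ := by
    rw [eq_top_iff, ← h J (by omega)]
    refine sup_le_sup_right ?_ _
    simpa using pow_sup_mono h1 (show 1 ≤ l + 1 by omega)
  rw [← finrank_sup_ideal _ _ hsup, hJ]
  let f : ↥(V ^ l) →ₗ[K] ↥(V ^ (l + 1) ⊓ J.restrictScalars K) :=
    (LinearMap.mulRight K v ∘ₗ (V ^ l).subtype).codRestrict _ fun x =>
      ⟨by rw [pow_succ]; exact Submodule.mul_mem_mul x.2 hv, J.mul_mem_left _ hvJ⟩
  have hf : Function.Injective f := by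
    rw [← LinearMap.ker_eq_bot, Submodule.eq_bot_iff]
    intro x hx
    have hx' : (x : A) * v = 0 := congrArg Subtype.val (LinearMap.mem_ker.1 hx)
    exact Subtype.ext (h.eq_zero_of_mul_eq_zero hV h1 hq hl hv hv0 x.2 (by rw [mul_comm, hx']))
  have := LinearMap.finrank_le_finrank_of_injective hf
  omega

/-- The total excess over growth by `n` is at most `n - 1` up to degree `q`. Degrees up to `2n`
contain `n` disjoint pairs of consecutive steps, so some pair has no excess. -/
theorem exists_finrank_pow_eq [IsAlgClosed K] [FiniteDimensional K A]
    (h : SpansSmallQuotients V n) (hV : finrank K V = n + 1) (h1 : 1 ∈ V) {q : ℕ}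
    (hq : ∀ J : Ideal A, J.restrictScalars K ≤ V ^ q → J = ⊥) (hA : n + 1 ≤ finrank K A)
    (hnq : 2 * n ≤ q) (hdim : finrank K ↥(V ^ q) ≤ n * q + n) :
    ∃ l, l + 2 ≤ q ∧ finrank K ↥(V ^ (l + 1)) ≤ finrank K ↥(V ^ l) + n ∧
      finrank K ↥(V ^ (l + 2)) ≤ finrank K ↥(V ^ (l + 1)) + n := by
  by_contra! hcon
  have hstep : ∀ l, l + 1 ≤ q → finrank K ↥(V ^ l) + n ≤ finrank K ↥(V ^ (l + 1)) :=
    fun l hl => h.finrank_pow_add_le hV h1 hq hA hl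
  have hA' : Nontrivial A := by
    by_contra hn
    rw [not_nontrivial_iff_subsingleton] at hn
    have := finrank_zero_of_subsingleton (R := K) (M := A)
    omega
  have h0 : finrank K ↥(V ^ 0) = 1 := by
    rw [pow_zero, Submodule.one_eq_span]; exact finrank_span_singleton one_ne_zero
  -- If every pair of steps has an excess, the excess after `k` pairs is at least `k`; `n` pairs
  -- already contradict `hdim`.
  have hgrow : ∀ k, 2 * k ≤ q → 2 * n * k + k + 1 ≤ finrank K ↥(V ^ (2 * k)) := by
    intro k
    induction k with
    | zero => intro _; simp [h0]
    | succ k ih =>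
      intro hk
      have e1 := ih (by omega)
      have e2 := hstep (2 * k) (by omega)
      have e3 := hstep (2 * k + 1) (by omega)
      have e4 := hcon (2 * k) (by omega)
      have e5 : 2 * (k + 1) = 2 * k + 2 := by ring
      rw [e5, mul_add]
      have e6 : 2 * k + 1 + 1 = 2 * k + 2 := by ring
      rw [e6] at e3
      by_cases hc : finrank K ↥(V ^ (2 * k + 1)) ≤ finrank K ↥(V ^ (2 * k)) + n
      · have := e4 hc
        omega
      · omega
  have hlast : ∀ m, 2 * n + m ≤ q → n * (2 * n + m) + n + 1 ≤ finrank K ↥(V ^ (2 * n + m)) := by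
    intro m
    induction m with
    | zero =>
      intro hm
      have := hgrow n (by omega)
      rw [add_zero]
      calc n * (2 * n) + n + 1 = 2 * n * n + n + 1 := by ring
        _ ≤ _ := this
    | succ m ih =>
      intro hm
      have e1 := ih (by omega)
      have e2 := hstep (2 * n + m) (by omega)
      rw [← add_assoc, mul_add, mul_one]
      omega
  have := hlast (q - 2 * n) (by omega)
  rw [show 2 * n + (q - 2 * n) = q by omega] at this
  omega

/-- A Castelnuovo type lemma: a finite scheme in linearly general position, minimal among those
not imposing independent conditions on forms of degree `q`, satisfies the quadratic equations of a
rational normal curve. -/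
theorem exists_basis_of_pow [IsAlgClosed K] [FiniteDimensional K A]
    (h : SpansSmallQuotients V n) (hV : finrank K V = n + 1) (h1 : 1 ∈ V) {q : ℕ} (hn : 1 ≤ n)
    (hq : ∀ J : Ideal A, J.restrictScalars K ≤ V ^ q → J = ⊥) (hA : n + 1 ≤ finrank K A)
    (hnq : 2 * n ≤ q) (hq3 : 3 ≤ q) (hdim : finrank K ↥(V ^ q) ≤ n * q + n) :
    ∃ v : ℕ → A, (∀ i ≤ n, v i ∈ V) ∧ (LinearIndependent K fun i : Fin (n + 1) => v i) ∧
      ∀ i < n, ∀ j < n, v i * v (j + 1) = v (i + 1) * v j := by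
  obtain ⟨l, hl, hl1, hl2⟩ := h.exists_finrank_pow_eq hV h1 hq hA hnq hdim
  have hcancel : ∀ {k : ℕ}, k + 1 ≤ q → ∀ {v x : A}, v ∈ V → v ≠ 0 → x ∈ V ^ k → v * x = 0 → x = 0 :=
    fun hk _ _ hv hv0 hx hvx => h.eq_zero_of_mul_eq_zero hV h1 hq hk hv hv0 hx hvx
  have hnt : Nontrivial A := by
    by_contra hn
    rw [not_nontrivial_iff_subsingleton] at hn
    have := finrank_zero_of_subsingleton (R := K) (M := A)
    omega
  have h1l : ∀ k, (1 : A) ∈ V ^ k := fun k => by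
    have := Submodule.pow_mem_pow V h1 k
    rwa [one_pow] at this
  have hpos : ∀ k, 0 < finrank K ↥(V ^ k) := fun k =>
    Module.finrank_pos_iff.2 ⟨⟨1, h1l k⟩, 0, fun e => one_ne_zero (congrArg Subtype.val e)⟩
  -- The hyperplanes containing a subscheme of length `n - 1` form a pencil, spanned by `f` and `g`.
  obtain ⟨Z, hZ⟩ := exists_ideal_finrank_quotient (K := K) (show n - 1 ≤ finrank K A by omega)
  have hVZ := finrank_sup_ideal V Z (h Z (by omega))
  obtain ⟨f, g, hf, hg, hfg⟩ : ∃ f g : A, f ∈ V ⊓ Z.restrictScalars K ∧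
      g ∈ V ⊓ Z.restrictScalars K ∧ LinearIndependent K ![f, g] := by
    have h2 : 2 ≤ finrank K ↥(V ⊓ Z.restrictScalars K) := by omega
    obtain ⟨b, hb⟩ := exists_linearIndependent_of_le_finrank h2
    refine ⟨b 0, b 1, (b 0).2, (b 1).2, ?_⟩
    have := hb.map' (V ⊓ Z.restrictScalars K).subtype (Submodule.ker_subtype _)
    have e : ![((b 0 : A)), (b 1 : A)] = (V ⊓ Z.restrictScalars K).subtype ∘ b := by
      ext i
      fin_cases i <;> rfl
    rw [e]
    exact this
  have hf0 : f ≠ 0 := hfg.ne_zero 0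
  have hgf : ∀ c : K, g - c • f ≠ 0 := by
    intro c hc
    have := LinearIndependent.pair_iff.1 hfg (-c) 1 (by rw [← hc]; module)
    exact one_ne_zero this.2
  let F : ∀ k, ↥(V ^ k) →ₗ[K] A := fun k => LinearMap.mulLeft K f ∘ₗ (V ^ k).subtype
  let G : ∀ k, ↥(V ^ k) →ₗ[K] A := fun k => LinearMap.mulLeft K g ∘ₗ (V ^ k).subtype
  have hF : ∀ k, k + 1 ≤ q → Function.Injective (F k) := by
    intro k hk
    rw [← LinearMap.ker_eq_bot, Submodule.eq_bot_iff]
    exact fun x hx => Subtype.ext (hcancel hk hf.1 hf0 x.2 (LinearMap.mem_ker.1 hx))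
  have hG : ∀ k, k + 1 ≤ q → ∀ (c : K) (w : ↥(V ^ k)), G k w = c • F k w → w = 0 := by
    intro k hk c w hw
    refine Subtype.ext (hcancel hk (V.sub_mem hg.1 (V.smul_mem c hf.1)) (hgf c) w.2 ?_)
    have hw' : g * (w : A) = c • (f * (w : A)) := hw
    rw [sub_mul, hw', smul_mul_assoc, sub_self]
  -- Both images vanish on `Z`, which imposes `n - 1` conditions on `V ^ (k + 1)`. Growth by only
  -- `n` then leaves one dimension more than the source, as Kronecker's normal form requires.
  have hrange : ∀ k, finrank K ↥(V ^ (k + 1)) ≤ finrank K ↥(V ^ k) + n →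
      finrank K ↥(LinearMap.range (F k) ⊔ LinearMap.range (G k)) ≤ finrank K ↥(V ^ k) + 1 := by
    intro k hk
    have hsup : V ^ (k + 1) ⊔ Z.restrictScalars K = ⊤ := by
      rw [eq_top_iff, ← h Z (by omega)]
      refine sup_le_sup_right ?_ _
      simpa using pow_sup_mono h1 (show 1 ≤ k + 1 by omega)
    have h3 := finrank_sup_ideal _ _ hsup
    have hle : LinearMap.range (F k) ⊔ LinearMap.range (G k) ≤
        V ^ (k + 1) ⊓ Z.restrictScalars K := by
      refine sup_le ?_ ?_
      · rintro _ ⟨x, rfl⟩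
        refine ⟨?_, Z.mul_mem_right _ hf.2⟩
        rw [pow_succ']
        exact Submodule.mul_mem_mul hf.1 x.2
      · rintro _ ⟨x, rfl⟩
        refine ⟨?_, Z.mul_mem_right _ hg.2⟩
        rw [pow_succ']
        exact Submodule.mul_mem_mul hg.1 x.2
    have := Submodule.finrank_mono hle
    omega
  obtain ⟨x, hx, hx0⟩ := exists_isChain (F l) (G l) (hF l (by omega)) rfl (hpos l) (hrange l hl1)
  obtain ⟨y, hy, hy0⟩ := exists_isChain (F (l + 1)) (G (l + 1)) (hF (l + 1) (by omega)) rfl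
    (hpos (l + 1)) (hrange (l + 1) hl2)
  set w := finrank K ↥(V ^ l) with hw
  set N := finrank K ↥(V ^ (l + 1)) with hN
  have hyspan : Submodule.span K (Set.range fun i : Fin N => y i) = ⊤ :=
    (hy.linearIndependent (hG _ (by omega)) hy0).span_eq_top_of_card_eq_finrank'
      (by rw [Fintype.card_fin])
  have hxspan : Submodule.span K (Set.range fun i : Fin w => x i) = ⊤ :=
    (hx.linearIndependent (hG _ (by omega)) hx0).span_eq_top_of_card_eq_finrank'
      (by rw [Fintype.card_fin])
  have hwN : w + n ≤ N := h.finrank_pow_add_le hV h1 hq hA (by omega)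
  -- Multiplying the chain `x` by a linear form gives a chain in the next degree, so it is the shift
  -- of `y` by a polynomial.
  let z : V → ℕ → ↥(V ^ (l + 1)) := fun v i =>
    ⟨v * x i, by rw [pow_succ']; exact Submodule.mul_mem_mul v.2 (x i).2⟩
  have hz : ∀ v, IsChain (F (l + 1)) (G (l + 1)) w (z v) := by
    intro v i hi
    have e : f * (x (i + 1) : A) = g * (x i : A) := hx i hi
    change f * (v * (x (i + 1) : A)) = g * (v * (x i : A))
    linear_combination (v : A) * e
  have hev : ∀ v : V, ∃ p : K[X], p.natDegree ≤ n ∧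
      ∀ i < w, z v i = evalSeq y N (X ^ i * p) := by
    intro v
    obtain ⟨p, hpN, hp⟩ := exists_evalSeq_eq (hpos (l + 1)) hyspan (z v 0)
    have hw0 := hpos l
    rcases eq_or_ne p 0 with rfl | hp0
    · refine ⟨0, by simp, fun i hi => ?_⟩
      have hv0 : v = 0 := by
        by_contra hv
        have : (v : A) * x 0 = 0 := by
          have := congrArg Subtype.val hp
          simpa [z] using this.symm
        exact hx0 (Subtype.ext (hcancel (by omega) v.2 (by simpa using hv) (x 0).2 this))
      subst hv0
      simp [z]
    · have key := hy.eq_evalSeq_X_pow_mul (hz v) (hF _ (by omega)) (hG _ (by omega)) hy0 rfl hpN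
        hp0 hp.symm
      refine ⟨p, ?_, fun i hi => (key i hi).2⟩
      -- The last term of the chain still fits among the `N ≤ w + n` terms of `y`, which bounds the
      -- degree of `p` by `n`.
      have := (key (w - 1) (by omega)).1
      omega
  let ev : degreeLT K (n + 1) →ₗ[K] ↥(V ^ (l + 1)) := evalSeq y N ∘ₗ (degreeLT K (n + 1)).subtype
  let mu : V →ₗ[K] ↥(V ^ (l + 1)) :=
    (LinearMap.mulRight K (x 0 : A) ∘ₗ V.subtype).codRestrict _ fun v => (z v 0).2
  have hmu : Function.Injective mu := by
    rw [← LinearMap.ker_eq_bot, Submodule.eq_bot_iff]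
    intro v hv
    by_contra hv0
    have : (v : A) * x 0 = 0 := congrArg Subtype.val (LinearMap.mem_ker.1 hv)
    exact hx0 (Subtype.ext (hcancel (by omega) v.2 (by simpa using hv0) (x 0).2 this))
  have hle : LinearMap.range mu ≤ LinearMap.range ev := by
    rintro _ ⟨v, rfl⟩
    obtain ⟨p, hp, hpz⟩ := hev v
    refine ⟨⟨p, ?_⟩, ?_⟩
    · rw [mem_degreeLT]
      exact degree_le_natDegree.trans_lt (by exact_mod_cast Nat.lt_succ_of_le hp)
    · have := hpz 0 (hpos l)
      rw [pow_zero, one_mul] at this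
      exact this.symm
  -- Linear forms embed in the polynomials of degree at most `n`; both spaces have dimension `n +
  -- 1`, so each power of `X` comes from a linear form `v j`.
  have heq : LinearMap.range mu = LinearMap.range ev := by
    refine Submodule.eq_of_le_of_finrank_le hle ?_
    rw [LinearMap.finrank_range_of_inj hmu, hV]
    refine (LinearMap.finrank_range_le ev).trans ?_
    rw [(degreeLTEquiv K (n + 1)).finrank_eq, finrank_fin_fun]
  have hvex : ∀ j : ℕ, ∃ v : V, j ≤ n → mu v = y j := by
    intro j
    by_cases hj : j ≤ n
    · have : y j ∈ LinearMap.range mu := by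
        rw [heq]
        refine ⟨⟨X ^ j, ?_⟩, evalSeq_X_pow _ (by have := hpos l; omega)⟩
        rw [mem_degreeLT, degree_X_pow]
        exact_mod_cast Nat.lt_succ_of_le hj
      exact this.imp fun v hv _ => hv
    · exact ⟨0, fun h => absurd h hj⟩
  choose v hv using hvex
  have hvx : ∀ j ≤ n, ∀ i < w, (v j : A) * x i = y (i + j) := by
    intro j hj i hi
    have hw0 := hpos l
    have key := hy.eq_evalSeq_X_pow_mul (hz (v j)) (hF _ (by omega)) (hG _ (by omega)) hy0 rfl
      (p := X ^ j) (by rw [natDegree_X_pow]; omega) (pow_ne_zero _ X_ne_zero)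
      (by rw [evalSeq_X_pow _ (by omega)]; exact hv j hj) i hi
    rw [← pow_add, evalSeq_X_pow _ (by omega)] at key
    exact congrArg Subtype.val key.2
  -- The relation holds after multiplication by every `x i`, since both sides become consecutive
  -- terms of the chain `y`. The `x i` span `V ^ l`, which contains `1`.
  have hrel : ∀ j < n, f * (v (j + 1) : A) = g * v j := by
    intro j hj
    have hall : ∀ u : ↥(V ^ l), f * (v (j + 1) : A) * u = g * v j * u := by
      intro u
      have hu : u ∈ Submodule.span K (Set.range fun i : Fin w => x i) := by rw [hxspan]; trivial
      induction hu using Submodule.span_induction with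
      | mem u hu =>
        obtain ⟨i, rfl⟩ := hu
        have e := hy (i + j) (by omega)
        have e' : f * (y (i + j + 1) : A) = g * y (i + j) := e
        rw [mul_assoc, mul_assoc, hvx _ hj _ i.2, hvx _ hj.le _ i.2]
        exact e'
      | zero => simp
      | add a b _ _ ha hb => rw [Submodule.coe_add, mul_add, mul_add, ha, hb]
      | smul c a _ ha => rw [Submodule.coe_smul, mul_smul_comm, mul_smul_comm, ha]
    simpa using hall ⟨1, h1l l⟩
  refine ⟨fun j => v j, fun i _ => (v i).2, ?_, fun i hi j hj => ?_⟩
  · have hli : LinearIndependent K fun i : Fin (n + 1) => mu (v i) := by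
      have := (hy.linearIndependent (hG _ (by omega)) hy0).comp
        (fun i : Fin (n + 1) => (⟨i, by have := hpos l; omega⟩ : Fin N))
        (fun i j hij => Fin.ext (by simpa using hij))
      have e : (fun i : Fin (n + 1) => mu (v i)) = fun i : Fin (n + 1) => y i :=
        funext fun i => hv i (by omega)
      rw [e]
      exact this
    exact (hli.of_comp mu).map' V.subtype (Submodule.ker_subtype _)
  -- By `hrel`, `f` annihilates the minor. It lies in `V ^ 2`, where `f` may be cancelled because `3
  -- ≤ q`.
  · rw [← sub_eq_zero]
    refine hcancel (k := 2) (by omega) hf.1 hf0 ?_ ?_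
    · rw [pow_two]
      exact Submodule.sub_mem _ (Submodule.mul_mem_mul (v i).2 (v (j + 1)).2)
        (Submodule.mul_mem_mul (v (i + 1)).2 (v j).2)
    · linear_combination (v i : A) * hrel j hj - (v j : A) * hrel i hi

end SpansSmallQuotients

end Castelnuovo

end ProjSub

namespace ProjSub

open Module MvPolynomial

/-! ### Homogeneous ideals and hyperplanes -/

section HomogeneousIdeals

variable {K : Type*} [Field K] {n : ℕ}

/-- The ideal contains the homogeneous components of its elements. -/
def IsHomogeneousIdeal {σ : Type*} (I : Ideal (MvPolynomial σ K)) : Prop :=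
  ∀ f ∈ I, ∀ m : ℕ, homogeneousComponent m f ∈ I

theorem IsHomogeneousIdeal.sup {σ : Type*} {I J : Ideal (MvPolynomial σ K)}
    (hI : IsHomogeneousIdeal I) (hJ : IsHomogeneousIdeal J) : IsHomogeneousIdeal (I ⊔ J) := by
  intro f hf m
  obtain ⟨a, ha, b, hb, rfl⟩ := Submodule.mem_sup.1 hf
  rw [map_add]
  exact Submodule.add_mem_sup (hI a ha m) (hJ b hb m)

theorem isHomogeneousIdeal_span_singleton {σ : Type*} {f : MvPolynomial σ K} {k : ℕ}
    (hf : f.IsHomogeneous k) : IsHomogeneousIdeal (Ideal.span {f}) := by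
  let := MvPolynomial.gradedAlgebra (σ := σ) (R := K)
  intro g hg m
  refine homogeneousComponent_mem_of_mem (Ideal.homogeneous_span _ _ ?_) hg m
  rintro _ rfl
  exact ⟨k, hf⟩

theorem homogeneousComponent_aeval {σ τ : Type*} {k : ℕ} (hk : k ≠ 0)
    {F : σ → MvPolynomial τ K} (hF : ∀ i, (F i).IsHomogeneous k) (f : MvPolynomial σ K) (m : ℕ) :
    homogeneousComponent (k * m) (aeval F f) = aeval F (homogeneousComponent m f) := by
  conv_lhs => rw [← sum_homogeneousComponent f]
  rw [map_sum, map_sum]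
  have h : ∀ i, homogeneousComponent (k * m) (aeval F (homogeneousComponent i f)) =
      if m = i then aeval F (homogeneousComponent m f) else 0 := by
    intro i
    rw [homogeneousComponent_of_mem ((homogeneousComponent_isHomogeneous i f).aeval F hF)]
    by_cases hmi : m = i
    · subst hmi; simp
    · rw [if_neg hmi, if_neg fun e => hmi (Nat.eq_of_mul_eq_mul_left (Nat.pos_of_ne_zero hk) e)]
  simp_rw [h]
  rw [Finset.sum_ite_eq]
  split_ifs with hm
  · rfl
  · rw [homogeneousComponent_eq_zero, map_zero]
    simpa using hm

theorem isHomogeneousIdeal_ker_aeval {σ τ : Type*} {k : ℕ} (hk : k ≠ 0)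
    {F : σ → MvPolynomial τ K} (hF : ∀ i, (F i).IsHomogeneous k) :
    IsHomogeneousIdeal (RingHom.ker (aeval F : MvPolynomial σ K →ₐ[K] MvPolynomial τ K)) := by
  intro f hf m
  rw [RingHom.mem_ker] at hf ⊢
  rw [← homogeneousComponent_aeval hk hF, hf, map_zero]

theorem homogeneous_one_induction {σ : Type*} {M : Type*} [AddCommGroup M] [Module K M]
    {f g : MvPolynomial σ K →ₗ[K] M} (h : ∀ i, f (X i) = g (X i)) {P : MvPolynomial σ K}
    (hP : P ∈ homogeneousSubmodule σ K 1) : f P = g P := by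
  rw [homogeneousSubmodule_one_eq_span_X] at hP
  induction hP using Submodule.span_induction with
  | mem x hx => obtain ⟨i, rfl⟩ := hx; exact h i
  | zero => simp
  | add a b _ _ ha hb => simp [ha, hb]
  | smul c a _ ha => simp [ha]

theorem linearIndependent_X {σ : Type*} :
    LinearIndependent K (X : σ → MvPolynomial σ K) := by
  have := (basisMonomials σ K).linearIndependent.comp (fun i => Finsupp.single i 1)
    (Finsupp.single_left_injective one_ne_zero)
  have e : (X : σ → MvPolynomial σ K) = basisMonomials σ K ∘ fun i => Finsupp.single i 1 := by
    ext1 i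
    simp [X]
  rw [e]
  exact this

theorem finrank_homogeneousSubmodule_one {σ : Type*} [Fintype σ] :
    finrank K (homogeneousSubmodule σ K 1) = Fintype.card σ := by
  rw [homogeneousSubmodule_one_eq_span_X]
  exact finrank_span_eq_card linearIndependent_X

instance finiteDimensional_homogeneousSubmodule {σ : Type*} [Finite σ] (m : ℕ) :
    FiniteDimensional K (homogeneousSubmodule σ K m) :=
  Module.Finite.iff_fg.2 (homogeneousSubmodule_fg σ K m)

/-- A hyperplane as a closed subscheme. -/
theorem exists_hyperplane (hn : 1 ≤ n) {v : MvPolynomial (Fin (n + 1)) K}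
    (hv : v ∈ homogeneousSubmodule (Fin (n + 1)) K 1) (hv0 : v ≠ 0) :
    ∃ Z : ClosedSubscheme K n, Z.IsPlane (n - 1) ∧ Z.ideal = Ideal.span {v} := by
  have hv' := hv
  rw [homogeneousSubmodule_one_eq_span_X] at hv'
  obtain ⟨c, hc⟩ := (Submodule.mem_span_range_iff_exists_fun K).1 hv'
  obtain ⟨k, hk⟩ : ∃ k, c k ≠ 0 := by
    by_contra! h
    exact hv0 (by rw [← hc]; simp [h])
  -- Eliminating `x_k`, whose coefficient in `v` is nonzero, gives a retraction with kernel `(v)`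
  -- and values in a domain. Saturation follows because it fixes some other variable `x_j`.
  let y : Fin (n + 1) → MvPolynomial (Fin (n + 1)) K :=
    fun j => if j = k then X k - C (c k)⁻¹ * v else X j
  let p : MvPolynomial (Fin (n + 1)) K →ₐ[K] MvPolynomial (Fin (n + 1)) K := aeval y
  have hpX : ∀ j, j ≠ k → p (X j) = X j := fun j hj => by simp [p, y, hj]
  have hpk : p (X k) = X k - C (c k)⁻¹ * v := by simp [p, y]
  have hpv : p v = 0 := by
    have h1 : p v - v = c k • (p (X k) - X k) := by
      rw [← hc, map_sum, ← Finset.sum_sub_distrib, Finset.sum_eq_single k]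
      · rw [map_smul, smul_sub]
      · intro j _ hj
        rw [map_smul, hpX j hj, sub_self]
      · simp
    rw [hpk, sub_sub_cancel_left, smul_neg, smul_eq_C_mul, ← mul_assoc, ← C_mul,
      mul_inv_cancel₀ hk, C_1, one_mul] at h1
    linear_combination h1
  have hpf : ∀ f, f - p f ∈ Ideal.span {v} := by
    intro f
    have : (Ideal.Quotient.mkₐ K (Ideal.span {v})).comp p = Ideal.Quotient.mkₐ K _ := by
      refine MvPolynomial.algHom_ext fun j => ?_
      by_cases hj : j = k
      · subst hj
        rw [AlgHom.comp_apply, hpk, map_sub, sub_eq_self]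
        exact Ideal.Quotient.eq_zero_iff_mem.2
          (Ideal.mul_mem_left _ _ (Ideal.mem_span_singleton_self v))
      · rw [AlgHom.comp_apply, hpX j hj]
    exact Ideal.Quotient.eq.1 (DFunLike.congr_fun this f).symm
  have hker : ∀ f, f ∈ Ideal.span {v} ↔ p f = 0 := by
    intro f
    constructor
    · intro hf
      obtain ⟨g, rfl⟩ := Ideal.mem_span_singleton'.1 hf
      rw [map_mul, hpv, mul_zero]
    · intro hf
      have := hpf f
      rwa [hf, sub_zero] at this
  refine ⟨⟨Ideal.span {v}, isHomogeneousIdeal_span_singleton hv, fun f hf => ?_⟩, ?_, rfl⟩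
  · obtain ⟨j, hj⟩ : ∃ j : Fin (n + 1), j ≠ k := by
      have : Nontrivial (Fin (n + 1)) := Fin.nontrivial_iff_two_le.2 (by omega)
      exact exists_ne k
    obtain ⟨N, hN⟩ := hf j
    rw [hker, map_mul, map_pow, hpX j hj] at hN
    rw [hker]
    exact (mul_eq_zero.1 hN).resolve_left (pow_ne_zero _ (X_ne_zero j))
  · refine ⟨K ∙ v, ?_, ?_, ?_⟩
    · rwa [Submodule.span_singleton_le_iff_mem]
    · rw [finrank_span_singleton hv0]; omega
    · refine le_antisymm ?_ ?_
      · exact Ideal.span_mono (by simp)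
      · rw [Ideal.span_le]
        intro w hw
        obtain ⟨a, rfl⟩ := Submodule.mem_span_singleton.1 hw
        rw [smul_eq_C_mul]
        exact Ideal.mul_mem_left _ _ (Ideal.mem_span_singleton_self v)

end HomogeneousIdeals

/-! ### Binary forms -/

section BinaryForms

variable {K : Type*} [Field K]

/-- The monomial `s ^ (m - j) * t ^ j`. -/
def binaryMonomial (K : Type*) [Field K] (m j : ℕ) : MvPolynomial (Fin 2) K :=
  X 0 ^ (m - j) * X 1 ^ j

theorem binaryMonomial_eq (m j : ℕ) : binaryMonomial K m j =
    monomial (Finsupp.single 0 (m - j) + Finsupp.single 1 j) 1 := by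
  rw [binaryMonomial, X_pow_eq_monomial, X_pow_eq_monomial, monomial_mul, one_mul]

theorem isHomogeneous_binaryMonomial {m j : ℕ} (hj : j ≤ m) :
    (binaryMonomial K m j).IsHomogeneous m := by
  have := ((isHomogeneous_X K (0 : Fin 2)).pow (m - j)).mul ((isHomogeneous_X K (1 : Fin 2)).pow j)
  rwa [one_mul, one_mul, Nat.sub_add_cancel hj] at this

theorem linearIndependent_binaryMonomial (m : ℕ) :
    LinearIndependent K fun j : Fin (m + 1) => binaryMonomial K m j := by
  have := (basisMonomials (Fin 2) K).linearIndependent.comp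
    (fun j : Fin (m + 1) => (Finsupp.single 0 (m - (j : ℕ)) + Finsupp.single 1 (j : ℕ) : Fin 2 →₀ ℕ))
    (fun i j hij => by
      have := DFunLike.congr_fun hij 1
      simpa [Fin.val_inj] using this)
  have e : (fun j : Fin (m + 1) => binaryMonomial K m j) = basisMonomials (Fin 2) K ∘
      fun j : Fin (m + 1) => Finsupp.single 0 (m - (j : ℕ)) + Finsupp.single 1 (j : ℕ) := by
    ext1 j
    simp [binaryMonomial_eq]
  rw [e]
  exact this

theorem span_binaryMonomial (m : ℕ) :
    Submodule.span K (Set.range fun j : Fin (m + 1) => binaryMonomial K m j) =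
      homogeneousSubmodule (Fin 2) K m := by
  refine le_antisymm ?_ fun f hf => ?_
  · rw [Submodule.span_le]
    rintro _ ⟨j, rfl⟩
    exact isHomogeneous_binaryMonomial (by omega)
  · rw [f.as_sum]
    refine Submodule.sum_mem _ fun d hd => ?_
    have hdm : d 0 + d 1 = m := by
      have h := hf (mem_support_iff.1 hd)
      simpa [Finsupp.weight_apply, Finsupp.sum_fintype] using h
    have : monomial d (coeff d f) = coeff d f • binaryMonomial K m (d 1) := by
      rw [binaryMonomial_eq, smul_monomial, smul_eq_mul, mul_one]
      congr 2
      ext i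
      fin_cases i
      · simp; omega
      · simp
    rw [this]
    exact Submodule.smul_mem _ _ (Submodule.subset_span ⟨⟨d 1, by omega⟩, rfl⟩)

theorem finrank_binaryForms (m : ℕ) : finrank K (homogeneousSubmodule (Fin 2) K m) = m + 1 := by
  rw [← span_binaryMonomial, finrank_span_eq_card (linearIndependent_binaryMonomial m),
    Fintype.card_fin]

end BinaryForms

/-! ### Rational normal curves and their quadratic equations -/

section RationalNormalCurves

variable {K : Type*} [Field K] {n : ℕ}

theorem exists_rationalNormalCurve (hn : n ≠ 0)
    (F : Basis (Fin (n + 1)) K (homogeneousSubmodule (Fin 2) K n)) :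
    ∃ C : ClosedSubscheme K n, C.IsRationalNormalCurve ∧ C.ideal = RingHom.ker
      (aeval fun i => (F i : MvPolynomial (Fin 2) K) :
        MvPolynomial (Fin (n + 1)) K →ₐ[K] MvPolynomial (Fin 2) K) := by
  refine ⟨⟨_, isHomogeneousIdeal_ker_aeval hn fun i => (F i).2, fun f hf => ?_⟩, ⟨F, rfl⟩, rfl⟩
  obtain ⟨N, hN⟩ := hf 0
  rw [RingHom.mem_ker, map_mul, map_pow, aeval_X] at hN
  refine (mul_eq_zero.1 hN).resolve_left (pow_ne_zero _ ?_)
  have := F.ne_zero 0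
  simpa using this

/-- The parametrization embeds forms of degree `q` modulo `I(C)` in the binary forms of degree `nq`.
-/
theorem ClosedSubscheme.IsRationalNormalCurve.finrank_le {C : ClosedSubscheme K n}
    (hC : C.IsRationalNormalCurve) (q : ℕ) : C.hilbertFunction q ≤ n * q + 1 := by
  obtain ⟨F, hF⟩ := hC
  let a : MvPolynomial (Fin (n + 1)) K →ₐ[K] MvPolynomial (Fin 2) K :=
    aeval fun i => (F i : MvPolynomial (Fin 2) K)
  let b : (MvPolynomial (Fin (n + 1)) K ⧸ C.ideal) →ₐ[K] MvPolynomial (Fin 2) K :=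
    Ideal.Quotient.liftₐ C.ideal a fun x hx => by rw [hF] at hx; exact hx
  have hb : Function.Injective b := by
    rw [injective_iff_map_eq_zero]
    intro x hx
    obtain ⟨x, rfl⟩ := Ideal.Quotient.mk_surjective x
    rw [Ideal.Quotient.eq_zero_iff_mem, hF]
    exact hx
  have hle : (((homogeneousSubmodule (Fin (n + 1)) K q).map
      (Ideal.Quotient.mkₐ K C.ideal).toLinearMap).map b.toLinearMap) ≤
      homogeneousSubmodule (Fin 2) K (n * q) := by
    rintro _ ⟨_, ⟨x, hx, rfl⟩, rfl⟩
    exact IsHomogeneous.aeval hx (fun i => (F i : MvPolynomial (Fin 2) K)) fun i => (F i).2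
  have := Submodule.finrank_mono hle
  rw [finrank_binaryForms, ← (Submodule.equivMapOfInjective b.toLinearMap hb _).finrank_eq] at this
  exact this

theorem pow_mul_eq_of_homogeneous {σ A S : Type*} [CommRing A] [Algebra K A] [CommRing S]
    [Algebra K S] (f : MvPolynomial σ K →ₐ[K] A) (g : MvPolynomial σ K →ₐ[K] S) (e : S →ₐ[K] A)
    {a b : A} (h : ∀ P ∈ homogeneousSubmodule σ K 1, a * f P = b * e (g P)) {m : ℕ}
    {P : MvPolynomial σ K} (hP : P ∈ homogeneousSubmodule σ K m) :
    a ^ m * f P = b ^ m * e (g P) := by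
  rw [← homogeneousSubmodule_one_pow] at hP
  induction hP using Submodule.pow_induction_on_left' with
  | algebraMap r => simp
  | add x y i _ _ hx hy => simp only [map_add, mul_add, hx, hy]
  | mem_mul x hx i y _ hy =>
    simp only [map_mul, Nat.succ_eq_add_one, pow_succ]
    linear_combination (a ^ i * f y) * h x hx + b * e (g x) * hy

/-- The cleared form of `v j = v 0 (v 1 / v 0) ^ j`. It says that, where `v 0` is invertible, the
point is on the curve with parameters `(v 0 : v 1)`. The companion statement treats the other end,
with parameters `(v (n - 1) : v n)`. -/
theorem pow_mul_eq_of_relations {A : Type*} [CommRing A] {v : ℕ → A}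
    (hrel : ∀ i < n, ∀ j < n, v i * v (j + 1) = v (i + 1) * v j) (hn : 1 ≤ n) {j : ℕ} (hj : j ≤ n) :
    v 0 ^ n * v j = v 0 * (v 0 ^ (n - j) * v 1 ^ j) := by
  have h : ∀ j ≤ n, v 0 ^ j * v j = v 0 * v 1 ^ j := by
    intro j
    induction j with
    | zero => intro _; simp
    | succ j ih =>
      intro hj
      have h1 := ih (by omega)
      have h2 := hrel 0 (by omega) j (by omega)
      rw [pow_succ, pow_succ]
      linear_combination (v 0 ^ j) * h2 + v 1 * h1
  obtain ⟨k, rfl⟩ := Nat.exists_eq_add_of_le hj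
  rw [Nat.add_sub_cancel_left, pow_add]
  linear_combination (v 0 ^ k) * h j hj

theorem pow_mul_eq_of_relations' {A : Type*} [CommRing A] {v : ℕ → A}
    (hrel : ∀ i < n, ∀ j < n, v i * v (j + 1) = v (i + 1) * v j) (hn : 1 ≤ n) {j : ℕ} (hj : j ≤ n) :
    v n ^ n * v j = v n * (v (n - 1) ^ (n - j) * v n ^ j) := by
  have := pow_mul_eq_of_relations (v := fun j => v (n - j)) (n := n) (fun i hi j hj => by
    have := hrel (n - (j + 1)) (by omega) (n - (i + 1)) (by omega)
    rw [show n - (i + 1) + 1 = n - i by omega, show n - (j + 1) + 1 = n - j by omega] at this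
    linear_combination this) hn (Nat.sub_le n j)
  simp only [Nat.sub_zero, Nat.sub_sub_self hj] at this
  rw [this]
  ring

/-- At a common zero of `v 0` and `v n`, the relations `v (j + 1) ^ 2 = v j v (j + 2)` make every `v
j` vanish in turn, whereas `1` lies in their span. -/
theorem isCoprime_of_relations {A : Type*} [CommRing A] [Algebra K A] {v : ℕ → A}
    (hrel : ∀ i < n, ∀ j < n, v i * v (j + 1) = v (i + 1) * v j)
    (h1 : (1 : A) ∈ Submodule.span K (Set.range fun i : Fin (n + 1) => v i)) :
    IsCoprime (v 0) (v n) := by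
  rw [← Ideal.isCoprime_span_singleton_iff, Ideal.isCoprime_iff_sup_eq]
  by_contra hne
  obtain ⟨M, hM, hle⟩ := Ideal.exists_le_maximal _ hne
  have h0 : v 0 ∈ M := hle (Ideal.mem_sup_left (Ideal.mem_span_singleton_self _))
  have hvn : v n ∈ M := hle (Ideal.mem_sup_right (Ideal.mem_span_singleton_self _))
  have hall : ∀ j < n, v j ∈ M := by
    intro j
    induction j with
    | zero => intro _; exact h0
    | succ j ih =>
      intro hj
      have h2 := hrel j (by omega) (j + 1) hj
      refine hM.isPrime.mem_of_pow_mem 2 ?_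
      rw [pow_two, ← h2]
      exact M.mul_mem_right _ (ih (by omega))
  have hspan : Submodule.span K (Set.range fun i : Fin (n + 1) => v i) ≤ M.restrictScalars K := by
    rw [Submodule.span_le]
    rintro _ ⟨i, rfl⟩
    rcases Nat.lt_or_ge i n with hi | hi
    · exact hall i hi
    · have : (i : ℕ) = n := by omega
      simpa [this] using hvn
  exact hM.ne_top ((Ideal.eq_top_iff_one _).2 (hspan h1))

/-- The quadratic equations of a rational normal curve cut it out scheme-theoretically. -/
theorem exists_rationalNormalCurve_of_relations {A : Type*} [CommRing A] [Algebra K A] (hn : 1 ≤ n)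
    (f : MvPolynomial (Fin (n + 1)) K →ₐ[K] A) (v : ℕ → A)
    (hv : ∀ i ≤ n, v i ∈ (homogeneousSubmodule (Fin (n + 1)) K 1).map f.toLinearMap)
    (hli : LinearIndependent K fun i : Fin (n + 1) => v i)
    (h1 : 1 ∈ (homogeneousSubmodule (Fin (n + 1)) K 1).map f.toLinearMap)
    (hrel : ∀ i < n, ∀ j < n, v i * v (j + 1) = v (i + 1) * v j) :
    ∃ C : ClosedSubscheme K n, C.IsRationalNormalCurve ∧ C.ideal ≤ RingHom.ker f := by
  have hdim : Fintype.card (Fin (n + 1)) =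
      finrank K (homogeneousSubmodule (Fin (n + 1)) K 1) := finrank_homogeneousSubmodule_one.symm
  have hu : ∀ i : Fin (n + 1), ∃ u : homogeneousSubmodule (Fin (n + 1)) K 1, f u = v i := by
    intro i
    obtain ⟨u, hu, e⟩ := hv i (by omega)
    exact ⟨⟨u, hu⟩, e⟩
  choose u hu using hu
  have huli : LinearIndependent K u := by
    refine LinearIndependent.of_comp (f.toLinearMap ∘ₗ Submodule.subtype _) ?_
    have e : (f.toLinearMap ∘ₗ Submodule.subtype _) ∘ u = fun i : Fin (n + 1) => v i :=
      funext hu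
    rw [e]
    exact hli
  let bu := basisOfLinearIndependentOfCardEqFinrank huli hdim
  have hbu : ∀ i, bu i = u i := fun i => by simp [bu]
  let bX := basisOfLinearIndependentOfCardEqFinrank (K := K)
    (b := fun i : Fin (n + 1) => (⟨X i, isHomogeneous_X K i⟩ :
      homogeneousSubmodule (Fin (n + 1)) K 1))
    (LinearIndependent.of_comp (Submodule.subtype _) linearIndependent_X) hdim
  have hbX : ∀ i, (bX i : MvPolynomial (Fin (n + 1)) K) = X i := fun i => by simp [bX]
  let bb := basisOfLinearIndependentOfCardEqFinrank (K := K)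
    (b := fun j : Fin (n + 1) => (⟨binaryMonomial K n j, isHomogeneous_binaryMonomial (by omega)⟩ :
      homogeneousSubmodule (Fin 2) K n))
    (LinearIndependent.of_comp (Submodule.subtype _) (linearIndependent_binaryMonomial n))
    (by rw [finrank_binaryForms, Fintype.card_fin])
  have hbb : ∀ i, (bb i : MvPolynomial (Fin 2) K) = binaryMonomial K n i := fun i => by simp [bb]
  -- Coordinates on the curve are chosen so that the linear form lifting `v i` restricts to `s ^ (n
  -- - i) t ^ i`.
  let Θ := bu.equiv bb (Equiv.refl _)
  let F := bX.map Θ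
  obtain ⟨C, hC, hCF⟩ := exists_rationalNormalCurve (by omega) F
  refine ⟨C, hC, fun P hP => ?_⟩
  set a : MvPolynomial (Fin (n + 1)) K →ₐ[K] MvPolynomial (Fin 2) K :=
    aeval fun i => (F i : MvPolynomial (Fin 2) K) with ha
  have haΘ : a.toLinearMap ∘ₗ Submodule.subtype _ = Submodule.subtype _ ∘ₗ Θ.toLinearMap := by
    refine bX.ext fun i => ?_
    simp [hbX, ha, F]
  have hau : ∀ i, a (u i) = binaryMonomial K n i := by
    intro i
    have := LinearMap.congr_fun haΘ (u i)
    rw [← hbb, ← hbu]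
    rw [← hbu] at this
    simpa [Θ] using this
  have h1' : (1 : A) ∈ Submodule.span K (Set.range fun i : Fin (n + 1) => v i) := by
    obtain ⟨w, hw, hw1⟩ := h1
    have := bu.sum_repr ⟨w, hw⟩
    have e := congrArg (f.toLinearMap ∘ₗ Submodule.subtype _) this
    rw [map_sum] at e
    have e2 : (f.toLinearMap ∘ₗ Submodule.subtype _) (⟨w, hw⟩ :
      homogeneousSubmodule (Fin (n + 1)) K 1) = 1 := hw1
    rw [e2] at e
    rw [← e]
    refine Submodule.sum_mem _ fun i _ => ?_
    rw [map_smul, hbu]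
    refine Submodule.smul_mem _ _ (Submodule.subset_span ⟨i, ?_⟩)
    exact (hu i).symm
  have hlin : ∀ (c d : A) (s t : A), (∀ j ≤ n, c * v j = d * (s ^ (n - j) * t ^ j)) →
      ∀ P ∈ homogeneousSubmodule (Fin (n + 1)) K 1, c * f P = d * (aeval ![s, t]) (a P) := by
    intro c d s t h P hP
    have : LinearMap.mulLeft K c ∘ₗ f.toLinearMap ∘ₗ Submodule.subtype _ =
        LinearMap.mulLeft K d ∘ₗ (aeval ![s, t]).toLinearMap ∘ₗ a.toLinearMap ∘ₗ
          Submodule.subtype (homogeneousSubmodule (Fin (n + 1)) K 1) := by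
      refine bu.ext fun i => ?_
      simp [hbu, hu, hau, binaryMonomial, h i (by omega)]
    exact LinearMap.congr_fun this ⟨P, hP⟩
  -- A form vanishing on the curve is killed by powers of `v 0` and of `v n`. These are coprime, so
  -- it vanishes in `A`.
  have hcop := isCoprime_of_relations hrel h1'
  have hcomp : ∀ m, f (homogeneousComponent m P) = 0 := by
    intro m
    have hPm : a (homogeneousComponent m P) = 0 := by
      have := C.homogeneous P hP m
      rwa [hCF] at this
    have e0 := pow_mul_eq_of_homogeneous f a (aeval ![v 0, v 1])
      (hlin _ _ _ _ fun j hj => pow_mul_eq_of_relations hrel hn hj)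
      (homogeneousComponent_mem m P)
    have e1 := pow_mul_eq_of_homogeneous f a (aeval ![v (n - 1), v n])
      (hlin _ _ _ _ fun j hj => pow_mul_eq_of_relations' hrel hn hj)
      (homogeneousComponent_mem m P)
    rw [hPm, map_zero, mul_zero, ← pow_mul] at e0 e1
    obtain ⟨x, y, hxy⟩ := hcop.pow (m := n * m) (n := n * m)
    rw [← one_mul (f _), ← hxy, add_mul, mul_assoc, mul_assoc, e0, e1, mul_zero, mul_zero, add_zero]
  rw [RingHom.mem_ker, ← sum_homogeneousComponent P, map_sum]
  exact Finset.sum_eq_zero fun m _ => hcomp m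

end RationalNormalCurves

end ProjSub

namespace ProjSub

/-! ### Cone contractions of the Čech complex -/

section Homotopy

variable {K : Type*} [Field K] {n p : ℕ}

/-- A cochain as a function on all finite sets of indices. -/
def extendCochain (c : (Fin (p + 1) ↪o Fin (n + 1)) → Laurent K n) (S : Finset (Fin (n + 1))) :
    Laurent K n :=
  if h : S.card = p + 1 then c (S.orderEmbOfFin h) else 0

/-- The sign of the position of `i` relative to `S`. -/
def positionSign (K : Type*) [Field K] (i : Fin (n + 1)) (S : Finset (Fin (n + 1))) : K :=
  (-1) ^ (S.filter (· < i)).card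

theorem positionSign_mul_self (i : Fin (n + 1)) (S : Finset (Fin (n + 1))) :
    positionSign K i S * positionSign K i S = 1 := by
  rw [positionSign, ← mul_pow]; simp

theorem positionSign_erase_self (i : Fin (n + 1)) (S : Finset (Fin (n + 1))) :
    positionSign K i (S.erase i) = positionSign K i S := by
  rw [positionSign, positionSign, Finset.filter_erase, Finset.erase_eq_of_notMem (by simp)]

theorem positionSign_insert_self (i : Fin (n + 1)) (S : Finset (Fin (n + 1))) :
    positionSign K i (insert i S) = positionSign K i S := by
  rw [positionSign, positionSign, Finset.filter_insert, if_neg (lt_irrefl i)]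

/-- Exactly one position changes by one: that of `k` on erasing `i` if `i < k`, that of `i` on
inserting `k` if `k < i`. -/
theorem positionSign_mul_insert {i k : Fin (n + 1)} {S : Finset (Fin (n + 1))} (hi : i ∈ S)
    (hk : k ∉ S) : positionSign K k S * positionSign K i (insert k S) =
      -(positionSign K i S * positionSign K k (S.erase i)) := by
  simp only [positionSign, Finset.filter_insert, Finset.filter_erase]
  rcases lt_trichotomy i k with h | rfl | h
  · rw [if_neg (asymm h)]
    have hmem : i ∈ S.filter (· < k) := by simp [hi, h]
    rw [← Finset.card_erase_add_one hmem, pow_succ]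
    ring
  · exact absurd hi hk
  · rw [if_pos h, Finset.card_insert_of_notMem (by simp [hk]),
      Finset.erase_eq_of_notMem (by simp [h.le]), pow_succ]
    ring

theorem card_map_orderEmb (s : Fin p ↪o Fin (n + 1)) :
    (Finset.univ.map s.toEmbedding).card = p := by simp

theorem extendCochain_map (c : (Fin (p + 1) ↪o Fin (n + 1)) → Laurent K n)
    (s : Fin (p + 1) ↪o Fin (n + 1)) : extendCochain c (Finset.univ.map s.toEmbedding) = c s := by
  rw [extendCochain, dif_pos (card_map_orderEmb s)]
  congr 1
  exact (Finset.orderEmbOfFin_unique' _ fun x => by simp).symm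

theorem exists_map_eq {S : Finset (Fin (n + 1))} (h : S.card = p) :
    ∃ s : Fin p ↪o Fin (n + 1), Finset.univ.map s.toEmbedding = S :=
  ⟨S.orderEmbOfFin h, by
    ext x
    simp⟩

theorem coboundary_apply (c : (Fin (p + 1) ↪o Fin (n + 1)) → Laurent K n)
    (s : Fin (p + 2) ↪o Fin (n + 1)) : coboundary K n p c s =
      ∑ i ∈ Finset.univ.map s.toEmbedding, positionSign K i (Finset.univ.map s.toEmbedding) •
        extendCochain c ((Finset.univ.map s.toEmbedding).erase i) := by
  rw [Finset.sum_map]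
  simp only [coboundary, LinearMap.pi_apply, LinearMap.sum_apply, LinearMap.smul_apply,
    LinearMap.proj_apply]
  refine Finset.sum_congr rfl fun k _ => ?_
  congr 1
  · rw [positionSign]
    congr 1
    rw [Finset.filter_map, Finset.card_map]
    have : Finset.univ.filter ((· < s.toEmbedding k) ∘ s.toEmbedding) = Finset.Iio k := by
      ext j; simp
    rw [this, Fin.card_Iio]
  · refine (extendCochain_map c _).symm.trans ?_
    congr 1
    ext x
    simp only [Finset.mem_map, Finset.mem_univ, true_and, Finset.mem_erase]
    constructor
    · rintro ⟨j, rfl⟩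
      exact ⟨fun e => Fin.succAbove_ne k j (s.injective e), _, rfl⟩
    · rintro ⟨hx, j, rfl⟩
      obtain ⟨i, rfl⟩ := Fin.exists_succAbove_eq (x := j) (y := k) (fun e => hx (by rw [e]))
      exact ⟨i, rfl⟩

theorem extendCochain_coboundary (c : (Fin (p + 1) ↪o Fin (n + 1)) → Laurent K n)
    {S : Finset (Fin (n + 1))} (h : S.card = p + 2) : extendCochain (coboundary K n p c) S =
      ∑ i ∈ S, positionSign K i S • extendCochain c (S.erase i) := by
  obtain ⟨s, rfl⟩ := exists_map_eq h
  rw [extendCochain_map, coboundary_apply]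

/-- The cone contraction with vertex `k`. -/
def contraction (k : Fin (n + 1)) (c : (Fin (p + 2) ↪o Fin (n + 1)) → Laurent K n) :
    (Fin (p + 1) ↪o Fin (n + 1)) → Laurent K n := fun s =>
  if k ∈ Finset.univ.map s.toEmbedding then 0 else
    positionSign K k (Finset.univ.map s.toEmbedding) •
      extendCochain c (insert k (Finset.univ.map s.toEmbedding))

theorem extendCochain_contraction (k : Fin (n + 1))
    (c : (Fin (p + 2) ↪o Fin (n + 1)) → Laurent K n) {S : Finset (Fin (n + 1))}
    (h : S.card = p + 1) : extendCochain (contraction k c) S =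
      if k ∈ S then 0 else positionSign K k S • extendCochain c (insert k S) := by
  obtain ⟨s, rfl⟩ := exists_map_eq h
  rw [extendCochain_map, contraction]

@[simp]
theorem contraction_zero (k : Fin (n + 1)) :
    contraction k (0 : (Fin (p + 2) ↪o Fin (n + 1)) → Laurent K n) = 0 := by
  ext1 s
  simp [contraction, extendCochain]

/-- The cone contraction is a homotopy between the identity and zero. -/
theorem coboundary_contraction_add (k : Fin (n + 1))
    (c : (Fin (p + 2) ↪o Fin (n + 1)) → Laurent K n) :
    coboundary K n p (contraction k c) + contraction k (coboundary K n (p + 1) c) = c := by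
  ext1 s
  rw [Pi.add_apply, coboundary_apply, contraction, ← extendCochain_map c s]
  have hcard := card_map_orderEmb s
  set S := Finset.univ.map s.toEmbedding with hS
  by_cases hk : k ∈ S
  · rw [if_pos hk, add_zero, Finset.sum_eq_single_of_mem k hk]
    · rw [extendCochain_contraction k c (by rw [Finset.card_erase_of_mem hk]; omega),
        if_neg (by simp), Finset.insert_erase hk, smul_smul, positionSign_erase_self,
        positionSign_mul_self, one_smul]
    · intro i hi hik
      rw [extendCochain_contraction k c (by rw [Finset.card_erase_of_mem hi]; omega),
        if_pos (by simp [hk, hik.symm]), smul_zero]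
  · rw [if_neg hk, extendCochain_coboundary c (by rw [Finset.card_insert_of_notMem hk]; omega),
      Finset.sum_insert hk, Finset.erase_insert hk, positionSign_insert_self, smul_add, smul_smul,
      positionSign_mul_self, one_smul, Finset.smul_sum, add_comm, add_assoc,
      ← Finset.sum_add_distrib, Finset.sum_eq_zero, add_zero]
    intro i hi
    have hne : k ≠ i := fun e => hk (e ▸ hi)
    rw [extendCochain_contraction k c (by rw [Finset.card_erase_of_mem hi]; omega),
      if_neg (by simp [hk]), smul_smul, smul_smul, ← Finset.erase_insert_of_ne hne,
      positionSign_mul_insert hi hk, neg_smul, neg_add_cancel]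

theorem coboundary_map (f : Laurent K n →ₗ[K] Laurent K n)
    (c : (Fin (p + 1) ↪o Fin (n + 1)) → Laurent K n) :
    coboundary K n p (fun s => f (c s)) = fun s => f (coboundary K n p c s) := by
  ext1 s
  simp [coboundary]

end Homotopy

end ProjSub

namespace ProjSub

open MvPolynomial

/-! ### Graded Laurent polynomials -/

section LaurentLemmas

variable {K : Type*} [Field K] {n : ℕ}

/-- The total degree as a homomorphism on exponents. -/
def expDegree (n : ℕ) : (Fin (n + 1) → ℤ) →+ ℤ where
  toFun e := ∑ i, e i
  map_zero' := by simp
  map_add' a b := by simp [Finset.sum_add_distrib]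

/-- The Laurent polynomials of degree `m`. -/
abbrev laurentDegree (K : Type*) [Field K] (n : ℕ) (m : ℤ) : Submodule K (Laurent K n) :=
  AddMonoidAlgebra.gradeBy K (expDegree n) m

theorem mul_mem_laurentDegree {a b : ℤ} {f g : Laurent K n} (hf : f ∈ laurentDegree K n a)
    (hg : g ∈ laurentDegree K n b) : f * g ∈ laurentDegree K n (a + b) :=
  (AddMonoidAlgebra.gradeBy.gradedMonoid (R := K) (expDegree n)).mul_mem hf hg

theorem one_mem_laurentDegree : (1 : Laurent K n) ∈ laurentDegree K n 0 :=
  (AddMonoidAlgebra.gradeBy.gradedMonoid (R := K) (expDegree n)).one_mem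

theorem pow_mem_laurentDegree {a : ℤ} {f : Laurent K n} (hf : f ∈ laurentDegree K n a) (N : ℕ) :
    f ^ N ∈ laurentDegree K n (N * a) := by
  induction N with
  | zero => simpa using one_mem_laurentDegree
  | succ N ih =>
    rw [pow_succ]
    have := mul_mem_laurentDegree ih hf
    rwa [show (N : ℤ) * a + a = ((N + 1 : ℕ) : ℤ) * a by push_cast; ring] at this

theorem x_mem_laurentDegree (i : Fin (n + 1)) : Laurent.x K i ∈ laurentDegree K n 1 := by
  have := AddMonoidAlgebra.single_mem_gradeBy (R := K) (expDegree n) (Pi.single i 1) 1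
  have h : expDegree n (Pi.single i 1) = 1 := by simp [expDegree]
  rwa [h] at this

/-- The inverse of a variable. -/
def Laurent.xInv (K : Type*) [Field K] {n : ℕ} (i : Fin (n + 1)) : Laurent K n :=
  AddMonoidAlgebra.single (-Pi.single i 1) 1

theorem x_mul_xInv (i : Fin (n + 1)) : Laurent.x K i * Laurent.xInv K i = 1 := by
  rw [Laurent.x, Laurent.xInv, AddMonoidAlgebra.single_mul_single, add_neg_cancel, mul_one]
  rfl

theorem xInv_mem_laurentDegree (i : Fin (n + 1)) : Laurent.xInv K i ∈ laurentDegree K n (-1) := by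
  have := AddMonoidAlgebra.single_mem_gradeBy (R := K) (expDegree n) (-Pi.single i 1) 1
  have h : expDegree n (-Pi.single i 1) = -1 := by simp [expDegree]
  rwa [h] at this

/-- The inclusion of the exponents of monomials into those of Laurent monomials. -/
def expCast (n : ℕ) : (Fin (n + 1) →₀ ℕ) →+ (Fin (n + 1) → ℤ) where
  toFun d i := d i
  map_zero' := by ext; simp
  map_add' a b := by ext; simp

theorem expCast_injective : Function.Injective (expCast n) := by
  intro a b h
  ext i
  exact Int.ofNat_injective (congrFun h i)

theorem toLaurent_X (i : Fin (n + 1)) : toLaurent K n (X i) = Laurent.x K i := by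
  simp [toLaurent]

theorem toLaurent_eq (g : MvPolynomial (Fin (n + 1)) K) :
    toLaurent K n g = AddMonoidAlgebra.mapDomain (expCast n) g := by
  have : toLaurent K n = AddMonoidAlgebra.mapDomainAlgHom K K (expCast n) := by
    refine MvPolynomial.algHom_ext fun i => ?_
    rw [toLaurent_X, X, monomial]
    change _ = AddMonoidAlgebra.mapDomain (expCast n) (AddMonoidAlgebra.single _ _)
    rw [AddMonoidAlgebra.mapDomain_single, Laurent.x]
    congr 1
    ext j
    simp [expCast, Finsupp.single_apply, Pi.single_apply, eq_comm]
  rw [this]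
  rfl

theorem toLaurent_injective : Function.Injective (toLaurent K n) := by
  intro a b h
  rw [toLaurent_eq, toLaurent_eq] at h
  exact AddMonoidAlgebra.mapDomain_injective expCast_injective h

theorem exists_of_mem_support_toLaurent {g : MvPolynomial (Fin (n + 1)) K} {e : Fin (n + 1) → ℤ}
    (he : e ∈ (toLaurent K n g).coeff.support) : ∃ d ∈ g.support, expCast n d = e := by
  classical
  rw [toLaurent_eq] at he
  exact Finset.mem_image.1 (Finsupp.mapDomain_support he)

theorem toLaurent_mem_laurentDegree {g : MvPolynomial (Fin (n + 1)) K} {m : ℕ}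
    (hg : g.IsHomogeneous m) : toLaurent K n g ∈ laurentDegree K n m := by
  intro e he
  obtain ⟨d, hd, rfl⟩ := exists_of_mem_support_toLaurent he
  have := hg (mem_support_iff.1 hd)
  rw [Finsupp.weight_apply, Finsupp.sum_fintype _ _ (by simp)] at this
  simp only [Pi.one_apply, smul_eq_mul, mul_one] at this
  rw [← this]
  simp [expDegree, expCast]

theorem coeff_toLaurent (g : MvPolynomial (Fin (n + 1)) K) (d : Fin (n + 1) →₀ ℕ) :
    (toLaurent K n g).coeff (expCast n d) = coeff d g := by
  rw [toLaurent_eq]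
  exact Finsupp.mapDomain_apply expCast_injective _ _

theorem isHomogeneous_of_toLaurent_mem {g : MvPolynomial (Fin (n + 1)) K} {m : ℕ}
    (hg : toLaurent K n g ∈ laurentDegree K n m) : g.IsHomogeneous m := by
  intro d hd
  have := hg (expCast n d) (by rw [Finsupp.mem_support_iff, coeff_toLaurent]; exact hd)
  rw [Finsupp.weight_apply, Finsupp.sum_fintype _ _ (by simp)]
  simp only [Pi.one_apply, smul_eq_mul, mul_one]
  have h : ((∑ i, d i : ℕ) : ℤ) = m := by rw [← this]; simp [expDegree, expCast]
  exact_mod_cast h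

theorem single_eq_toLaurent {e : Fin (n + 1) → ℤ} (he : ∀ i, 0 ≤ e i) (a : K) :
    (AddMonoidAlgebra.single e a : Laurent K n) =
      toLaurent K n (monomial (Finsupp.equivFunOnFinite.symm fun i => (e i).toNat) a) := by
  rw [toLaurent_eq, monomial]
  change _ = AddMonoidAlgebra.mapDomain (expCast n) (AddMonoidAlgebra.single _ _)
  rw [AddMonoidAlgebra.mapDomain_single]
  congr 1
  ext i
  simp [expCast, he i]

theorem laurent_eq_sum (f : Laurent K n) :
    f = ∑ e ∈ f.coeff.support, AddMonoidAlgebra.single e (f.coeff e) := by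
  apply AddMonoidAlgebra.coeff_injective
  rw [AddMonoidAlgebra.coeff_sum]
  exact (Finsupp.sum_single f.coeff).symm

theorem exists_toLaurent_eq {f : Laurent K n} (hf : ∀ e ∈ f.coeff.support, ∀ i, 0 ≤ e i) :
    ∃ g, toLaurent K n g = f := by
  have : f ∈ (toLaurent K n).range := by
    rw [laurent_eq_sum f]
    refine sum_mem fun e he => ?_
    rw [single_eq_toLaurent (hf e he)]
    exact ⟨_, rfl⟩
  exact this

end LaurentLemmas

/-! ### Localizations at products of variables -/

section Localized

variable {K : Type*} [Field K] {n : ℕ} {I : Ideal (MvPolynomial (Fin (n + 1)) K)}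
  {S T : Finset (Fin (n + 1))} {f g : Laurent K n} {m k : ℤ}

theorem toLaurent_prod_X (S : Finset (Fin (n + 1))) :
    toLaurent K n (∏ i ∈ S, X i) = ∏ i ∈ S, Laurent.x K i := by
  simp [toLaurent]

/-- The localization of an ideal at the product of the variables in `S`. -/
def localized (I : Ideal (MvPolynomial (Fin (n + 1)) K)) (S : Finset (Fin (n + 1))) :
    Submodule K (Laurent K n) where
  carrier := {f | ∃ N : ℕ, ∃ g ∈ I, (∏ i ∈ S, Laurent.x K i) ^ N * f = toLaurent K n g}
  zero_mem' := ⟨0, 0, I.zero_mem, by simp⟩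
  add_mem' := by
    rintro f₁ f₂ ⟨N₁, g₁, hg₁, e₁⟩ ⟨N₂, g₂, hg₂, e₂⟩
    refine ⟨N₁ + N₂, (∏ i ∈ S, X i) ^ N₂ * g₁ + (∏ i ∈ S, X i) ^ N₁ * g₂,
      I.add_mem (I.mul_mem_left _ hg₁) (I.mul_mem_left _ hg₂), ?_⟩
    rw [map_add, map_mul, map_mul, map_pow, map_pow, toLaurent_prod_X, ← e₁, ← e₂]
    ring
  smul_mem' := by
    rintro a f ⟨N, g, hg, e⟩
    refine ⟨N, a • g, ?_, ?_⟩
    · rw [smul_eq_C_mul]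
      exact I.mul_mem_left _ hg
    · rw [map_smul, ← e, mul_smul_comm]

theorem mul_mem_localized (hf : f ∈ localized ⊤ S) (hg : g ∈ localized I S) :
    f * g ∈ localized I S := by
  obtain ⟨N, a, -, ha⟩ := hf
  obtain ⟨M, b, hb, hb'⟩ := hg
  refine ⟨N + M, a * b, I.mul_mem_left _ hb, ?_⟩
  rw [map_mul, ← ha, ← hb']
  ring

theorem mul_mem_localized' (hf : f ∈ localized I S) (hg : g ∈ localized ⊤ S) :
    f * g ∈ localized I S := by
  rw [mul_comm]; exact mul_mem_localized hg hf

theorem localized_mono_ideal {J : Ideal (MvPolynomial (Fin (n + 1)) K)} (h : I ≤ J) :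
    localized I S ≤ localized J S := fun _ ⟨N, g, hg, e⟩ => ⟨N, g, h hg, e⟩

theorem toLaurent_mem_localized {a : MvPolynomial (Fin (n + 1)) K} (ha : a ∈ I) :
    toLaurent K n a ∈ localized I S := ⟨0, a, ha, by simp⟩

theorem toLaurent_mem_localized_top (a : MvPolynomial (Fin (n + 1)) K) :
    toLaurent K n a ∈ localized ⊤ S := toLaurent_mem_localized trivial

theorem one_mem_localized_top : (1 : Laurent K n) ∈ localized ⊤ S := by
  simpa using toLaurent_mem_localized_top (K := K) (n := n) (S := S) 1

theorem pow_mem_localized_top (hf : f ∈ localized ⊤ S) (N : ℕ) : f ^ N ∈ localized ⊤ S := by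
  induction N with
  | zero => simpa using one_mem_localized_top
  | succ N ih => rw [pow_succ]; exact mul_mem_localized ih hf

theorem localized_mono (h : S ⊆ T) : localized I S ≤ localized I T := by
  rintro f ⟨N, g, hg, e⟩
  refine ⟨N, (∏ i ∈ T \ S, X i) ^ N * g, I.mul_mem_left _ hg, ?_⟩
  rw [map_mul, map_pow, toLaurent_prod_X, ← e, ← Finset.prod_sdiff h]
  ring

theorem xInv_mem_localized {i : Fin (n + 1)} (hi : i ∈ S) :
    Laurent.xInv K i ∈ localized ⊤ S := by
  refine localized_mono (Finset.singleton_subset_iff.2 hi) ⟨1, 1, trivial, ?_⟩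
  simp [x_mul_xInv]

theorem mem_localized_singleton_iff {i : Fin (n + 1)} {a : MvPolynomial (Fin (n + 1)) K} :
    toLaurent K n a ∈ localized I {i} ↔ ∃ N : ℕ, X i ^ N * a ∈ I := by
  constructor
  · rintro ⟨N, g, hg, e⟩
    refine ⟨N, ?_⟩
    rw [Finset.prod_singleton, ← toLaurent_X, ← map_pow, ← map_mul] at e
    rwa [toLaurent_injective e]
  · rintro ⟨N, hN⟩
    refine ⟨N, _, hN, ?_⟩
    rw [Finset.prod_singleton, map_mul, map_pow, toLaurent_X]

theorem exists_pow_mul_mem_localized {i : Fin (n + 1)} (hf : f ∈ localized I (insert i S)) :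
    ∃ N₀ : ℕ, ∀ N ≥ N₀, Laurent.x K i ^ N * f ∈ localized I S := by
  by_cases hi : i ∈ S
  · rw [Finset.insert_eq_of_mem hi] at hf
    refine ⟨0, fun N _ => mul_mem_localized ?_ hf⟩
    rw [← toLaurent_X, ← map_pow]
    exact toLaurent_mem_localized_top _
  obtain ⟨N₀, g, hg, e⟩ := hf
  refine ⟨N₀, fun N hN => ⟨N₀, X i ^ (N - N₀) * g, I.mul_mem_left _ hg, ?_⟩⟩
  rw [map_mul, map_pow, toLaurent_X, ← e, Finset.prod_insert hi]
  obtain ⟨k, rfl⟩ := Nat.exists_eq_add_of_le hN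
  rw [Nat.add_sub_cancel_left]
  ring

theorem mem_localized_top_iff :
    f ∈ localized (⊤ : Ideal (MvPolynomial (Fin (n + 1)) K)) S ↔
      ∀ e ∈ f.coeff.support, ∀ i, i ∉ S → 0 ≤ e i := by
  have hprod : ∀ N : ℕ, (∏ i ∈ S, Laurent.x K i) ^ N =
      (AddMonoidAlgebra.single (fun i => if i ∈ S then (N : ℤ) else 0) 1 : Laurent K n) := by
    have h1 : ∏ i ∈ S, Laurent.x K i =
        (AddMonoidAlgebra.single (fun i => if i ∈ S then (1 : ℤ) else 0) 1 : Laurent K n) := by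
      induction S using Finset.induction_on with
      | empty => simp; rfl
      | insert a s ha ih =>
        rw [Finset.prod_insert ha, ih, Laurent.x, AddMonoidAlgebra.single_mul_single, mul_one]
        congr 1
        ext j
        by_cases hj : j = a
        · subst hj; simp [ha]
        · simp [hj]
    intro N
    rw [h1, AddMonoidAlgebra.single_pow, one_pow]
    congr 1
    ext j
    simp
  constructor
  · rintro ⟨N, g, -, e⟩ d hd i hi
    rw [hprod] at e
    have h1 : (toLaurent K n g).coeff ((fun i => if i ∈ S then (N : ℤ) else 0) + d) = f.coeff d := by
      rw [← e]
      refine (AddMonoidAlgebra.coeff_single_mul_eq_mul_coeff d fun m' _ => ?_).trans (one_mul _)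
      exact add_right_inj _
    have h2 : (fun i => if i ∈ S then (N : ℤ) else 0) + d ∈ (toLaurent K n g).coeff.support := by
      rw [Finsupp.mem_support_iff, h1]
      exact Finsupp.mem_support_iff.1 hd
    obtain ⟨d', -, hd'⟩ := exists_of_mem_support_toLaurent h2
    have := congrFun hd' i
    simp only [Pi.add_apply, if_neg hi, zero_add] at this
    rw [← this]
    exact Int.natCast_nonneg _
  · intro h
    rw [laurent_eq_sum f]
    refine Submodule.sum_mem _ fun e he => ?_
    have hnn : ∀ i, 0 ≤ ((fun i => if i ∈ S then ((∑ j, (e j).natAbs : ℕ) : ℤ) else 0) + e) i := by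
      intro i
      by_cases hi : i ∈ S
      · have : (e i).natAbs ≤ ∑ j, (e j).natAbs :=
          Finset.single_le_sum (f := fun j => (e j).natAbs) (fun _ _ => Nat.zero_le _)
            (Finset.mem_univ i)
        simp only [Pi.add_apply, if_pos hi]
        omega
      · simpa [hi] using h e he i hi
    obtain ⟨g, hg⟩ : ∃ g, toLaurent K n g = AddMonoidAlgebra.single _ (f.coeff e) :=
      ⟨_, (single_eq_toLaurent hnn _).symm⟩
    refine ⟨∑ j, (e j).natAbs, g, Submodule.mem_top, ?_⟩
    rw [hprod, AddMonoidAlgebra.single_mul_single, one_mul, hg]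

/-- Global sections of `𝒪(m)` are forms of degree `m`. -/
theorem exists_toLaurent_eq_of_mem_localized (hn : 1 ≤ n)
    (hf : ∀ i, f ∈ localized (⊤ : Ideal (MvPolynomial (Fin (n + 1)) K)) {i}) :
    ∃ g, toLaurent K n g = f := by
  refine exists_toLaurent_eq fun e he i => ?_
  have : Nontrivial (Fin (n + 1)) := Fin.nontrivial_iff_two_le.2 (by omega)
  obtain ⟨j, hj⟩ := exists_ne i
  exact mem_localized_top_iff.1 (hf j) e he i (by simpa using hj.symm)

end Localized

end ProjSub

namespace ProjSub

open MvPolynomial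

/-! ### Vanishing of higher cohomology -/

section Cech

variable {K : Type*} [Field K] {n p : ℕ} {I : Ideal (MvPolynomial (Fin (n + 1)) K)} {m : ℤ}

theorem extendCochain_map_linear (f : Laurent K n →ₗ[K] Laurent K n)
    (c : (Fin (p + 1) ↪o Fin (n + 1)) → Laurent K n) (S : Finset (Fin (n + 1))) :
    extendCochain (fun s => f (c s)) S = f (extendCochain c S) := by
  unfold extendCochain
  split_ifs <;> simp

theorem extendCochain_mem {D : Finset (Fin (n + 1)) → Submodule K (Laurent K n)}
    {c : (Fin (p + 1) ↪o Fin (n + 1)) → Laurent K n}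
    (hc : ∀ s, c s ∈ D (Finset.univ.map s.toEmbedding)) (S : Finset (Fin (n + 1))) :
    extendCochain c S ∈ D S := by
  by_cases h : S.card = p + 1
  · obtain ⟨s, rfl⟩ := exists_map_eq h
    rw [extendCochain_map]
    exact hc s
  · rw [extendCochain, dif_neg h]
    exact zero_mem _

theorem coboundary_mem {D : Finset (Fin (n + 1)) → Submodule K (Laurent K n)} (hD : Monotone D)
    {c : (Fin (p + 1) ↪o Fin (n + 1)) → Laurent K n}
    (hc : ∀ s, c s ∈ D (Finset.univ.map s.toEmbedding)) (s : Fin (p + 2) ↪o Fin (n + 1)) :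
    coboundary K n p c s ∈ D (Finset.univ.map s.toEmbedding) := by
  rw [coboundary_apply]
  exact Submodule.sum_mem _ fun i _ => Submodule.smul_mem _ _
    (hD (Finset.erase_subset _ _) (extendCochain_mem hc _))

theorem sections_mono_set : Monotone (sections I m) :=
  fun _ _ h _ hf => ⟨hf.1, localized_mono h hf.2⟩

theorem localized_mono_set : Monotone (localized I) := fun _ _ h => localized_mono h

theorem mem_cochains {c : (Fin (p + 1) ↪o Fin (n + 1)) → Laurent K n} :
    c ∈ cochains I m p ↔ ∀ s, c s ∈ sections I m (Finset.univ.map s.toEmbedding) := by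
  simp [cochains, Submodule.mem_pi]

theorem coboundary_mem_cochains {c : (Fin (p + 1) ↪o Fin (n + 1)) → Laurent K n}
    (hc : c ∈ cochains I m p) : coboundary K n p c ∈ cochains I m (p + 1) :=
  mem_cochains.2 (coboundary_mem sections_mono_set (mem_cochains.1 hc))

theorem cochains_le_top : cochains I m p ≤ cochains ⊤ m p :=
  fun _ hc => mem_cochains.2 fun s =>
    ⟨(mem_cochains.1 hc s).1, localized_mono_ideal le_top (mem_cochains.1 hc s).2⟩

theorem positionSign_mul_erase {i k : Fin (n + 1)} {S : Finset (Fin (n + 1))} (hi : i ∈ S)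
    (hk : k ∈ S) (hik : i ≠ k) : positionSign K i S * positionSign K k (S.erase i) =
      -(positionSign K k S * positionSign K i (S.erase k)) := by
  have h := positionSign_mul_insert (K := K) (i := i) (k := k) (S := S.erase k) (by simp [hi, hik])
    (by simp)
  rw [Finset.insert_erase hk, positionSign_erase_self, Finset.erase_right_comm,
    positionSign_erase_self] at h
  have h1 := positionSign_mul_self (K := K) k S
  have h2 := positionSign_mul_self (K := K) k (S.erase i)
  linear_combination (positionSign K k S * positionSign K k (S.erase i)) * h -
    (positionSign K i S * positionSign K k (S.erase i)) * h1 -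
    (positionSign K i (S.erase k) * positionSign K k S) * h2

theorem coboundary_coboundary (c : (Fin (p + 1) ↪o Fin (n + 1)) → Laurent K n) :
    coboundary K n (p + 1) (coboundary K n p c) = 0 := by
  ext1 s
  rw [coboundary_apply]
  have hcard := card_map_orderEmb s
  set S := Finset.univ.map s.toEmbedding
  rw [Finset.sum_congr rfl fun i hi => by
    rw [extendCochain_coboundary c (by rw [Finset.card_erase_of_mem hi]; omega), Finset.smul_sum],
    Finset.sum_sigma']
  refine Finset.sum_involution (fun a _ => ⟨a.2, a.1⟩) ?_ ?_ ?_ ?_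
  · rintro ⟨i, j⟩ h
    simp only [Finset.mem_sigma, Finset.mem_erase] at h
    simp only [smul_smul]
    rw [positionSign_mul_erase h.1 h.2.2 h.2.1.symm, Finset.erase_right_comm, neg_smul,
      neg_add_cancel]
  · rintro ⟨i, j⟩ h - e
    simp only [Finset.mem_sigma, Finset.mem_erase] at h
    simp only [Sigma.mk.injEq] at e
    exact h.2.1 e.1
  · rintro ⟨i, j⟩ h
    simp only [Finset.mem_sigma, Finset.mem_erase] at h ⊢
    exact ⟨h.2.2, h.2.1.symm, h.1⟩
  · rintro ⟨i, j⟩ h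
    rfl

open Classical in
/-- The part of a Laurent polynomial with exponents satisfying a predicate. -/
def filterExp (P : (Fin (n + 1) → ℤ) → Prop) : Laurent K n →ₗ[K] Laurent K n where
  toFun f := AddMonoidAlgebra.ofCoeff (f.coeff.filter P)
  map_add' f g := by
    apply AddMonoidAlgebra.coeff_injective
    exact Finsupp.filter_add
  map_smul' a f := by
    apply AddMonoidAlgebra.coeff_injective
    exact Finsupp.filter_smul

open Classical in
theorem coeff_filterExp (P : (Fin (n + 1) → ℤ) → Prop) (f : Laurent K n) (e : Fin (n + 1) → ℤ) :
    (filterExp P f).coeff e = if P e then f.coeff e else 0 :=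
  Finsupp.filter_apply _ _ _

theorem mem_support_filterExp {P : (Fin (n + 1) → ℤ) → Prop} {f : Laurent K n}
    {e : Fin (n + 1) → ℤ} (he : e ∈ (filterExp P f).coeff.support) :
    P e ∧ e ∈ f.coeff.support := by
  classical
  rw [Finsupp.mem_support_iff, coeff_filterExp] at he
  by_cases h : P e
  · rw [if_pos h] at he
    exact ⟨h, Finsupp.mem_support_iff.2 he⟩
  · simp [h] at he

/-- The index of the first nonnegative exponent is `k`. -/
def FirstNonneg (k : Fin (n + 1)) (e : Fin (n + 1) → ℤ) : Prop :=
  0 ≤ e k ∧ ∀ j < k, e j < 0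

theorem sum_filterExp_firstNonneg {f : Laurent K n} (hf : ∀ e ∈ f.coeff.support, ∃ k, 0 ≤ e k) :
    ∑ k, filterExp (FirstNonneg k) f = f := by
  classical
  apply AddMonoidAlgebra.coeff_injective
  ext e
  rw [AddMonoidAlgebra.coeff_sum, Finsupp.finsetSum_apply]
  simp only [coeff_filterExp]
  by_cases he : e ∈ f.coeff.support
  · obtain ⟨k, hk, hmin⟩ := WellFounded.has_min (wellFounded_lt (α := Fin (n + 1)))
      {k | 0 ≤ e k} (hf e he)
    have hk' : FirstNonneg k e := ⟨hk, fun j hj => by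
      by_contra h
      exact hmin j (not_lt.1 h) hj⟩
    rw [Finset.sum_eq_single k, if_pos hk']
    · intro j _ hjk
      refine if_neg fun hj => hjk ?_
      rcases lt_trichotomy j k with h | h | h
      · exact absurd (hk'.2 j h) (not_lt.2 hj.1)
      · exact h
      · exact absurd (hj.2 k h) (not_lt.2 hk)
    · simp
  · rw [Finsupp.notMem_support_iff.1 he]
    simp

/-- The cohomology of `𝒪(m)` vanishes in positive degrees other than `n`, and in degree `n` for
`m ≥ -n`. -/
theorem exists_coboundary_eq_of_top (h : -(n : ℤ) ≤ m ∨ p + 1 ≠ n)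
    {c : (Fin (p + 2) ↪o Fin (n + 1)) → Laurent K n} (hc : c ∈ cochains ⊤ m (p + 1))
    (hd : coboundary K n (p + 1) c = 0) : ∃ b ∈ cochains ⊤ m p, coboundary K n p b = c := by
  -- A monomial with only negative exponents occurs only on the intersection of all charts, hence in
  -- cohomological degree `n`, and has degree at most `-(n + 1)`; `h` excludes this.
  have hnn : ∀ s, ∀ e ∈ (c s).coeff.support, ∃ k, 0 ≤ e k := by
    intro s e he
    by_contra! hneg
    obtain ⟨hdeg, hloc⟩ := mem_cochains.1 hc s
    have huniv : Finset.univ.map s.toEmbedding = Finset.univ := by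
      rw [Finset.eq_univ_iff_forall]
      intro i
      by_contra hi
      exact absurd (mem_localized_top_iff.1 hloc e he i hi) (not_le.2 (hneg i))
    have hcard := card_map_orderEmb s
    rw [huniv, Finset.card_univ, Fintype.card_fin] at hcard
    have hsum : ∑ i, e i ≤ ∑ i : Fin (n + 1), (-1 : ℤ) :=
      Finset.sum_le_sum fun i _ => by have := hneg i; omega
    rw [hdeg e he] at hsum
    simp at hsum
    omega
  -- Monomials with nonnegative exponent at `k` remain regular when the chart `D₊(x_k)` is dropped,
  -- so the contraction with vertex `k` preserves cochains on that part of `c`.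
  refine ⟨∑ k, contraction k fun s => filterExp (FirstNonneg k) (c s), ?_, ?_⟩
  · refine Submodule.sum_mem _ fun k _ => mem_cochains.2 fun s => ?_
    rw [contraction]
    split_ifs with hk
    · exact zero_mem _
    refine Submodule.smul_mem _ _ ?_
    rw [extendCochain_map_linear]
    obtain ⟨hdeg, hloc⟩ := extendCochain_mem (mem_cochains.1 hc)
      (insert k (Finset.univ.map s.toEmbedding))
    refine ⟨fun e he => hdeg e (mem_support_filterExp he).2, mem_localized_top_iff.2 ?_⟩
    intro e he i hi
    obtain ⟨he1, he2⟩ := mem_support_filterExp he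
    by_cases hik : i = k
    · rw [hik]; exact he1.1
    · exact mem_localized_top_iff.1 hloc e he2 i (by simp [hik]; simpa using hi)
  · rw [map_sum]
    have h1 : ∀ k, coboundary K n p (contraction k fun s => filterExp (FirstNonneg k) (c s)) =
        fun s => filterExp (FirstNonneg k) (c s) := by
      intro k
      have h2 := coboundary_contraction_add k fun s => filterExp (FirstNonneg k) (c s)
      rw [coboundary_map, hd] at h2
      have h3 : (fun s => filterExp (FirstNonneg k)
          ((0 : (Fin (p + 1 + 2) ↪o Fin (n + 1)) → Laurent K n) s)) = 0 := by
        ext1 s; simp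
      rwa [h3, contraction_zero, add_zero] at h2
    simp_rw [h1]
    ext1 s
    rw [Finset.sum_apply]
    exact sum_filterExp_firstNonneg (hnn s)

/-- By pigeonhole, each monomial of degree `(n + 1) N` is divisible by some `x_k ^ N`. Applied to a
power of `L`, which is invertible on the subscheme, this serves as a partition of unity. -/
theorem exists_eq_sum_mul_pow (N : ℕ) {P : MvPolynomial (Fin (n + 1)) K}
    (hP : P.IsHomogeneous ((n + 1) * N)) : ∃ a : Fin (n + 1) → MvPolynomial (Fin (n + 1)) K,
      (∀ k, (a k).IsHomogeneous (n * N)) ∧ P = ∑ k, a k * X k ^ N := by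
  rw [P.as_sum]
  refine Finset.sum_induction _ (fun P => ∃ a : Fin (n + 1) → MvPolynomial (Fin (n + 1)) K,
    (∀ k, (a k).IsHomogeneous (n * N)) ∧ P = ∑ k, a k * X k ^ N) ?_ ?_ ?_
  · rintro _ _ ⟨a, ha, rfl⟩ ⟨b, hb, rfl⟩
    exact ⟨a + b, fun k => (ha k).add (hb k), by simp [add_mul, Finset.sum_add_distrib]⟩
  · exact ⟨0, fun k => isHomogeneous_zero _ _ _, by simp⟩
  · intro d hd
    have hdeg := hP (mem_support_iff.1 hd)
    rw [Finsupp.weight_apply, Finsupp.sum_fintype _ _ (by simp)] at hdeg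
    simp only [Pi.one_apply, smul_eq_mul, mul_one] at hdeg
    obtain ⟨k, hk⟩ : ∃ k, N ≤ d k := by
      by_contra! hlt
      have : ∑ i, d i < ∑ _i : Fin (n + 1), N :=
        Finset.sum_lt_sum_of_nonempty Finset.univ_nonempty fun i _ => hlt i
      simp at this
      omega
    have hle : Finsupp.single k N ≤ d := by
      rw [Finsupp.single_le_iff]; exact hk
    refine ⟨Pi.single k (monomial (d - Finsupp.single k N) (coeff d P)), fun j => ?_, ?_⟩
    · by_cases hj : j = k
      · subst hj
        rw [Pi.single_eq_same]
        refine isHomogeneous_monomial _ ?_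
        have h1 : (d - Finsupp.single j N).degree + N = (n + 1) * N := by
          have h2 := congrArg Finsupp.degree (tsub_add_cancel_of_le hle)
          rwa [map_add, Finsupp.degree_single, Finsupp.degree_eq_sum d, hdeg] at h2
        rw [add_mul, one_mul] at h1
        omega
      · rw [Pi.single_eq_of_ne hj]
        exact isHomogeneous_zero _ _ _
    · rw [Finset.sum_eq_single k]
      · rw [Pi.single_eq_same, X_pow_eq_monomial, monomial_mul, mul_one, tsub_add_cancel_of_le hle]
      · intro j _ hj
        rw [Pi.single_eq_of_ne hj, zero_mul]
      · simp

/-- The linear form `L` has no zeros on the subscheme defined by `I`: on every chart it is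
invertible modulo `I`, with inverse `θ i`. -/
structure IsNowhereZero (I : Ideal (MvPolynomial (Fin (n + 1)) K))
    (L : MvPolynomial (Fin (n + 1)) K) (θ : Fin (n + 1) → Laurent K n) : Prop where
  isHomogeneous : L.IsHomogeneous 1
  mem_degree : ∀ i, θ i ∈ laurentDegree K n (-1)
  mem_localized : ∀ i, θ i ∈ localized ⊤ {i}
  mul_sub_one_mem : ∀ i, toLaurent K n L * θ i - 1 ∈ localized I {i}

namespace IsNowhereZero

variable {L : MvPolynomial (Fin (n + 1)) K} {θ : Fin (n + 1) → Laurent K n}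

theorem pow_mul_pow_sub_one_mem (h : IsNowhereZero I L θ) (i : Fin (n + 1)) (M : ℕ) :
    toLaurent K n L ^ M * θ i ^ M - 1 ∈ localized I {i} := by
  induction M with
  | zero => simp
  | succ M ih =>
    have e : toLaurent K n L ^ (M + 1) * θ i ^ (M + 1) - 1 =
        (toLaurent K n L * θ i) * (toLaurent K n L ^ M * θ i ^ M - 1) +
          (toLaurent K n L * θ i - 1) := by ring
    rw [e]
    exact add_mem (mul_mem_localized
      (mul_mem_localized (toLaurent_mem_localized_top _) (h.mem_localized i)) ih)
      (h.mul_sub_one_mem i)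

theorem pow_mul_pow_mul_sub_mem (h : IsNowhereZero I L θ) {i : Fin (n + 1)} (M : ℕ)
    {S : Finset (Fin (n + 1))} (hi : i ∈ S) {f : Laurent K n} (hf : f ∈ localized ⊤ S) :
    toLaurent K n L ^ M * (θ i ^ M * f) - f ∈ localized I S := by
  have e : toLaurent K n L ^ M * (θ i ^ M * f) - f =
      (toLaurent K n L ^ M * θ i ^ M - 1) * f := by ring
  rw [e]
  exact mul_mem_localized' (localized_mono (Finset.singleton_subset_iff.2 hi)
    (h.pow_mul_pow_sub_one_mem i M)) hf

theorem mem_of_pow_mul_mem (h : IsNowhereZero I L θ) {i : Fin (n + 1)} (M : ℕ)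
    {S : Finset (Fin (n + 1))} (hi : i ∈ S) {f : Laurent K n} (hf : f ∈ localized ⊤ S)
    (hLf : toLaurent K n L ^ M * f ∈ localized I S) : f ∈ localized I S := by
  have h1 := h.pow_mul_pow_mul_sub_mem M hi hf
  have h2 : θ i ^ M * (toLaurent K n L ^ M * f) ∈ localized I S :=
    mul_mem_localized (pow_mem_localized_top
      (localized_mono (Finset.singleton_subset_iff.2 hi) (h.mem_localized i)) M) hLf
  have e : f = θ i ^ M * (toLaurent K n L ^ M * f) -
      (toLaurent K n L ^ M * (θ i ^ M * f) - f) := by ring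
  rw [e]
  exact sub_mem h2 h1

/-- The cohomology of `𝒪_Z(m)` vanishes in positive degrees. -/
theorem exists_sub_coboundary_mem (h : IsNowhereZero I L θ)
    {b : (Fin (p + 2) ↪o Fin (n + 1)) → Laurent K n} (hb : b ∈ cochains ⊤ m (p + 1))
    (hd : coboundary K n (p + 1) b ∈ cochains I m (p + 2)) :
    ∃ a ∈ cochains ⊤ m p, b - coboundary K n p a ∈ cochains I m (p + 1) := by
  -- A single exponent `N` clears the denominators in `x_k` for all `k` and all index sets, both for
  -- `b` and for its coboundary.
  have hex : ∀ q : Finset (Fin (n + 1)) × Fin (n + 1), ∃ N₀ : ℕ, ∀ N ≥ N₀,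
      Laurent.x K q.2 ^ N * extendCochain b (insert q.2 q.1) ∈ localized ⊤ q.1 ∧
      Laurent.x K q.2 ^ N * extendCochain (coboundary K n (p + 1) b) (insert q.2 q.1) ∈
        localized I q.1 := by
    intro q
    obtain ⟨N₁, h1⟩ := exists_pow_mul_mem_localized
      (extendCochain_mem (mem_cochains.1 hb) (insert q.2 q.1)).2
    obtain ⟨N₂, h2⟩ := exists_pow_mul_mem_localized
      (extendCochain_mem (mem_cochains.1 hd) (insert q.2 q.1)).2
    exact ⟨max N₁ N₂, fun N hN => ⟨h1 N (by omega), h2 N (by omega)⟩⟩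
  choose N₀ hN₀ using hex
  set N := Finset.univ.sup N₀
  have hN : ∀ S k, Laurent.x K k ^ N * extendCochain b (insert k S) ∈ localized ⊤ S ∧
      Laurent.x K k ^ N * extendCochain (coboundary K n (p + 1) b) (insert k S) ∈
        localized I S := fun S k => hN₀ (S, k) N (Finset.le_sup (f := N₀) (Finset.mem_univ (S, k)))
  set M := (n + 1) * N with hM
  obtain ⟨a, ha, hLa⟩ := exists_eq_sum_mul_pow N (P := L ^ M)
    (by simpa using h.isHomogeneous.pow M)
  have hLM : toLaurent K n L ^ M = ∑ k, toLaurent K n (a k) * Laurent.x K k ^ N := by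
    rw [← map_pow, hLa, map_sum]
    exact Finset.sum_congr rfl fun k _ => by rw [map_mul, map_pow, toLaurent_X]
  let A : Fin (n + 1) → Laurent K n := fun k => toLaurent K n (a k) * Laurent.x K k ^ N
  have hAdeg : ∀ k, A k ∈ laurentDegree K n M := by
    intro k
    have h1 := mul_mem_laurentDegree (toLaurent_mem_laurentDegree (ha k))
      (pow_mem_laurentDegree (x_mem_laurentDegree (K := K) k) N)
    have e : ((n * N : ℕ) : ℤ) + (N : ℤ) * 1 = (M : ℤ) := by rw [hM]; push_cast; ring
    rwa [e] at h1
  -- As `∑ A k = L ^ M`, the homotopy formula makes the coboundary of `a₁` equal to `L ^ M b` modulo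
  -- `I`. Multiplication by `θ ^ M` then divides by `L ^ M`; the chart used does not matter modulo
  -- `I`.
  let a₁ : (Fin (p + 1) ↪o Fin (n + 1)) → Laurent K n := fun s => ∑ k, A k * contraction k b s
  let a₀ : (Fin (p + 1) ↪o Fin (n + 1)) → Laurent K n := fun s => θ (s 0) ^ M * a₁ s
  have hs0 : ∀ {r : ℕ} (s : Fin (r + 1) ↪o Fin (n + 1)), s 0 ∈ Finset.univ.map s.toEmbedding :=
    fun s => Finset.mem_map.2 ⟨0, Finset.mem_univ _, rfl⟩
  have ha₁loc : ∀ s, a₁ s ∈ localized ⊤ (Finset.univ.map s.toEmbedding) := by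
    intro s
    refine Submodule.sum_mem _ fun k _ => ?_
    rw [contraction]
    split_ifs
    · rw [mul_zero]; exact zero_mem _
    rw [mul_smul_comm, mul_assoc]
    exact Submodule.smul_mem _ _ (mul_mem_localized (toLaurent_mem_localized_top _) (hN _ k).1)
  have ha₁deg : ∀ s, a₁ s ∈ laurentDegree K n (M + m) := by
    intro s
    refine Submodule.sum_mem _ fun k _ => mul_mem_laurentDegree (hAdeg k) ?_
    rw [contraction]
    split_ifs
    · exact zero_mem _
    · exact Submodule.smul_mem _ _ (extendCochain_mem (mem_cochains.1 hb) _).1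
  have ha₀ : a₀ ∈ cochains ⊤ m p := by
    refine mem_cochains.2 fun s => ⟨?_, ?_⟩
    · have := mul_mem_laurentDegree (pow_mem_laurentDegree (h.mem_degree (s 0)) M) (ha₁deg s)
      have e : (M : ℤ) * -1 + (M + m) = m := by ring
      rwa [e] at this
    · exact mul_mem_localized (pow_mem_localized_top (localized_mono
        (Finset.singleton_subset_iff.2 (hs0 s)) (h.mem_localized _)) M) (ha₁loc s)
  refine ⟨a₀, ha₀, mem_cochains.2 fun s => ?_⟩
  have htop : b - coboundary K n p a₀ ∈ cochains ⊤ m (p + 1) :=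
    sub_mem hb (coboundary_mem_cochains ha₀)
  obtain ⟨h1, h2⟩ := mem_cochains.1 htop s
  refine ⟨h1, h.mem_of_pow_mul_mem M (hs0 s) h2 ?_⟩
  have hda₁ : coboundary K n p a₁ = fun s => ∑ k, A k * coboundary K n p (contraction k b) s := by
    have e : a₁ = ∑ k, fun s => LinearMap.mulLeft K (A k) (contraction k b s) := by
      ext1 s; simp [a₁]
    rw [e, map_sum]
    ext1 s
    rw [Finset.sum_apply]
    refine Finset.sum_congr rfl fun k _ => ?_
    rw [coboundary_map]
    rfl
  have hdiff : coboundary K n p (fun s => LinearMap.mulLeft K (toLaurent K n L ^ M) (a₀ s)) s -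
      coboundary K n p a₁ s ∈ localized I (Finset.univ.map s.toEmbedding) := by
    rw [← Pi.sub_apply, ← map_sub]
    exact coboundary_mem localized_mono_set (fun t =>
      h.pow_mul_pow_mul_sub_mem M (hs0 t) (ha₁loc t)) s
  have hrest : toLaurent K n L ^ M * b s - coboundary K n p a₁ s ∈
      localized I (Finset.univ.map s.toEmbedding) := by
    rw [hda₁, hLM, Finset.sum_mul, ← Finset.sum_sub_distrib]
    refine Submodule.sum_mem _ fun k _ => ?_
    have e := congrFun (coboundary_contraction_add k b) s
    rw [Pi.add_apply] at e
    rw [← mul_sub, ← e, add_sub_cancel_left, contraction]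
    split_ifs
    · rw [mul_zero]; exact zero_mem _
    rw [mul_smul_comm, mul_assoc]
    exact Submodule.smul_mem _ _ (mul_mem_localized (toLaurent_mem_localized_top _) (hN _ k).2)
  have e : toLaurent K n L ^ M * (b - coboundary K n p a₀) s =
      (toLaurent K n L ^ M * b s - coboundary K n p a₁ s) -
      (coboundary K n p (fun s => LinearMap.mulLeft K (toLaurent K n L ^ M) (a₀ s)) s -
        coboundary K n p a₁ s) := by
    rw [coboundary_map, Pi.sub_apply, mul_sub]
    simp only [LinearMap.mulLeft_apply]
    ring
  rw [e]
  exact sub_mem hrest hdiff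

/-- The cohomology of `ℐ(m)` vanishes in degrees at least two, for `m ≥ -n`. -/
theorem subsingleton_cohomology (h : IsNowhereZero I L θ) (hm : -(n : ℤ) ≤ m ∨ p + 2 ≠ n) :
    Subsingleton (cohomology I m (p + 2)) := by
  rw [Submodule.Quotient.subsingleton_iff, Submodule.submoduleOf,
    Submodule.comap_subtype_eq_top]
  rintro c ⟨hc, hdc⟩
  obtain ⟨b, hb, rfl⟩ := exists_coboundary_eq_of_top hm (cochains_le_top hc) hdc
  obtain ⟨a, ha, hba⟩ := h.exists_sub_coboundary_mem hb hc
  exact ⟨_, hba, by rw [map_sub, coboundary_coboundary, sub_zero]⟩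

end IsNowhereZero

end Cech

end ProjSub

namespace ProjSub

open MvPolynomial Module

/-! ### Zero-cochains and lifting of sections -/

section ZeroCochains

variable {K : Type*} [Field K] {n : ℕ} {I : Ideal (MvPolynomial (Fin (n + 1)) K)} {m : ℤ}

/-- The `0`-cochain with given values on the charts. -/
def zeroCochain (β : Fin (n + 1) → Laurent K n) : (Fin (0 + 1) ↪o Fin (n + 1)) → Laurent K n :=
  fun s => β (s 0)

theorem map_orderEmb_one (s : Fin (0 + 1) ↪o Fin (n + 1)) :
    Finset.univ.map s.toEmbedding = {s 0} := by
  ext x; simp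

theorem exists_orderEmb_one (i : Fin (n + 1)) : ∃ s : Fin (0 + 1) ↪o Fin (n + 1), s 0 = i := by
  obtain ⟨s, hs⟩ := exists_map_eq (S := ({i} : Finset (Fin (n + 1)))) (p := 0 + 1) (by simp)
  rw [map_orderEmb_one] at hs
  exact ⟨s, Finset.singleton_injective hs⟩

theorem exists_zeroCochain_eq (b : (Fin (0 + 1) ↪o Fin (n + 1)) → Laurent K n) :
    ∃ β, b = zeroCochain β := by
  choose s hs using exists_orderEmb_one (n := n)
  refine ⟨fun i => b (s i), funext fun t => ?_⟩
  change b t = b (s (t 0))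
  congr 1
  refine DFunLike.ext _ _ fun j => ?_
  have hj : j = 0 := Subsingleton.elim (α := Fin 1) j 0
  rw [hj, hs]

theorem zeroCochain_mem_cochains {β : Fin (n + 1) → Laurent K n} :
    zeroCochain β ∈ cochains I m 0 ↔ ∀ i, β i ∈ sections I m {i} := by
  rw [mem_cochains]
  constructor
  · intro h i
    obtain ⟨s, rfl⟩ := exists_orderEmb_one i
    have := h s
    rwa [map_orderEmb_one] at this
  · intro h s
    rw [map_orderEmb_one]
    exact h _

theorem coboundary_zeroCochain (β : Fin (n + 1) → Laurent K n) (s : Fin (0 + 2) ↪o Fin (n + 1)) :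
    coboundary K n 0 (zeroCochain β) s = β (s 1) - β (s 0) := by
  simp [coboundary, Fin.sum_univ_two, zeroCochain, sub_eq_add_neg]

theorem map_orderEmb_two (s : Fin (0 + 2) ↪o Fin (n + 1)) :
    Finset.univ.map s.toEmbedding = {s 0, s 1} := by
  ext x; simp [Fin.exists_fin_two, eq_comm]

theorem exists_orderEmb_two {i j : Fin (n + 1)} (h : i < j) :
    ∃ s : Fin (0 + 2) ↪o Fin (n + 1), s 0 = i ∧ s 1 = j := by
  refine ⟨OrderEmbedding.ofStrictMono ![i, j] ?_, rfl, rfl⟩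
  rw [Fin.strictMono_iff_lt_succ]
  intro k
  rw [Subsingleton.elim k 0]
  exact h

theorem zeroCochain_mem_quotientCocycles {β : Fin (n + 1) → Laurent K n} :
    zeroCochain β ∈ quotientCocycles I m ↔
      (∀ i, β i ∈ sections ⊤ m {i}) ∧ ∀ i j, β j - β i ∈ localized I {i, j} := by
  rw [quotientCocycles, Submodule.mem_inf, zeroCochain_mem_cochains, Submodule.mem_comap,
    mem_cochains]
  refine and_congr_right fun hβ => ⟨fun h i j => ?_, fun h s => ?_⟩
  · rcases lt_trichotomy i j with hij | rfl | hij
    · obtain ⟨s, rfl, rfl⟩ := exists_orderEmb_two hij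
      have := (h s).2
      rwa [coboundary_zeroCochain, map_orderEmb_two] at this
    · rw [sub_self]; exact zero_mem _
    · obtain ⟨s, rfl, rfl⟩ := exists_orderEmb_two hij
      have h1 : coboundary K n 0 (zeroCochain β) s ∈ localized I (Finset.univ.map s.toEmbedding) :=
        (h s).2
      rw [coboundary_zeroCochain, map_orderEmb_two] at h1
      rw [← neg_sub, Finset.pair_comm]
      exact neg_mem h1
  · rw [coboundary_zeroCochain, map_orderEmb_two]
    exact ⟨(laurentDegree K n m).sub_mem (hβ _).1 (hβ _).1, h _ _⟩

/-- Vanishing of `H¹(ℐ(m))` means that the sections of `𝒪_Z(m)` lift to sections of `𝒪(m)`. -/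
theorem subsingleton_cohomology_one_iff (hn : 2 ≤ n) :
    Subsingleton (cohomology I m 1) ↔ ∀ β : Fin (n + 1) → Laurent K n,
      (∀ i, β i ∈ sections ⊤ m {i}) → (∀ i j, β j - β i ∈ localized I {i, j}) →
      ∃ f : Laurent K n, (∀ i, f ∈ sections ⊤ m {i}) ∧ ∀ i, β i - f ∈ localized I {i} := by
  rw [Submodule.Quotient.subsingleton_iff, Submodule.submoduleOf, Submodule.comap_subtype_eq_top]
  constructor
  · intro h β hβ hβ'
    have hmem := zeroCochain_mem_quotientCocycles.2 ⟨hβ, hβ'⟩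
    obtain ⟨b, hb, e⟩ := h ⟨hmem.2, coboundary_coboundary (zeroCochain β)⟩
    obtain ⟨γ, rfl⟩ := exists_zeroCochain_eq b
    rw [SetLike.mem_coe, zeroCochain_mem_cochains] at hb
    have hconst : ∀ i, β i - γ i = β 0 - γ 0 := by
      intro i
      rcases eq_or_ne i 0 with rfl | hi
      · rfl
      obtain ⟨s, h0, h1⟩ := exists_orderEmb_two (Fin.pos_of_ne_zero hi)
      have := congrFun e s
      change coboundary K n 0 (zeroCochain γ) s = coboundary K n 0 (zeroCochain β) s at this
      rw [coboundary_zeroCochain, coboundary_zeroCochain, h0, h1] at this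
      linear_combination -this
    refine ⟨β 0 - γ 0, fun i => ?_, fun i => ?_⟩
    · rw [← hconst i]
      exact sub_mem (hβ i) ⟨(hb i).1, localized_mono_ideal le_top (hb i).2⟩
    · rw [← hconst i, sub_sub_cancel]
      exact (hb i).2
  · rintro h c ⟨hc, hdc⟩
    obtain ⟨b, hb, rfl⟩ := exists_coboundary_eq_of_top (p := 0) (Or.inr (by omega))
      (cochains_le_top hc) hdc
    obtain ⟨β, rfl⟩ := exists_zeroCochain_eq b
    obtain ⟨hβ, hβ'⟩ := zeroCochain_mem_quotientCocycles.1
      (⟨hb, hc⟩ : zeroCochain β ∈ quotientCocycles I m)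
    obtain ⟨f, hf, hβf⟩ := h β hβ hβ'
    refine ⟨zeroCochain fun i => β i - f, zeroCochain_mem_cochains.2 fun i =>
      ⟨(laurentDegree K n m).sub_mem (hβ i).1 (hf i).1, hβf i⟩, ?_⟩
    ext1 s
    rw [coboundary_zeroCochain, coboundary_zeroCochain, sub_sub_sub_cancel_right]

end ZeroCochains

/-! ### Dehomogenization with respect to a linear form -/

section Dehomogenization

variable {K : Type*} [Field K] {n : ℕ} {I : Ideal (MvPolynomial (Fin (n + 1)) K)}
  {L : MvPolynomial (Fin (n + 1)) K} {i : Fin (n + 1)} {τ : Laurent K n}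

/-- Evaluation of polynomials at the functions `xⱼ τ`, for a section `τ` of `𝒪(-1)` on a chart. -/
def evalChart (τ : Laurent K n) : MvPolynomial (Fin (n + 1)) K →ₐ[K] Laurent K n :=
  aeval fun j => Laurent.x K j * τ

theorem evalChart_of_homogeneous {m : ℕ} {f : MvPolynomial (Fin (n + 1)) K}
    (hf : f.IsHomogeneous m) : evalChart τ f = τ ^ m * toLaurent K n f := by
  have h1 : ∀ P ∈ homogeneousSubmodule (Fin (n + 1)) K 1,
      1 * evalChart τ P = τ * AlgHom.id K _ (toLaurent K n P) := by
    intro P hP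
    rw [one_mul]
    refine homogeneous_one_induction (f := (evalChart τ).toLinearMap)
      (g := LinearMap.mulLeft K τ ∘ₗ (toLaurent K n).toLinearMap) (fun j => ?_) hP
    simp [evalChart, toLaurent_X, mul_comm]
  have := pow_mul_eq_of_homogeneous _ _ _ h1 hf
  simpa using this

theorem evalChart_mem_laurentDegree (hτ : τ ∈ laurentDegree K n (-1))
    (f : MvPolynomial (Fin (n + 1)) K) : evalChart τ f ∈ laurentDegree K n 0 := by
  induction f using MvPolynomial.induction_on with
  | C a =>
    rw [evalChart, aeval_C, Algebra.algebraMap_eq_smul_one]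
    exact Submodule.smul_mem _ _ one_mem_laurentDegree
  | add p q hp hq => rw [map_add]; exact add_mem hp hq
  | mul_X p j hp =>
    have h1 := mul_mem_laurentDegree (x_mem_laurentDegree (K := K) j) hτ
    have := mul_mem_laurentDegree hp h1
    rw [map_mul]
    simpa [evalChart] using this

theorem evalChart_mem_localized (hτ : τ ∈ localized ⊤ {i}) (f : MvPolynomial (Fin (n + 1)) K) :
    evalChart τ f ∈ localized ⊤ {i} := by
  induction f using MvPolynomial.induction_on with
  | C a =>
    rw [evalChart, aeval_C, Algebra.algebraMap_eq_smul_one]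
    exact Submodule.smul_mem _ _ one_mem_localized_top
  | add p q hp hq => rw [map_add]; exact add_mem hp hq
  | mul_X p j hp =>
    rw [map_mul]
    refine mul_mem_localized hp ?_
    rw [evalChart, aeval_X, ← toLaurent_X]
    exact mul_mem_localized (toLaurent_mem_localized_top _) hτ

theorem evalChart_mem_of_mem (hI : IsHomogeneousIdeal I) (hτ : τ ∈ localized ⊤ {i})
    {f : MvPolynomial (Fin (n + 1)) K} (hf : f ∈ I) : evalChart τ f ∈ localized I {i} := by
  rw [← sum_homogeneousComponent f, map_sum]
  refine Submodule.sum_mem _ fun m _ => ?_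
  rw [evalChart_of_homogeneous (homogeneousComponent_isHomogeneous m f)]
  exact mul_mem_localized (pow_mem_localized_top hτ m) (toLaurent_mem_localized (hI f hf m))

theorem evalChart_mem_of_mem_sup (hI : IsHomogeneousIdeal I) (hτ : τ ∈ localized ⊤ {i})
    (hL : L.IsHomogeneous 1) (hLτ : toLaurent K n L * τ - 1 ∈ localized I {i})
    {f : MvPolynomial (Fin (n + 1)) K} (hf : f ∈ I ⊔ Ideal.span {L - 1}) :
    evalChart τ f ∈ localized I {i} := by
  obtain ⟨a, ha, b, hb, rfl⟩ := Submodule.mem_sup.1 hf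
  obtain ⟨c, rfl⟩ := Ideal.mem_span_singleton'.1 hb
  rw [map_add, map_mul, map_sub, map_one, evalChart_of_homogeneous hL, pow_one, mul_comm τ]
  exact add_mem (evalChart_mem_of_mem hI hτ ha)
    (mul_mem_localized (evalChart_mem_localized hτ c) hLτ)

theorem one_sub_pow_mem_span (L : MvPolynomial (Fin (n + 1)) K) (M : ℕ) :
    1 - L ^ M ∈ Ideal.span {L - 1} := by
  rw [Ideal.mem_span_singleton, ← dvd_neg, neg_sub]
  exact sub_one_dvd_pow_sub_one L M

/-- Modulo `L - 1`, powers of `L` can be inserted to bring all components to the same degree. -/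
theorem exists_homogeneous_sub_mem_span (hL : L.IsHomogeneous 1)
    (f : MvPolynomial (Fin (n + 1)) K) :
    ∃ (M : ℕ) (F : MvPolynomial (Fin (n + 1)) K), F.IsHomogeneous M ∧
      f - F ∈ Ideal.span {L - 1} := by
  refine ⟨f.totalDegree, ∑ m ∈ Finset.range (f.totalDegree + 1),
    homogeneousComponent m f * L ^ (f.totalDegree - m), ?_, ?_⟩
  · refine IsHomogeneous.sum _ _ _ fun m hm => ?_
    have h1 := (homogeneousComponent_isHomogeneous m f).mul (hL.pow (f.totalDegree - m))
    have h2 : m ≤ f.totalDegree := by simpa [Nat.lt_succ_iff] using hm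
    rwa [one_mul, Nat.add_sub_cancel' h2] at h1
  · nth_rw 1 [← sum_homogeneousComponent f]
    rw [← Finset.sum_sub_distrib]
    refine Ideal.sum_mem _ fun m _ => ?_
    have e : homogeneousComponent m f - homogeneousComponent m f * L ^ (f.totalDegree - m) =
        homogeneousComponent m f * (1 - L ^ (f.totalDegree - m)) := by ring
    rw [e]
    exact Ideal.mul_mem_left _ _ (one_sub_pow_mem_span L _)

theorem toLaurent_mem_of_evalChart_mem {m : ℕ} (hLτ : toLaurent K n L * τ - 1 ∈ localized I {i})
    (hτ : τ ∈ localized ⊤ {i})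
    {F : MvPolynomial (Fin (n + 1)) K} (hF : F.IsHomogeneous m)
    (h : evalChart τ F ∈ localized I {i}) : toLaurent K n F ∈ localized I {i} := by
  rw [evalChart_of_homogeneous hF] at h
  have h1 : ∀ k : ℕ, (toLaurent K n L * τ) ^ k - 1 ∈ localized I {i} := by
    intro k
    induction k with
    | zero => simp
    | succ k ih =>
      have e : (toLaurent K n L * τ) ^ (k + 1) - 1 = (toLaurent K n L * τ) *
        ((toLaurent K n L * τ) ^ k - 1) + (toLaurent K n L * τ - 1) := by ring
      rw [e]
      exact add_mem (mul_mem_localized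
        (mul_mem_localized (toLaurent_mem_localized_top _) hτ) ih) hLτ
  have e : toLaurent K n F = toLaurent K n (L ^ m) * (τ ^ m * toLaurent K n F) -
      ((toLaurent K n L * τ) ^ m - 1) * toLaurent K n F := by
    rw [map_pow]; ring
  rw [e]
  exact sub_mem (mul_mem_localized (toLaurent_mem_localized_top _) h)
    (mul_mem_localized' (h1 m) (toLaurent_mem_localized_top _))

end Dehomogenization

/-! ### A hyperplane missing a finite subscheme -/

section Existence

variable {K : Type*} [Field K] {n : ℕ} {I : Ideal (MvPolynomial (Fin (n + 1)) K)}

theorem x_mul_xInv_sub_one_mem (i : Fin (n + 1)) :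
    toLaurent K n (X i) * Laurent.xInv K i - 1 ∈ localized I {i} := by
  rw [toLaurent_X, x_mul_xInv, sub_self]
  exact zero_mem _

/-- Evaluation at `x_j / x_i` embeds this quotient in the coordinate ring of the chart. -/
theorem finiteDimensional_chart (hI : IsHomogeneousIdeal I) (i : Fin (n + 1))
    (hfin : FiniteDimensional K (sections (⊤ : Ideal (MvPolynomial (Fin (n + 1)) K)) 0 {i} ⧸
      (sections I 0 {i}).submoduleOf (sections ⊤ 0 {i}))) :
    FiniteDimensional K (MvPolynomial (Fin (n + 1)) K ⧸ (I ⊔ Ideal.span {X i - 1})) := by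
  have hinv : Laurent.xInv K i ∈ localized ⊤ {i} := xInv_mem_localized (by simp)
  let E : MvPolynomial (Fin (n + 1)) K →ₗ[K]
      sections (⊤ : Ideal (MvPolynomial (Fin (n + 1)) K)) 0 {i} :=
    (evalChart (Laurent.xInv K i)).toLinearMap.codRestrict _ fun f =>
      ⟨evalChart_mem_laurentDegree (xInv_mem_laurentDegree i) f, evalChart_mem_localized hinv f⟩
  let Q := (sections I 0 {i}).submoduleOf (sections ⊤ 0 {i})
  have hker : LinearMap.ker (Q.mkQ ∘ₗ E) = (I ⊔ Ideal.span {X i - 1}).restrictScalars K := by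
    ext f
    rw [LinearMap.mem_ker, LinearMap.comp_apply, Submodule.mkQ_apply, Submodule.Quotient.mk_eq_zero]
    change evalChart (Laurent.xInv K i) f ∈ sections I 0 {i} ↔ f ∈ I ⊔ Ideal.span {X i - 1}
    constructor
    · rintro ⟨-, hf⟩
      obtain ⟨M, F, hF, hfF⟩ := exists_homogeneous_sub_mem_span (isHomogeneous_X K i) f
      have h1 : evalChart (Laurent.xInv K i) F ∈ localized I {i} := by
        have := evalChart_mem_of_mem_sup hI hinv (isHomogeneous_X K i)
          (x_mul_xInv_sub_one_mem i) (Ideal.mem_sup_right hfF)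
        rw [map_sub] at this
        have h2 := sub_mem hf this
        rwa [sub_sub_cancel] at h2
      obtain ⟨N, hN⟩ := mem_localized_singleton_iff.1
        (toLaurent_mem_of_evalChart_mem (x_mul_xInv_sub_one_mem i) hinv hF h1)
      have e : f = (f - F) + (X i ^ N * F + F * (1 - X i ^ N)) := by ring
      rw [e]
      exact add_mem (Ideal.mem_sup_right hfF) (add_mem (Ideal.mem_sup_left hN)
        (Ideal.mem_sup_right (Ideal.mul_mem_left _ _ (one_sub_pow_mem_span _ N))))
    · intro hf
      exact ⟨evalChart_mem_laurentDegree (xInv_mem_laurentDegree i) f,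
        evalChart_mem_of_mem_sup hI hinv (isHomogeneous_X K i) (x_mul_xInv_sub_one_mem i) hf⟩
  have h1 : FiniteDimensional K (MvPolynomial (Fin (n + 1)) K ⧸ LinearMap.ker (Q.mkQ ∘ₗ E)) :=
    (LinearMap.quotKerEquivRange (Q.mkQ ∘ₗ E)).symm.finiteDimensional
  rw [hker] at h1
  exact (Submodule.Quotient.restrictScalarsEquiv K (I ⊔ Ideal.span {X i - 1})).finiteDimensional

/-- A finite subscheme is disjoint from some hyperplane. -/
theorem exists_isNowhereZero [Infinite K] (hI : IsHomogeneousIdeal I)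
    (hfin : ∀ i : Fin (n + 1),
      FiniteDimensional K (MvPolynomial (Fin (n + 1)) K ⧸ (I ⊔ Ideal.span {X i - 1}))) :
    ∃ L θ, IsNowhereZero I L θ := by
  have hart : ∀ i : Fin (n + 1),
      IsArtinianRing (MvPolynomial (Fin (n + 1)) K ⧸ (I ⊔ Ideal.span {X i - 1})) :=
    fun i => IsArtinianRing.of_finite K _
  let ι := Σ i : Fin (n + 1),
    MaximalSpectrum (MvPolynomial (Fin (n + 1)) K ⧸ (I ⊔ Ideal.span {X i - 1}))
  let H : ι → Submodule K (homogeneousSubmodule (Fin (n + 1)) K 1) := fun q =>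
    (q.2.asIdeal.restrictScalars K).comap
      ((Ideal.Quotient.mkₐ K (I ⊔ Ideal.span {X q.1 - 1})).toLinearMap ∘ₗ Submodule.subtype _)
  have hH : ∀ q, H q ≠ ⊤ := by
    intro q hq
    have h1 : (⟨X q.1, isHomogeneous_X K q.1⟩ : homogeneousSubmodule (Fin (n + 1)) K 1) ∈ H q := by
      rw [hq]; trivial
    have h2 : Ideal.Quotient.mk (I ⊔ Ideal.span {X q.1 - 1}) (X q.1) ∈ q.2.asIdeal := h1
    have h3 : Ideal.Quotient.mk (I ⊔ Ideal.span {X q.1 - 1}) (X q.1) = 1 := by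
      rw [← map_one (Ideal.Quotient.mk _), Ideal.Quotient.eq]
      exact Ideal.mem_sup_right (Ideal.mem_span_singleton_self _)
    rw [h3] at h2
    exact q.2.isMaximal.ne_top ((Ideal.eq_top_iff_one _).2 h2)
  -- There are finitely many points, since the chart rings are Artinian. The linear forms vanishing
  -- at one of them form a proper subspace, and finitely many of these do not cover the space over
  -- an infinite field.
  obtain ⟨L, hL⟩ : ∃ L, ∀ q, L ∉ H q := by
    by_contra! hcon
    obtain ⟨q, hq⟩ := Subspace.exists_eq_top_of_iUnion_eq_univ (p := H)
      (Set.eq_univ_of_forall fun L => Set.mem_iUnion.2 (hcon L))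
    exact hH q hq
  have hu : ∀ i, ∃ u : MvPolynomial (Fin (n + 1)) K,
      u * (L : MvPolynomial (Fin (n + 1)) K) - 1 ∈ I ⊔ Ideal.span {X i - 1} := by
    intro i
    have hunit : IsUnit (Ideal.Quotient.mk (I ⊔ Ideal.span {X i - 1})
        (L : MvPolynomial (Fin (n + 1)) K)) := by
      by_contra hnu
      obtain ⟨M, hM, hLM⟩ := exists_max_ideal_of_mem_nonunits hnu
      exact hL ⟨i, ⟨M, hM⟩⟩ hLM
    obtain ⟨v, hv⟩ := hunit.exists_left_inv
    obtain ⟨u, rfl⟩ := Ideal.Quotient.mk_surjective v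
    refine ⟨u, ?_⟩
    rw [← Ideal.Quotient.eq, map_mul, hv, map_one]
  choose u hu using hu
  have hinv : ∀ i : Fin (n + 1), Laurent.xInv K i ∈ localized ⊤ {i} :=
    fun i => xInv_mem_localized (by simp)
  refine ⟨L, fun i => evalChart (Laurent.xInv K i) (u i) * Laurent.xInv K i,
    L.2, fun i => ?_, fun i => ?_, fun i => ?_⟩
  · have := mul_mem_laurentDegree
      (evalChart_mem_laurentDegree (xInv_mem_laurentDegree i) (u i)) (xInv_mem_laurentDegree i)
    rwa [zero_add] at this
  · exact mul_mem_localized (evalChart_mem_localized (hinv i) _) (hinv i)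
  · have := evalChart_mem_of_mem_sup hI (hinv i) (isHomogeneous_X K i)
      (x_mul_xInv_sub_one_mem i) (hu i)
    rw [map_sub, map_mul, map_one, evalChart_of_homogeneous L.2, pow_one] at this
    convert this using 1
    ring

end Existence

/-! ### Global functions and the first cohomology -/

namespace IsNowhereZero

variable {K : Type*} [Field K] {n : ℕ} {I : Ideal (MvPolynomial (Fin (n + 1)) K)}
  {L : MvPolynomial (Fin (n + 1)) K} {θ : Fin (n + 1) → Laurent K n}

theorem mono (h : IsNowhereZero I L θ) {J : Ideal (MvPolynomial (Fin (n + 1)) K)} (hIJ : I ≤ J) :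
    IsNowhereZero J L θ :=
  ⟨h.isHomogeneous, h.mem_degree, h.mem_localized,
    fun i => localized_mono_ideal hIJ (h.mul_sub_one_mem i)⟩

theorem localized_pair (h : IsNowhereZero I L θ) (i j : Fin (n + 1)) :
    θ i ∈ localized ⊤ {i, j} ∧ θ j ∈ localized ⊤ {i, j} ∧ θ j - θ i ∈ localized I {i, j} := by
  have hi := localized_mono (show {i} ⊆ ({i, j} : Finset (Fin (n + 1))) by simp) (h.mem_localized i)
  have hj := localized_mono (show {j} ⊆ ({i, j} : Finset (Fin (n + 1))) by simp) (h.mem_localized j)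
  have hi' := localized_mono (show {i} ⊆ ({i, j} : Finset (Fin (n + 1))) by simp)
    (h.mul_sub_one_mem i)
  have hj' := localized_mono (show {j} ⊆ ({i, j} : Finset (Fin (n + 1))) by simp)
    (h.mul_sub_one_mem j)
  refine ⟨hi, hj, ?_⟩
  have e : θ j - θ i = θ i * (toLaurent K n L * θ j - 1) - θ j * (toLaurent K n L * θ i - 1) := by
    ring
  rw [e]
  exact sub_mem (mul_mem_localized hi hj') (mul_mem_localized hj hi')

theorem pow_sub_pow_mem (h : IsNowhereZero I L θ) (i j : Fin (n + 1)) (m : ℕ) :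
    θ j ^ m - θ i ^ m ∈ localized I {i, j} := by
  obtain ⟨hi, hj, hij⟩ := h.localized_pair i j
  induction m with
  | zero => simp
  | succ m ih =>
    have e : θ j ^ (m + 1) - θ i ^ (m + 1) = θ j * (θ j ^ m - θ i ^ m) + θ i ^ m * (θ j - θ i) := by
      ring
    rw [e]
    exact add_mem (mul_mem_localized hj ih) (mul_mem_localized (pow_mem_localized_top hi m) hij)

theorem evalChart_sub_mem (h : IsNowhereZero I L θ) (i j : Fin (n + 1))
    (f : MvPolynomial (Fin (n + 1)) K) :
    evalChart (θ j) f - evalChart (θ i) f ∈ localized I {i, j} := by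
  rw [← sum_homogeneousComponent f, map_sum, map_sum, ← Finset.sum_sub_distrib]
  refine Submodule.sum_mem _ fun m _ => ?_
  rw [evalChart_of_homogeneous (homogeneousComponent_isHomogeneous m f),
    evalChart_of_homogeneous (homogeneousComponent_isHomogeneous m f), ← sub_mul]
  exact mul_mem_localized' (h.pow_sub_pow_mem i j m) (toLaurent_mem_localized_top _)

/-- Modulo `L - 1`, `f` becomes a form `F`. Local vanishing gives `x_k ^ N F ∈ I` for all `k`, hence
`L ^ M' F ∈ I` for a large power, and `L` is `1` in the quotient. -/
theorem mem_sup_iff (h : IsNowhereZero I L θ) (hI : IsHomogeneousIdeal I)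
    {f : MvPolynomial (Fin (n + 1)) K} :
    f ∈ I ⊔ Ideal.span {L - 1} ↔ ∀ i, evalChart (θ i) f ∈ localized I {i} := by
  refine ⟨fun hf i => evalChart_mem_of_mem_sup hI (h.mem_localized i) h.isHomogeneous
    (h.mul_sub_one_mem i) hf, fun hf => ?_⟩
  obtain ⟨M, F, hF, hfF⟩ := exists_homogeneous_sub_mem_span h.isHomogeneous f
  have h1 : ∀ i, ∃ N : ℕ, X i ^ N * F ∈ I := by
    intro i
    refine mem_localized_singleton_iff.1 (toLaurent_mem_of_evalChart_mem (h.mul_sub_one_mem i)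
      (h.mem_localized i) hF ?_)
    have := evalChart_mem_of_mem_sup hI (h.mem_localized i) h.isHomogeneous
      (h.mul_sub_one_mem i) (Ideal.mem_sup_right hfF)
    rw [map_sub] at this
    have h2 := sub_mem (hf i) this
    rwa [sub_sub_cancel] at h2
  choose N hN using h1
  obtain ⟨a, -, ha⟩ := exists_eq_sum_mul_pow (Finset.univ.sup N)
    (P := L ^ ((n + 1) * Finset.univ.sup N)) (by simpa using h.isHomogeneous.pow _)
  have h2 : L ^ ((n + 1) * Finset.univ.sup N) * F ∈ I := by
    rw [ha, Finset.sum_mul]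
    refine Ideal.sum_mem _ fun k _ => ?_
    obtain ⟨c, hc⟩ := Nat.exists_eq_add_of_le (Finset.le_sup (f := N) (Finset.mem_univ k))
    rw [hc]
    have e : a k * X k ^ (N k + c) * F = a k * X k ^ c * (X k ^ N k * F) := by ring
    rw [e]
    exact Ideal.mul_mem_left _ _ (hN k)
  set M' := (n + 1) * Finset.univ.sup N
  have e : f = (f - F) + (L ^ M' * F + F * (1 - L ^ M')) := by ring
  rw [e]
  exact add_mem (Ideal.mem_sup_right hfF) (add_mem (Ideal.mem_sup_left h2)
    (Ideal.mem_sup_right (Ideal.mul_mem_left _ _ (one_sub_pow_mem_span _ _))))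

theorem exists_evalChart_sub_mem (h : IsNowhereZero I L θ)
    {β : Fin (n + 1) → Laurent K n} (hβ : ∀ i, β i ∈ sections ⊤ 0 {i})
    (hβ' : ∀ i j, β j - β i ∈ localized I {i, j}) :
    ∃ f, ∀ i, β i - evalChart (θ i) f ∈ localized I {i} := by
  have hex : ∀ q : Fin (n + 1) × Fin (n + 1), ∃ N₀ : ℕ, ∀ N ≥ N₀,
      Laurent.x K q.2 ^ N * β q.2 ∈ localized ⊤ ∅ ∧
      Laurent.x K q.2 ^ N * (β q.2 - β q.1) ∈ localized I {q.1} := by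
    intro q
    obtain ⟨N₁, h1⟩ := exists_pow_mul_mem_localized (S := ∅) (i := q.2) (by rw [insert_empty_eq]; exact (hβ q.2).2)
    obtain ⟨N₂, h2⟩ := exists_pow_mul_mem_localized (S := {q.1}) (i := q.2)
      (by rw [Finset.pair_comm]; exact hβ' q.1 q.2)
    exact ⟨max N₁ N₂, fun N hN => ⟨h1 N (by omega), h2 N (by omega)⟩⟩
  choose N₀ hN₀ using hex
  set N := Finset.univ.sup N₀
  have hN : ∀ i k, Laurent.x K k ^ N * β k ∈ localized ⊤ ∅ ∧
      Laurent.x K k ^ N * (β k - β i) ∈ localized I {i} :=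
    fun i k => hN₀ (i, k) N (Finset.le_sup (f := N₀) (Finset.mem_univ (i, k)))
  have hg : ∀ k, ∃ g, toLaurent K n g = Laurent.x K k ^ N * β k := by
    intro k
    obtain ⟨N', g, _, e⟩ := (hN k k).1
    exact ⟨g, by simpa using e.symm⟩
  choose g hg using hg
  have hghom : ∀ k, (g k).IsHomogeneous N := by
    intro k
    refine isHomogeneous_of_toLaurent_mem ?_
    rw [hg k]
    have := mul_mem_laurentDegree (pow_mem_laurentDegree (x_mem_laurentDegree (K := K) k) N)
      (hβ k).1
    rwa [mul_one, add_zero] at this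
  set M := (n + 1) * N with hM
  obtain ⟨a, ha, hLa⟩ := exists_eq_sum_mul_pow N (P := L ^ M)
    (by simpa using h.isHomogeneous.pow M)
  have hF : (∑ k, a k * g k).IsHomogeneous M := by
    refine IsHomogeneous.sum _ _ _ fun k _ => ?_
    have := (ha k).mul (hghom k)
    rwa [show n * N + N = M by rw [hM]; ring] at this
  -- The forms `g k = x_k ^ N β k` are glued with the weights of `L ^ M = ∑ a k x_k ^ N`. On chart
  -- `i` the sum is `L ^ M β i` modulo `I`.
  refine ⟨∑ k, a k * g k, fun i => ?_⟩
  rw [evalChart_of_homogeneous hF]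
  have h1 : toLaurent K n (∑ k, a k * g k) - toLaurent K n L ^ M * β i ∈ localized I {i} := by
    rw [← map_pow, hLa, map_sum, map_sum, Finset.sum_mul, ← Finset.sum_sub_distrib]
    refine Submodule.sum_mem _ fun k _ => ?_
    rw [map_mul, map_mul, hg, map_pow, toLaurent_X]
    have e : toLaurent K n (a k) * (Laurent.x K k ^ N * β k) -
        toLaurent K n (a k) * Laurent.x K k ^ N * β i =
        toLaurent K n (a k) * (Laurent.x K k ^ N * (β k - β i)) := by ring
    rw [e]
    exact mul_mem_localized (toLaurent_mem_localized_top _) (hN i k).2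
  have h2 := h.pow_mul_pow_mul_sub_mem M (Finset.mem_singleton_self i) (hβ i).2
  have e : β i - θ i ^ M * toLaurent K n (∑ k, a k * g k) =
      -(θ i ^ M * (toLaurent K n (∑ k, a k * g k) - toLaurent K n L ^ M * β i)) -
        (toLaurent K n L ^ M * (θ i ^ M * β i) - β i) := by ring
  rw [e]
  exact sub_mem (neg_mem (mul_mem_localized (pow_mem_localized_top (h.mem_localized i) M) h1)) h2

/-- The ring of global functions on a finite subscheme. -/
theorem finrank_quotient_eq_length (h : IsNowhereZero I L θ) (hI : IsHomogeneousIdeal I) :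
    finrank K (MvPolynomial (Fin (n + 1)) K ⧸ (I ⊔ Ideal.span {L - 1})) = length I := by
  let E₀ : MvPolynomial (Fin (n + 1)) K →ₗ[K]
      ((Fin (0 + 1) ↪o Fin (n + 1)) → Laurent K n) :=
    LinearMap.pi fun s => (evalChart (θ (s 0))).toLinearMap
  have hE₀ : ∀ f, E₀ f = zeroCochain fun i => evalChart (θ i) f := fun f => rfl
  let E : MvPolynomial (Fin (n + 1)) K →ₗ[K] quotientCocycles I 0 :=
    E₀.codRestrict _ fun f => by
      rw [hE₀]
      exact zeroCochain_mem_quotientCocycles.2 ⟨fun i =>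
        ⟨evalChart_mem_laurentDegree (h.mem_degree i) f,
          evalChart_mem_localized (h.mem_localized i) f⟩, fun i j => h.evalChart_sub_mem i j f⟩
  let Q := (cochains I 0 0).submoduleOf (quotientCocycles I 0)
  have hker : LinearMap.ker (Q.mkQ ∘ₗ E) = (I ⊔ Ideal.span {L - 1}).restrictScalars K := by
    ext f
    rw [LinearMap.mem_ker, LinearMap.comp_apply, Submodule.mkQ_apply, Submodule.Quotient.mk_eq_zero,
      Submodule.restrictScalars_mem, h.mem_sup_iff hI]
    change E₀ f ∈ cochains I 0 0 ↔ _
    rw [hE₀, zeroCochain_mem_cochains]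
    exact forall_congr' fun i => ⟨fun hf => hf.2, fun hf =>
      ⟨evalChart_mem_laurentDegree (h.mem_degree i) f, hf⟩⟩
  have hsurj : Function.Surjective (Q.mkQ ∘ₗ E) := by
    intro x
    obtain ⟨⟨b, hb⟩, rfl⟩ := Q.mkQ_surjective x
    obtain ⟨β, rfl⟩ := exists_zeroCochain_eq b
    obtain ⟨h1, h2⟩ := zeroCochain_mem_quotientCocycles.1 hb
    obtain ⟨f, hf⟩ := h.exists_evalChart_sub_mem h1 h2
    refine ⟨f, ?_⟩
    rw [LinearMap.comp_apply, ← sub_eq_zero, ← map_sub, Submodule.mkQ_apply,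
      Submodule.Quotient.mk_eq_zero]
    change E₀ f - zeroCochain β ∈ cochains I 0 0
    rw [← neg_mem_iff, neg_sub, hE₀]
    exact zeroCochain_mem_cochains.2 fun i =>
      ⟨(laurentDegree K n 0).sub_mem (h1 i).1 (evalChart_mem_laurentDegree (h.mem_degree i) f), hf i⟩
  rw [length, ← (LinearMap.quotKerEquivOfSurjective _ hsurj).finrank_eq, hker]
  exact ((Submodule.Quotient.restrictScalarsEquiv K (I ⊔ Ideal.span {L - 1})).finrank_eq).symm

theorem mem_of_pow_mul_mem' (h : IsNowhereZero I L θ) {i : Fin (n + 1)} (M : ℕ)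
    {S : Finset (Fin (n + 1))} (hi : i ∈ S) {f : Laurent K n} (hf : f ∈ localized ⊤ S)
    (hθf : θ i ^ M * f ∈ localized I S) : f ∈ localized I S := by
  have e : f = toLaurent K n (L ^ M) * (θ i ^ M * f) -
      (toLaurent K n L ^ M * (θ i ^ M * f) - f) := by
    rw [map_pow]; ring
  rw [e]
  exact sub_mem (mul_mem_localized (toLaurent_mem_localized_top _) hθf)
    (h.pow_mul_pow_mul_sub_mem M hi hf)

/-- `H¹(ℐ(m))` vanishes if and only if the forms of degree `m` give all functions on `Z`. -/
theorem subsingleton_cohomology_one (h : IsNowhereZero I L θ) (hI : IsHomogeneousIdeal I)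
    (hn : 2 ≤ n) (m : ℕ) : Subsingleton (cohomology I m 1) ↔
      (homogeneousSubmodule (Fin (n + 1)) K m).map
        (Ideal.Quotient.mkₐ K (I ⊔ Ideal.span {L - 1})).toLinearMap = ⊤ := by
  rw [subsingleton_cohomology_one_iff hn]
  constructor
  · intro H
    rw [eq_top_iff]
    rintro x -
    obtain ⟨f, rfl⟩ := Ideal.Quotient.mk_surjective x
    -- Multiplication by `L ^ m` identifies the functions on the subscheme with the sections of its
    -- twist by `m`; multiplication by `θ ^ m` is the inverse, used for the converse.
    have hdeg : ∀ i, toLaurent K n L ^ m * evalChart (θ i) f ∈ sections ⊤ m {i} := by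
      intro i
      rw [← map_pow]
      refine ⟨?_, mul_mem_localized (toLaurent_mem_localized_top _)
        (evalChart_mem_localized (h.mem_localized i) f)⟩
      have := mul_mem_laurentDegree (toLaurent_mem_laurentDegree (h.isHomogeneous.pow m))
        (evalChart_mem_laurentDegree (h.mem_degree i) f)
      rwa [one_mul, add_zero] at this
    have hglue : ∀ i j, toLaurent K n L ^ m * evalChart (θ j) f -
        toLaurent K n L ^ m * evalChart (θ i) f ∈ localized I {i, j} := by
      intro i j
      rw [← mul_sub, ← map_pow]
      exact mul_mem_localized (toLaurent_mem_localized_top _) (h.evalChart_sub_mem i j f)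
    obtain ⟨g, hg, hgβ⟩ := H _ hdeg hglue
    obtain ⟨r, rfl⟩ := exists_toLaurent_eq_of_mem_localized (by omega) fun i => (hg i).2
    have hr : r.IsHomogeneous m := isHomogeneous_of_toLaurent_mem (hg 0).1
    refine ⟨r, hr, ?_⟩
    change Ideal.Quotient.mk _ r = _
    rw [eq_comm, Ideal.Quotient.eq, h.mem_sup_iff hI]
    intro i
    rw [map_sub, evalChart_of_homogeneous hr]
    have h1 := h.pow_mul_pow_mul_sub_mem m (Finset.mem_singleton_self i)
      (evalChart_mem_localized (h.mem_localized i) f)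
    have e : evalChart (θ i) f - θ i ^ m * toLaurent K n r =
        θ i ^ m * (toLaurent K n L ^ m * evalChart (θ i) f - toLaurent K n r) -
        (toLaurent K n L ^ m * (θ i ^ m * evalChart (θ i) f) - evalChart (θ i) f) := by ring
    rw [e]
    exact sub_mem (mul_mem_localized (pow_mem_localized_top (h.mem_localized i) m) (hgβ i)) h1
  · intro H β hβ hβ'
    have hdeg : ∀ i, θ i ^ m * β i ∈ sections ⊤ 0 {i} := by
      intro i
      refine ⟨?_, mul_mem_localized (pow_mem_localized_top (h.mem_localized i) m) (hβ i).2⟩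
      have := mul_mem_laurentDegree (pow_mem_laurentDegree (h.mem_degree i) m) (hβ i).1
      rwa [mul_neg_one, neg_add_cancel] at this
    have hglue : ∀ i j, θ j ^ m * β j - θ i ^ m * β i ∈ localized I {i, j} := by
      intro i j
      obtain ⟨hi, hj, -⟩ := h.localized_pair i j
      have e : θ j ^ m * β j - θ i ^ m * β i =
          θ j ^ m * (β j - β i) + (θ j ^ m - θ i ^ m) * β i := by ring
      rw [e]
      exact add_mem (mul_mem_localized (pow_mem_localized_top hj m) (hβ' i j))
        (mul_mem_localized' (h.pow_sub_pow_mem i j m)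
          (localized_mono (show {i} ⊆ ({i, j} : Finset (Fin (n + 1))) by simp) (hβ i).2))
    obtain ⟨f, hf⟩ := h.exists_evalChart_sub_mem hdeg hglue
    have hx : (Ideal.Quotient.mkₐ K (I ⊔ Ideal.span {L - 1})).toLinearMap f ∈
      (homogeneousSubmodule (Fin (n + 1)) K m).map
        (Ideal.Quotient.mkₐ K (I ⊔ Ideal.span {L - 1})).toLinearMap := by rw [H]; trivial
    obtain ⟨r, hr, e⟩ := hx
    have hfr : f - r ∈ I ⊔ Ideal.span {L - 1} := Ideal.Quotient.eq.1 e.symm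
    rw [h.mem_sup_iff hI] at hfr
    refine ⟨toLaurent K n r, fun i =>
      ⟨toLaurent_mem_laurentDegree hr, toLaurent_mem_localized_top _⟩, fun i => ?_⟩
    have h1 := hfr i
    rw [map_sub, evalChart_of_homogeneous hr] at h1
    have h2 := add_mem (hf i) h1
    have e : θ i ^ m * β i - evalChart (θ i) f +
        (evalChart (θ i) f - θ i ^ m * toLaurent K n r) =
        θ i ^ m * (β i - toLaurent K n r) := by ring
    rw [e] at h2
    refine h.mem_of_pow_mul_mem' m (Finset.mem_singleton_self i) ?_ h2
    exact sub_mem (hβ i).2 (toLaurent_mem_localized_top _)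

theorem eq_top_of_subsingleton_cohomology_one (h : IsNowhereZero I L θ) (hI : IsHomogeneousIdeal I)
    (hn : 2 ≤ n) {m : ℤ} (hm : m < 0) (H : Subsingleton (cohomology I m 1)) :
    I ⊔ Ideal.span {L - 1} = ⊤ := by
  rw [subsingleton_cohomology_one_iff hn] at H
  obtain ⟨k, rfl⟩ : ∃ k : ℕ, m = -k := ⟨m.natAbs, by omega⟩
  have hdeg : ∀ i, θ i ^ k ∈ laurentDegree K n (-k) := by
    intro i
    have := pow_mem_laurentDegree (h.mem_degree i) k
    rwa [mul_neg_one] at this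
  -- The nowhere vanishing section `L ^ (-k)` would lift to a global section of `𝒪(-k)`, which must
  -- be zero. Hence the subscheme is empty.
  obtain ⟨f, hf, hθf⟩ := H (fun i => θ i ^ k) (fun i =>
    ⟨hdeg i, pow_mem_localized_top (h.mem_localized i) k⟩) (fun i j => h.pow_sub_pow_mem i j k)
  obtain ⟨r, rfl⟩ := exists_toLaurent_eq_of_mem_localized (by omega) fun i => (hf i).2
  have h0 : toLaurent K n r = 0 := by
    rw [← AddMonoidAlgebra.coeff_eq_zero, ← Finsupp.support_eq_empty, Finset.eq_empty_iff_forall_notMem]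
    intro e he
    have h1 : ∑ i, e i = -(k : ℤ) := (hf 0).1 e he
    obtain ⟨d, -, rfl⟩ := exists_of_mem_support_toLaurent he
    have : 0 ≤ ∑ i, (expCast n d) i := Finset.sum_nonneg fun i _ => Int.natCast_nonneg (d i)
    omega
  rw [Ideal.eq_top_iff_one, h.mem_sup_iff hI]
  intro i
  have h1 := hθf i
  rw [h0, sub_zero] at h1
  have h2 := h.pow_mul_pow_sub_one_mem i k
  have h3 := mul_mem_localized (toLaurent_mem_localized_top (L ^ k)) h1
  rw [map_pow] at h3
  have := sub_mem h3 h2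
  rwa [sub_sub_cancel, ← map_one (evalChart (θ i))] at this

end IsNowhereZero

end ProjSub

namespace ProjSub

open MvPolynomial Module

theorem finrank_map_eq_of_forall {K M N N' : Type*} [Field K] [AddCommGroup M] [Module K M]
    [AddCommGroup N] [Module K N] [AddCommGroup N'] [Module K N'] (W : Submodule K M)
    (f : M →ₗ[K] N) (g : M →ₗ[K] N') (h : ∀ x ∈ W, f x = 0 ↔ g x = 0) :
    finrank K (W.map f) = finrank K (W.map g) := by
  have hker : LinearMap.ker (f.domRestrict W) = LinearMap.ker (g.domRestrict W) := by
    ext x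
    exact h x x.2
  rw [← LinearMap.range_domRestrict, ← LinearMap.range_domRestrict,
    ← (LinearMap.quotKerEquivRange (f.domRestrict W)).finrank_eq, hker,
    (LinearMap.quotKerEquivRange (g.domRestrict W)).finrank_eq]

/-! ### Restrictions of forms to affine quotients -/

section FormsImage

variable {K : Type*} [Field K] {n : ℕ}

/-- The image of the forms of degree `m` in a quotient of the polynomial ring. -/
def formsImage (𝔞 : Ideal (MvPolynomial (Fin (n + 1)) K)) (m : ℕ) :
    Submodule K (MvPolynomial (Fin (n + 1)) K ⧸ 𝔞) :=
  (homogeneousSubmodule (Fin (n + 1)) K m).map (Ideal.Quotient.mkₐ K 𝔞).toLinearMap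

variable {𝔞 𝔟 : Ideal (MvPolynomial (Fin (n + 1)) K)}

instance finiteDimensional_formsImage (m : ℕ) : FiniteDimensional K (formsImage 𝔞 m) :=
  Module.Finite.map _ _

theorem formsImage_one_pow (m : ℕ) : formsImage 𝔞 1 ^ m = formsImage 𝔞 m := by
  rw [formsImage, formsImage, ← Submodule.map_pow, homogeneousSubmodule_one_pow]

theorem map_formsImage (h : 𝔞 ≤ 𝔟) (m : ℕ) :
    (formsImage 𝔞 m).map (Ideal.Quotient.factorₐ K h).toLinearMap = formsImage 𝔟 m := by
  rw [formsImage, formsImage, ← Submodule.map_comp]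
  rfl

theorem one_mem_formsImage {L : MvPolynomial (Fin (n + 1)) K} (hL : L.IsHomogeneous 1)
    (h : L - 1 ∈ 𝔞) : 1 ∈ formsImage 𝔞 1 :=
  ⟨L, hL, (Ideal.Quotient.eq (x := L) (y := 1)).2 h⟩

theorem formsImage_eq_top_of_le (h : 𝔞 ≤ 𝔟) {m : ℕ} (hm : formsImage 𝔞 m = ⊤) :
    formsImage 𝔟 m = ⊤ := by
  rw [← map_formsImage h, hm, Submodule.map_top, LinearMap.range_eq_top]
  exact Ideal.Quotient.factor_surjective h

theorem finrank_formsImage_le_of_le (h : 𝔞 ≤ 𝔟) (m : ℕ) :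
    finrank K (formsImage 𝔟 m) ≤ finrank K (formsImage 𝔞 m) := by
  rw [← map_formsImage h]
  exact Submodule.finrank_map_le _ _

theorem finiteDimensional_quotient_of_le (h : 𝔞 ≤ 𝔟)
    [FiniteDimensional K (MvPolynomial (Fin (n + 1)) K ⧸ 𝔞)] :
    FiniteDimensional K (MvPolynomial (Fin (n + 1)) K ⧸ 𝔟) :=
  Module.Finite.of_surjective (Ideal.Quotient.factorₐ K h).toLinearMap
    (Ideal.Quotient.factor_surjective h)

theorem le_of_finrank_quotient_le (h : 𝔞 ≤ 𝔟)
    [FiniteDimensional K (MvPolynomial (Fin (n + 1)) K ⧸ 𝔞)]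
    (hle : finrank K (MvPolynomial (Fin (n + 1)) K ⧸ 𝔞) ≤
      finrank K (MvPolynomial (Fin (n + 1)) K ⧸ 𝔟)) : 𝔟 ≤ 𝔞 := by
  have := finiteDimensional_quotient_of_le h
  let φ := (Ideal.Quotient.factorₐ K h).toLinearMap
  have hsurj : Function.Surjective φ := Ideal.Quotient.factor_surjective h
  have hinj : Function.Injective φ := (LinearMap.injective_iff_surjective_of_finrank_eq_finrank
    (hle.antisymm (φ.finrank_le_finrank_of_surjective hsurj))).2 hsurj
  intro x hx
  refine Ideal.Quotient.eq_zero_iff_mem.1 (hinj ?_)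
  rw [map_zero]
  exact Ideal.Quotient.eq_zero_iff_mem.2 hx

theorem finrank_quotient_map_mk (h : 𝔞 ≤ 𝔟) :
    finrank K ((MvPolynomial (Fin (n + 1)) K ⧸ 𝔞) ⧸ 𝔟.map (Ideal.Quotient.mkₐ K 𝔞)) =
      finrank K (MvPolynomial (Fin (n + 1)) K ⧸ 𝔟) :=
  (DoubleQuot.quotQuotEquivQuotOfLEₐ K h).toLinearEquiv.finrank_eq

theorem formsImage_eq_top_of_finrank_le [IsAlgClosed K]
    [FiniteDimensional K (MvPolynomial (Fin (n + 1)) K ⧸ 𝔞)]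
    (h : SpansSmallQuotients (formsImage 𝔞 1) n) (hV : finrank K (formsImage 𝔞 1) = n + 1)
    (h1 : 1 ∈ formsImage 𝔞 1) (h𝔟 : 𝔞 ≤ 𝔟) {l : ℕ}
    (hl : finrank K (MvPolynomial (Fin (n + 1)) K ⧸ 𝔟) ≤ n * l + 1) : formsImage 𝔟 l = ⊤ := by
  have h2 := h.pow_sup_eq_top hV h1 l (𝔟.map (Ideal.Quotient.mkₐ K 𝔞))
    ((finrank_quotient_map_mk h𝔟).trans_le hl)
  have h3 := congrArg (Submodule.map (Ideal.Quotient.factorₐ K h𝔟).toLinearMap) h2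
  rw [Submodule.map_sup, formsImage_one_pow, map_formsImage, Submodule.map_top,
    LinearMap.range_eq_top.2 (Ideal.Quotient.factor_surjective h𝔟)] at h3
  rw [← h3, left_eq_sup, Submodule.map_le_iff_le_comap]
  have h4 : 𝔟.map (Ideal.Quotient.mkₐ K 𝔞) ≤ RingHom.ker (Ideal.Quotient.factorₐ K h𝔟) := by
    rw [Ideal.map_le_iff_le_comap]
    intro x hx
    exact Ideal.Quotient.eq_zero_iff_mem.2 hx
  intro x hx
  rw [Submodule.mem_comap]
  have h5 : Ideal.Quotient.factorₐ K h𝔟 x = 0 := h4 hx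
  exact (show (Ideal.Quotient.factorₐ K h𝔟).toLinearMap x = 0 from h5) ▸ zero_mem _

/-- Restriction to a subscheme whose length is the minimum on the left loses no more than it should:
forms of degree `l` span there. -/
theorem le_finrank_formsImage [IsAlgClosed K]
    [FiniteDimensional K (MvPolynomial (Fin (n + 1)) K ⧸ 𝔞)]
    (h : SpansSmallQuotients (formsImage 𝔞 1) n) (hV : finrank K (formsImage 𝔞 1) = n + 1)
    (h1 : 1 ∈ formsImage 𝔞 1) (h𝔟 : 𝔞 ≤ 𝔟) (l : ℕ) :
    min (finrank K (MvPolynomial (Fin (n + 1)) K ⧸ 𝔟)) (n * l + 1) ≤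
      finrank K (formsImage 𝔟 l) := by
  have := finiteDimensional_quotient_of_le h𝔟
  obtain ⟨J, hJ⟩ := exists_ideal_finrank_quotient (K := K)
    (min_le_left (finrank K (MvPolynomial (Fin (n + 1)) K ⧸ 𝔟)) (n * l + 1))
  have hle : 𝔟 ≤ J.comap (Ideal.Quotient.mk 𝔟) := fun x hx => by
    rw [Ideal.mem_comap, Ideal.Quotient.eq_zero_iff_mem.2 hx]
    exact zero_mem _
  have hJ' : finrank K (MvPolynomial (Fin (n + 1)) K ⧸ J.comap (Ideal.Quotient.mk 𝔟)) =
      min (finrank K (MvPolynomial (Fin (n + 1)) K ⧸ 𝔟)) (n * l + 1) := by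
    rw [← hJ, ← finrank_quotient_map_mk hle]
    have e : (J.comap (Ideal.Quotient.mk 𝔟)).map (Ideal.Quotient.mkₐ K 𝔟) = J :=
      Ideal.map_comap_of_surjective _ Ideal.Quotient.mk_surjective J
    rw [e]
  have h2 := formsImage_eq_top_of_finrank_le h hV h1 (h𝔟.trans hle)
    (hJ'.trans_le (min_le_right _ _))
  have h3 := finrank_formsImage_le_of_le hle l
  rw [h2, finrank_top, hJ'] at h3
  exact h3

/-- If the forms of degree `q` do not span, then a quotient of large length lies on a rational
normal curve. -/
theorem exists_rationalNormalCurve_of_formsImage_ne_top [IsAlgClosed K]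
    [FiniteDimensional K (MvPolynomial (Fin (n + 1)) K ⧸ 𝔞)]
    (h : SpansSmallQuotients (formsImage 𝔞 1) n) (hV : finrank K (formsImage 𝔞 1) = n + 1)
    (h1 : 1 ∈ formsImage 𝔞 1) {q : ℕ} (hn : 1 ≤ n) (hnq : 2 * n ≤ q) (hq3 : 3 ≤ q)
    (hdim : finrank K (MvPolynomial (Fin (n + 1)) K ⧸ 𝔞) ≤ n * q + n + 1)
    (hq : formsImage 𝔞 q ≠ ⊤) :
    ∃ (C : ClosedSubscheme K n) (𝔠 : Ideal (MvPolynomial (Fin (n + 1)) K)),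
      C.IsRationalNormalCurve ∧ 𝔞 ≤ 𝔠 ∧ C.ideal ≤ 𝔠 ∧
        n * q + 2 ≤ finrank K (MvPolynomial (Fin (n + 1)) K ⧸ 𝔠) := by
  set V := formsImage 𝔞 1
  rw [← formsImage_one_pow] at hq
  have hnoeth : IsNoetherianRing (MvPolynomial (Fin (n + 1)) K ⧸ 𝔞) :=
    IsNoetherianRing.of_finite K _
  -- A maximal ideal in this family defines a minimal subscheme on which forms of degree `q` do not
  -- span.
  obtain ⟨J, hJ, hmax⟩ := set_has_maximal_iff_noetherian.2 hnoeth
    {J : Ideal (MvPolynomial (Fin (n + 1)) K ⧸ 𝔞) | V ^ q ⊔ J.restrictScalars K ≠ ⊤}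
    ⟨⊥, by
      rw [Set.mem_ofPred_eq, Submodule.restrictScalars_bot, sup_bot_eq]
      exact hq⟩
  let π := Ideal.Quotient.mkₐ K J
  have hπ : Function.Surjective π := Ideal.Quotient.mkₐ_surjective K J
  have hker : LinearMap.ker π.toLinearMap = J.restrictScalars K := by
    ext x
    exact Ideal.Quotient.eq_zero_iff_mem
  set W := V.map π.toLinearMap with hW
  have hWq : W ^ q = (V ^ q).map π.toLinearMap := (Submodule.map_pow _ _ _).symm
  have htop : ∀ J' : Submodule K _, (J.restrictScalars K ≤ J') → (V ^ q ⊔ J' = ⊤ ↔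
      W ^ q ⊔ J'.map π.toLinearMap = ⊤) := by
    intro J' hJ'
    rw [hWq, ← Submodule.map_sup]
    constructor
    · intro h; rw [h, Submodule.map_top]; exact LinearMap.range_eq_top.2 hπ
    · intro h
      have := congrArg (Submodule.comap π.toLinearMap) h
      rwa [Submodule.comap_map_eq, hker, Submodule.comap_top, sup_eq_left.2] at this
      exact hJ'.trans le_sup_right
  have hWtop : W ^ q ≠ ⊤ := by
    intro hcon
    refine hJ ((htop _ le_rfl).2 ?_)
    rw [hcon, top_sup_eq]
  -- Dividing by a nonzero ideal makes the forms of degree `q` span. Were that ideal contained in `W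
  -- ^ q`, they would have spanned before.
  have hbot : ∀ J' : Ideal ((MvPolynomial (Fin (n + 1)) K ⧸ 𝔞) ⧸ J),
      J'.restrictScalars K ≤ W ^ q → J' = ⊥ := by
    intro J' hJ'
    have hle : J ≤ J'.comap π := fun x hx => by
      rw [Ideal.mem_comap, show π x = 0 from Ideal.Quotient.eq_zero_iff_mem.2 hx]
      exact zero_mem _
    have hmap : (J'.comap π).map π = J' := Ideal.map_comap_of_surjective _ hπ J'
    rcases hle.eq_or_lt with heq | hlt
    · rw [← hmap, ← heq, eq_bot_iff, Ideal.map_le_iff_le_comap]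
      intro x hx
      exact Ideal.Quotient.eq_zero_iff_mem.2 hx
    · exfalso
      have h2 : V ^ q ⊔ (J'.comap π).restrictScalars K = ⊤ := by
        by_contra hcon
        exact hmax _ hcon hlt
      rw [htop _ hle, sup_eq_left.2] at h2
      · exact hWtop h2
      · rw [Submodule.map_le_iff_le_comap]
        exact fun x hx => hJ' hx
  have h1' : 1 ∈ W := ⟨1, h1, map_one π⟩
  have hBdim : n * q + 2 ≤ finrank K ((MvPolynomial (Fin (n + 1)) K ⧸ 𝔞) ⧸ J) := by
    by_contra! hlt
    exact hJ (h.pow_sup_eq_top hV h1 q J (by omega))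
  have hn1 : n ≤ n * q := Nat.le_mul_of_pos_right n (by omega)
  have hle : finrank K ((MvPolynomial (Fin (n + 1)) K ⧸ 𝔞) ⧸ J) ≤
      finrank K (MvPolynomial (Fin (n + 1)) K ⧸ 𝔞) :=
    π.toLinearMap.finrank_le_finrank_of_surjective hπ
  have hlt : finrank K ↥(W ^ q) < finrank K ((MvPolynomial (Fin (n + 1)) K ⧸ 𝔞) ⧸ J) :=
    Submodule.finrank_lt hWtop
  have hWdim : finrank K ↥(W ^ q) ≤ n * q + n := by omega
  obtain ⟨v, hvW, hli, hrel⟩ := (h.map_quotient J).exists_basis_of_pow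
    (h.finrank_map_quotient hV J (by omega)) h1' hn hbot (by omega) hnq hq3 hWdim
  let f := π.comp (Ideal.Quotient.mkₐ K 𝔞)
  have hf : Function.Surjective f := hπ.comp (Ideal.Quotient.mkₐ_surjective K 𝔞)
  have hWf : W = (homogeneousSubmodule (Fin (n + 1)) K 1).map f.toLinearMap := by
    rw [hW]
    exact (Submodule.map_comp _ _ _).symm
  obtain ⟨C, hC, hCf⟩ := exists_rationalNormalCurve_of_relations hn f v (fun i hi => hWf ▸ hvW i hi)
    hli (hWf ▸ h1') hrel
  refine ⟨C, RingHom.ker f, hC, fun x hx => ?_, hCf, ?_⟩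
  · rw [RingHom.mem_ker, AlgHom.comp_apply,
      show Ideal.Quotient.mkₐ K 𝔞 x = 0 from Ideal.Quotient.eq_zero_iff_mem.2 hx, map_zero]
  · rw [(Ideal.quotientKerAlgEquivOfSurjective hf).toLinearEquiv.finrank_eq]
    exact hBdim

end FormsImage

/-! ### Degrees, regularity and uniform position -/

section Geometry

variable {K : Type*} [Field K] {n : ℕ} {Γ : ClosedSubscheme K n}
  {L : MvPolynomial (Fin (n + 1)) K} {θ : Fin (n + 1) → Laurent K n}

theorem ClosedSubscheme.InLinearlyGeneralPosition.interDegree_le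
    (hΓ : Γ.InLinearlyGeneralPosition) (hn : 1 ≤ n) {Z : ClosedSubscheme K n}
    (hZ : Z.IsPlane (n - 1)) : Γ.interDegree Z ≤ n := by
  have h1 : n - 1 < Γ.secantIndex := by rw [hΓ]; omega
  have h2 := Nat.notMem_of_lt_sInf h1
  by_contra! hcon
  exact h2 ⟨Z, hZ, by omega⟩

namespace IsNowhereZero

theorem finrank_quotient_sup_eq_interDegree (h : IsNowhereZero Γ.ideal L θ)
    (Z : ClosedSubscheme K n) :
    finrank K (MvPolynomial (Fin (n + 1)) K ⧸ (Γ.ideal ⊔ Z.ideal ⊔ Ideal.span {L - 1})) =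
      Γ.interDegree Z :=
  (h.mono le_sup_left).finrank_quotient_eq_length (IsHomogeneousIdeal.sup Γ.homogeneous Z.homogeneous)

theorem finrank_quotient_eq_degree (h : IsNowhereZero Γ.ideal L θ) :
    finrank K (MvPolynomial (Fin (n + 1)) K ⧸ (Γ.ideal ⊔ Ideal.span {L - 1})) = Γ.degree :=
  h.finrank_quotient_eq_length Γ.homogeneous

theorem interDegree_le_degree (h : IsNowhereZero Γ.ideal L θ) (hd : 0 < Γ.degree)
    (Z : ClosedSubscheme K n) : Γ.interDegree Z ≤ Γ.degree := by
  have : FiniteDimensional K (MvPolynomial (Fin (n + 1)) K ⧸ (Γ.ideal ⊔ Ideal.span {L - 1})) :=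
    Module.finite_of_finrank_pos (by rwa [h.finrank_quotient_eq_degree])
  rw [← h.finrank_quotient_eq_degree, ← h.finrank_quotient_sup_eq_interDegree]
  have hle : Γ.ideal ⊔ Ideal.span {L - 1} ≤ Γ.ideal ⊔ Z.ideal ⊔ Ideal.span {L - 1} :=
    sup_le_sup_right le_sup_left _
  exact (Ideal.Quotient.factorₐ K hle).toLinearMap.finrank_le_finrank_of_surjective
    (Ideal.Quotient.factor_surjective hle)

/-- A form vanishing on the affine scheme `Γ` vanishes on the projective scheme `Γ`. -/
theorem mem_of_mem_sup (h : IsNowhereZero Γ.ideal L θ) {m : ℕ}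
    {f : MvPolynomial (Fin (n + 1)) K} (hf : f.IsHomogeneous m)
    (hfL : f ∈ Γ.ideal ⊔ Ideal.span {L - 1}) : f ∈ Γ.ideal := by
  rw [h.mem_sup_iff Γ.homogeneous] at hfL
  exact Γ.saturated f fun i => mem_localized_singleton_iff.1
    (toLaurent_mem_of_evalChart_mem (h.mul_sub_one_mem i) (h.mem_localized i) hf (hfL i))

theorem finrank_formsImage_eq_hilbertFunction (h : IsNowhereZero Γ.ideal L θ) (m : ℕ) :
    finrank K (formsImage (Γ.ideal ⊔ Ideal.span {L - 1}) m) = Γ.hilbertFunction m := by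
  refine finrank_map_eq_of_forall _ _ _ fun x hx => ?_
  change Ideal.Quotient.mk _ x = 0 ↔ Ideal.Quotient.mk _ x = 0
  rw [Ideal.Quotient.eq_zero_iff_mem, Ideal.Quotient.eq_zero_iff_mem]
  exact ⟨h.mem_of_mem_sup hx, fun hx => Ideal.mem_sup_left hx⟩

theorem finrank_quotient_span_singleton_le (h : IsNowhereZero Γ.ideal L θ)
    (hΓ : Γ.InLinearlyGeneralPosition) (hn : 1 ≤ n) {v : MvPolynomial (Fin (n + 1)) K}
    (hv : v ∈ homogeneousSubmodule (Fin (n + 1)) K 1) (hv0 : v ≠ 0) :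
    finrank K ((MvPolynomial (Fin (n + 1)) K ⧸ (Γ.ideal ⊔ Ideal.span {L - 1})) ⧸
      Ideal.span {Ideal.Quotient.mkₐ K (Γ.ideal ⊔ Ideal.span {L - 1}) v}) ≤ n := by
  obtain ⟨Z, hZ, hZv⟩ := exists_hyperplane hn hv hv0
  have h1 := hΓ.interDegree_le hn hZ
  rw [← h.finrank_quotient_sup_eq_interDegree, hZv, sup_right_comm,
    ← (DoubleQuot.quotQuotEquivQuotSupₐ K _ _).toLinearEquiv.finrank_eq, Ideal.map_span,
    Set.image_singleton] at h1
  exact h1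

theorem eq_zero_of_mem_sup (h : IsNowhereZero Γ.ideal L θ)
    (hΓ : Γ.InLinearlyGeneralPosition) (hn : 1 ≤ n) (hd : n < Γ.degree)
    {v : MvPolynomial (Fin (n + 1)) K} (hv : v ∈ homogeneousSubmodule (Fin (n + 1)) K 1)
    (hvL : v ∈ Γ.ideal ⊔ Ideal.span {L - 1}) : v = 0 := by
  by_contra hv0
  have h1 := h.finrank_quotient_span_singleton_le hΓ hn hv hv0
  rw [show Ideal.Quotient.mkₐ K (Γ.ideal ⊔ Ideal.span {L - 1}) v = 0 from
    Ideal.Quotient.eq_zero_iff_mem.2 hvL, Ideal.span_singleton_eq_bot.2 rfl,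
    (AlgEquiv.quotientBot K _).toLinearEquiv.finrank_eq, h.finrank_quotient_eq_degree] at h1
  omega

theorem finrank_formsImage_one (h : IsNowhereZero Γ.ideal L θ)
    (hΓ : Γ.InLinearlyGeneralPosition) (hn : 1 ≤ n) (hd : n < Γ.degree) :
    finrank K (formsImage (Γ.ideal ⊔ Ideal.span {L - 1}) 1) = n + 1 := by
  have h1 := finrank_map_eq_of_forall (homogeneousSubmodule (Fin (n + 1)) K 1)
    (Ideal.Quotient.mkₐ K (Γ.ideal ⊔ Ideal.span {L - 1})).toLinearMap LinearMap.id
    fun x hx => ⟨fun hx0 => h.eq_zero_of_mem_sup hΓ hn hd hx (Ideal.Quotient.eq_zero_iff_mem.1 hx0),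
      fun hx0 => by rw [show x = 0 from hx0, map_zero]⟩
  rw [Submodule.map_id, finrank_homogeneousSubmodule_one, Fintype.card_fin] at h1
  exact h1

theorem spansSmallQuotients (h : IsNowhereZero Γ.ideal L θ) [IsAlgClosed K]
    (hΓ : Γ.InLinearlyGeneralPosition) (hn : 1 ≤ n) (hd : n < Γ.degree) :
    SpansSmallQuotients (formsImage (Γ.ideal ⊔ Ideal.span {L - 1}) 1) n := by
  have : FiniteDimensional K (MvPolynomial (Fin (n + 1)) K ⧸ (Γ.ideal ⊔ Ideal.span {L - 1})) :=
    Module.finite_of_finrank_pos (by rw [h.finrank_quotient_eq_degree]; omega)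
  refine spansSmallQuotients_of_finrank_le (h.finrank_formsImage_one hΓ hn hd)
    (by rwa [h.finrank_quotient_eq_degree]) ?_
  rintro _ ⟨v, hv, rfl⟩ hv0
  exact h.finrank_quotient_span_singleton_le hΓ hn hv fun h0 => hv0 (by rw [h0, map_zero])

/-- Only the first cohomology matters: in degree `n` the twist is `m + 1 - n ≥ -n`, so the top
cohomology of `𝒪` does not interfere. -/
theorem isRegular_add_one_iff (h : IsNowhereZero Γ.ideal L θ) (hn : 2 ≤ n) (m : ℕ) :
    Γ.IsRegular (m + 1) ↔ formsImage (Γ.ideal ⊔ Ideal.span {L - 1}) m = ⊤ := by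
  have h1 := h.subsingleton_cohomology_one Γ.homogeneous hn m
  constructor
  · intro H
    have h2 := H 1 le_rfl
    rw [Nat.cast_one, add_sub_cancel_right] at h2
    exact h1.1 h2
  · intro H i hi
    match i, hi with
    | 1, _ =>
      rw [Nat.cast_one, add_sub_cancel_right]
      exact h1.2 H
    | p + 2, _ =>
      refine h.subsingleton_cohomology ?_
      push_cast
      omega

theorem one_le_of_isRegular (h : IsNowhereZero Γ.ideal L θ) (hn : 2 ≤ n) (hd : 0 < Γ.degree)
    {p : ℤ} (hp : Γ.IsRegular p) : 1 ≤ p := by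
  by_contra! hlt
  have h1 := hp 1 le_rfl
  have h2 := h.eq_top_of_subsingleton_cohomology_one Γ.homogeneous hn (by push_cast; omega) h1
  rw [← h.finrank_quotient_eq_degree, h2] at hd
  have : Subsingleton (MvPolynomial (Fin (n + 1)) K ⧸ (⊤ : Ideal (MvPolynomial (Fin (n + 1)) K))) :=
    Ideal.Quotient.subsingleton_iff.2 rfl
  rw [finrank_zero_of_subsingleton] at hd
  omega

theorem reg_eq_iff (h : IsNowhereZero Γ.ideal L θ) [IsAlgClosed K]
    (hΓ : Γ.InLinearlyGeneralPosition) (hn : 2 ≤ n) (hd : n < Γ.degree) {q : ℕ}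
    (hq : Γ.degree ≤ n * (q + 1) + 1) :
    Γ.reg = q + 2 ↔ formsImage (Γ.ideal ⊔ Ideal.span {L - 1}) q ≠ ⊤ := by
  have : FiniteDimensional K (MvPolynomial (Fin (n + 1)) K ⧸ (Γ.ideal ⊔ Ideal.span {L - 1})) :=
    Module.finite_of_finrank_pos (by rw [h.finrank_quotient_eq_degree]; omega)
  have h1 : 1 ∈ formsImage (Γ.ideal ⊔ Ideal.span {L - 1}) 1 :=
    one_mem_formsImage h.isHomogeneous (Ideal.mem_sup_right (Ideal.mem_span_singleton_self _))
  -- The infimum in `ℤ` is meaningful only for a set bounded below; a nonempty subscheme is never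
  -- `p`-regular for `p ≤ 0`.
  have hbdd : BddBelow {p : ℤ | Γ.IsRegular p} :=
    ⟨1, fun p hp => h.one_le_of_isRegular hn (by omega) hp⟩
  have hreg : Γ.IsRegular ((q + 1 : ℕ) + 1) := by
    rw [h.isRegular_add_one_iff hn]
    refine formsImage_eq_top_of_finrank_le (h.spansSmallQuotients hΓ (by omega) hd)
      (h.finrank_formsImage_one hΓ (by omega) hd) h1 le_rfl ?_
    rwa [h.finrank_quotient_eq_degree]
  constructor
  · intro hr htop
    have h2 := csInf_le hbdd ((h.isRegular_add_one_iff hn q).2 htop)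
    change Γ.reg ≤ _ at h2
    omega
  · intro hne
    refine le_antisymm ((csInf_le hbdd hreg).trans (by push_cast; omega)) ?_
    refine le_csInf ⟨_, hreg⟩ fun p hp => ?_
    by_contra! hlt
    have hp1 := h.one_le_of_isRegular hn (by omega) hp
    obtain ⟨m, rfl⟩ : ∃ m : ℕ, p = m + 1 := ⟨(p - 1).toNat, by omega⟩
    rw [Set.mem_ofPred_eq, h.isRegular_add_one_iff hn] at hp
    refine hne (eq_top_iff.2 ?_)
    -- As `1 ∈ V`, the powers of `V` increase, so spanning in degree `m ≤ q` forces spanning in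
    -- degree `q`.
    rw [← hp, ← formsImage_one_pow m, ← formsImage_one_pow q]
    exact SpansSmallQuotients.pow_sup_mono h1 (by omega)

theorem formsImage_ne_top_of_interDegree (h : IsNowhereZero Γ.ideal L θ)
    {C : ClosedSubscheme K n} (hC : C.IsRationalNormalCurve) {q : ℕ}
    (hq : n * q + 2 ≤ Γ.interDegree C) : formsImage (Γ.ideal ⊔ Ideal.span {L - 1}) q ≠ ⊤ := by
  intro htop
  have h1 := formsImage_eq_top_of_le (𝔟 := Γ.ideal ⊔ C.ideal ⊔ Ideal.span {L - 1})
    (sup_le_sup_right le_sup_left _) htop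
  have h2 := finrank_formsImage_le_of_le (le_sup_of_le_left le_sup_right :
    C.ideal ≤ Γ.ideal ⊔ C.ideal ⊔ Ideal.span {L - 1}) q
  rw [h1, finrank_top, h.finrank_quotient_sup_eq_interDegree] at h2
  have h3 : finrank K (formsImage C.ideal q) ≤ n * q + 1 := hC.finrank_le q
  omega

theorem inUniformPosition (h : IsNowhereZero Γ.ideal L θ) [IsAlgClosed K]
    (hΓ : Γ.InLinearlyGeneralPosition) (hn : 1 ≤ n) (hd : n < Γ.degree) (hfin : Γ.IsFinite)
    {C : ClosedSubscheme K n} (hC : C.IsRationalNormalCurve) (hΓC : Γ.IsSubscheme C) :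
    Γ.InUniformPosition := by
  have : FiniteDimensional K (MvPolynomial (Fin (n + 1)) K ⧸ (Γ.ideal ⊔ Ideal.span {L - 1})) :=
    Module.finite_of_finrank_pos (by rw [h.finrank_quotient_eq_degree]; omega)
  have h1 : 1 ∈ formsImage (Γ.ideal ⊔ Ideal.span {L - 1}) 1 :=
    one_mem_formsImage h.isHomogeneous (Ideal.mem_sup_right (Ideal.mem_span_singleton_self _))
  -- General position of `Γ` bounds the Hilbert function of `Y` from below, and `Y ⊆ C` bounds it
  -- from above.
  have hY : ∀ Y : ClosedSubscheme K n, Y.IsSubscheme Γ → ∀ l,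
      Y.hilbertFunction l = min Y.degree (n * l + 1) := by
    intro Y hY l
    have hle : Γ.ideal ⊔ Ideal.span {L - 1} ≤ Y.ideal ⊔ Ideal.span {L - 1} :=
      sup_le_sup_right hY _
    have := finiteDimensional_quotient_of_le hle
    have h2 := le_finrank_formsImage (h.spansSmallQuotients hΓ hn hd)
      (h.finrank_formsImage_one hΓ hn hd) h1 hle l
    have h3 := finrank_formsImage_le_of_le
      ((hΓC.trans hY).trans le_sup_left : C.ideal ≤ Y.ideal ⊔ Ideal.span {L - 1}) l
    have h4 : finrank K (formsImage C.ideal l) ≤ n * l + 1 := hC.finrank_le l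
    have h5 := Submodule.finrank_le (formsImage (Y.ideal ⊔ Ideal.span {L - 1}) l)
    rw [(h.mono hY).finrank_quotient_eq_degree,
      (h.mono hY).finrank_formsImage_eq_hilbertFunction] at *
    omega
  refine ⟨hfin, fun f hf hfΓ => h.eq_zero_of_mem_sup hΓ hn hd hf (Ideal.mem_sup_left hfΓ),
    fun Y hYΓ l => ?_⟩
  have h2 : Y.degree ≤ Γ.degree := by
    rw [← h.finrank_quotient_eq_degree, ← (h.mono hYΓ).finrank_quotient_eq_degree]
    have hle : Γ.ideal ⊔ Ideal.span {L - 1} ≤ Y.ideal ⊔ Ideal.span {L - 1} :=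
      sup_le_sup_right hYΓ _
    exact (Ideal.Quotient.factorₐ K hle).toLinearMap.finrank_le_finrank_of_surjective
      (Ideal.Quotient.factor_surjective hle)
  rw [hY Y hYΓ, hY Γ le_rfl]
  omega

end IsNowhereZero

end Geometry

theorem ceil_sub_one_div {n d q r : ℕ} (hdqr : d = n * q + r + 2) (hr : r < n) :
    ⌈((d : ℚ) - 1) / n⌉ = q + 1 := by
  have hn : (0 : ℚ) < n := by exact_mod_cast (by omega : 0 < n)
  have hr' : (r : ℚ) + 1 ≤ n := by exact_mod_cast hr
  rw [Int.ceil_eq_iff, lt_div_iff₀ hn, div_le_iff₀ hn, hdqr]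
  push_cast
  constructor <;> nlinarith [(Nat.cast_nonneg r : (0 : ℚ) ≤ r)]

end ProjSub

/-! ### Extremal regularity and rational normal curves -/

open ProjSub MvPolynomial Module

theorem corollary1p4 {K : Type*} [Field K] [IsAlgClosed K] [CharZero K]
    (n : ℕ) (hn : 2 ≤ n) (Γ : ProjSub.ClosedSubscheme K n) (hfin : Γ.IsFinite)
    (hΓ : Γ.InLinearlyGeneralPosition)
    (d : ℕ) (hdeg : Γ.degree = d) (hd : 4 * n ^ 2 + 6 * n + 1 ≤ d)
    (q r : ℕ) (hdqr : d = n * q + r + 2) (hr : r < n) :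
    (Γ.reg = ⌈((d : ℚ) - 1) / n⌉ + 1 ↔ (d : ℤ) - r ≤ Γ.rho) ∧
    (r = 0 → Γ.reg = ⌈((d : ℚ) - 1) / n⌉ + 1 →
      (∃ C : ProjSub.ClosedSubscheme K n, C.IsRationalNormalCurve ∧ Γ.IsSubscheme C) ∧
      Γ.InUniformPosition) := by
  have hn1 : 1 ≤ n := by omega
  obtain ⟨L, θ, h⟩ := exists_isNowhereZero Γ.homogeneous
    fun i => finiteDimensional_chart Γ.homogeneous i (hfin i)
  have hnd : n < Γ.degree := by omega
  -- Otherwise `d` would be at most `2n² + n + 1`. The Castelnuovo argument needs `q ≥ 2n`, and `q ≥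
  -- 3` follows from it.
  have hq : 2 * n ≤ q := by
    by_contra! hlt
    have : n * q ≤ n * (2 * n) := Nat.mul_le_mul_left n hlt.le
    nlinarith
  have hdq : n * (q + 1) = n * q + n := Nat.mul_succ n q
  have : FiniteDimensional K (MvPolynomial (Fin (n + 1)) K ⧸ (Γ.ideal ⊔ Ideal.span {L - 1})) :=
    Module.finite_of_finrank_pos (by rw [h.finrank_quotient_eq_degree]; omega)
  have h1 : 1 ∈ formsImage (Γ.ideal ⊔ Ideal.span {L - 1}) 1 :=
    one_mem_formsImage h.isHomogeneous (Ideal.mem_sup_right (Ideal.mem_span_singleton_self _))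
  have hreg : Γ.reg = ⌈((d : ℚ) - 1) / n⌉ + 1 ↔
      formsImage (Γ.ideal ⊔ Ideal.span {L - 1}) q ≠ ⊤ := by
    rw [ceil_sub_one_div hdqr hr, ← h.reg_eq_iff hΓ hn hnd (by omega), add_assoc]
    rfl
  have hcurve (hne : formsImage (Γ.ideal ⊔ Ideal.span {L - 1}) q ≠ ⊤) :=
    exists_rationalNormalCurve_of_formsImage_ne_top (h.spansSmallQuotients hΓ hn1 hnd)
      (h.finrank_formsImage_one hΓ hn1 hnd) h1 hn1 hq (by omega)
      (by rw [h.finrank_quotient_eq_degree]; omega) hne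
  refine ⟨hreg.trans ⟨fun hne => ?_, fun hrho => ?_⟩, fun hr0 hne => ?_⟩
  · obtain ⟨C, 𝔠, hC, hΓ𝔠, hC𝔠, hdim⟩ := hcurve hne
    -- The scheme defined by `𝔠` lies in `Γ ∩ C`, so that intersection has length at least `nq + 2 =
    -- d - r`.
    have hle : Γ.ideal ⊔ C.ideal ⊔ Ideal.span {L - 1} ≤ 𝔠 :=
      sup_le (sup_le (le_sup_left.trans hΓ𝔠) hC𝔠) (le_sup_right.trans hΓ𝔠)
    have := finiteDimensional_quotient_of_le (K := K) (sup_le_sup_right le_sup_left _ :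
      Γ.ideal ⊔ Ideal.span {L - 1} ≤ Γ.ideal ⊔ C.ideal ⊔ Ideal.span {L - 1})
    have h2 : finrank K (MvPolynomial (Fin (n + 1)) K ⧸ 𝔠) ≤
        finrank K (MvPolynomial (Fin (n + 1)) K ⧸ (Γ.ideal ⊔ C.ideal ⊔ Ideal.span {L - 1})) :=
      (Ideal.Quotient.factorₐ K hle).toLinearMap.finrank_le_finrank_of_surjective
        (Ideal.Quotient.factor_surjective hle)
    rw [h.finrank_quotient_sup_eq_interDegree] at h2
    have h3 : Γ.interDegree C ≤ Γ.rho := by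
      refine le_csSup ⟨Γ.degree, ?_⟩ ⟨C, hC, rfl⟩
      rintro _ ⟨C', -, rfl⟩
      exact h.interDegree_le_degree (by omega) C'
    omega
  -- An empty supremum would be `0`, below `d - r = nq + 2`. Being nonempty and bounded by `d`, the
  -- set contains its supremum.
  · have hne : {k : ℕ | ∃ C : ClosedSubscheme K n,
        C.IsRationalNormalCurve ∧ Γ.interDegree C = k}.Nonempty := by
      by_contra hemp
      have h2 : Γ.rho = 0 := by
        rw [ClosedSubscheme.rho, Set.not_nonempty_iff_eq_empty.1 hemp, csSup_empty]
        rfl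
      omega
    obtain ⟨C, hC, hCdeg⟩ := Nat.sSup_mem hne ⟨Γ.degree, by
      rintro _ ⟨C', -, rfl⟩
      exact h.interDegree_le_degree (by omega) C'⟩
    change Γ.interDegree C = Γ.rho at hCdeg
    exact h.formsImage_ne_top_of_interDegree hC (by omega)
  · obtain ⟨C, 𝔠, hC, hΓ𝔠, hC𝔠, hdim⟩ := hcurve (hreg.1 hne)
    -- For `r = 0` the scheme defined by `𝔠` has length at least `nq + 2 = d`, so it is all of `Γ`.
    -- Saturation then carries the components of the equations of `C` into `I(Γ)`.
    have hCΓ : Γ.IsSubscheme C := by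
      have h2 := le_of_finrank_quotient_le hΓ𝔠 (by rw [h.finrank_quotient_eq_degree]; omega)
      intro f hf
      rw [← sum_homogeneousComponent f]
      exact Ideal.sum_mem _ fun m _ => h.mem_of_mem_sup (homogeneousComponent_isHomogeneous m f)
        (h2 (hC𝔠 (C.homogeneous f hf m)))
    exact ⟨⟨C, hC, hCΓ⟩, h.inUniformPosition hΓ hn1 hnd hfin hC hCΓ⟩

end
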